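/- **Theorem.** Let $G=(V,E,\mathcal P,(V_\Diamond,V_\square))$ be a finite non-empty parity game: $V$ is partitioned into the vertices $V_\Diamond$ of player Even and $V_\square$ of player Odd, $E$ is total, $\mathcal P:V\to\mathbb N$, and Even wins an infinite play iff the least priority occurring infinitely often is even. Let $n=|V|$, $m=|E|$, let $d$ be one larger than the largest priority occurring in $G$, let $V_i=\{v\in V\mid\mathcal P(v)=i\}$ and $n_i=|V_i|$. *Measures.* Let $\mathbb M$ consist of an element $\top$ and all $d$-tuples (positions $0,\dots,d-1$) that are $0$ at even positions and at most $n_i$ at each odd position $i$, ordered lexicographically with $\top$ as greatest element; $<_i,\le_i$ compare tuples lexicographically up to and including position $i$, with $\top$ above all tuples. For $\rho:V\to\mathbb M$ and $w\in v^\bullet=\{w\mid (v,w)\in E\}$ let $\mathrm{Prog}(\rho,v,w)$ be the least $x\in\mathbb M$ with $x\ge_{\mathcal P(v)}\rho(w)$ if $\mathcal P(v)$ is even, and with $x>_{\mathcal P(v)}\rho(w)$ or $x=\rho(w)=\top$ if $\mathcal P(v)$ is odd. $\mathrm{Lift}(\rho,v)$ replaces $\rho(v)$ by the maximum of $\rho(v)$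 and of $\min_{w\in v^\bullet}\mathrm{Prog}(\rho,v,w)$ if $v\in V_\Diamond$, resp. $\max_{w\in v^\bullet}\mathrm{Prog}(\rho,v,w)$ if $v\in V_\square$; $v$ *can be lifted* if this increases $\rho(v)$. For $U\subseteq X\subseteq W\subseteq V$, the attractor of a player into $U$ in the context $W$ guarded by $X$ is the least $A$ with $U\subseteq A\subseteq X$ containing each $u\in X$ of that player with $u^\bullet\cap A\ne\emptyset$ and each $u\in X$ of the opponent with $u^\bullet\cap W\subseteq A$; if $X$ is not mentioned, $X=W$. *The algorithm Solve.* Start with $\rho=(0,\dots,0)$ everywhere and $\sigma$ (a partial strategy for Odd) empty, and call $\textsf{SPM-Within}(V)$, where $\textsf{SPM-Within}(W)$ is: while $W\neq\emptyset$, 1. lift vertices $w\in W$ that can be lifted, in an arbitrary order, until there are none or some $v\in W$ gets $\rho(v)=\top$; in the first case, return; 2. let $k=\mathcal P(v)$; if $v\in V_\square$, let $\sigma(v)$ be a $\le_k$-maximal (with respect to $\rho$) vertex of $v^\bullet\cap W$; 3. let $\textsf{RES}$ be Odd's attractor into $\{v\}$ in $W$ guarded by $\{w\in W\mid\mathcal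 P(w)\ge k\}$; on $\textsf{RES}\setminus\{v\}$ set $\rho=\top$, and let $\sigma$ on Odd's vertices there be a strategy attracting to $v$; 4. let $\textsf{IRR}$ be Even's attractor into $\{w\in W\mid\mathcal P(w)<k\}$ in $W$, let $\textsf{REM}=W\setminus(\textsf{RES}\cup\textsf{IRR})$, and call $\textsf{SPM-Within}(\textsf{REM})$; 5. let $\textsf{DOM}=\textsf{RES}\cup\{w\in\textsf{REM}\mid\rho(w)=\top\}$ and let $A$ be Odd's attractor into $\textsf{DOM}$ in $W$; on $A\setminus\textsf{DOM}$ set $\rho=\top$, and let $\sigma$ on Odd's vertices there be a strategy attracting to $\textsf{DOM}$; replace $W$ by $W\setminus A$. Finally, let $W_\Diamond=\{v\mid\rho(v)\ne\top\}$, $W_\square=\{v\mid\rho(v)=\top\}$, let $\sigma'(v)$, for $v\in V_\Diamond\cap W_\Diamond$, be a successor of $v$ with minimal measure, and return $((W_\Diamond,\sigma'),(W_\square,\sigma))$. *Claim.* For every such game, every representation of it by successor and predecessor lists, and every order of liftings, Solve terminates; $W_\Diamond$ and $W_\square$ are complementary and are exactly the sets of vertices won by Even and by Odd; and $\sigma'$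 and $\sigma$ are positional strategies that are winning for Even from every vertex of $W_\Diamond$ and for Odd from every vertex of $W_\square$. If moreover there are no gaps among the priorities (each of $1,\dots,d-1$ occurs; $0$ may or may not occur), then the worst-case running time is $$O\bigl(dm\cdot(n/\lfloor d/2\rfloor)^{\lfloor d/2\rfloor}\bigr)$$ with an absolute constant, where the power is read as $1$ if $d=1$. Here Solve is implemented with worklists and counters on a random access machine, operations on vertices, counters and membership bits cost one step, and operations on $d$-tuples cost $d$ steps. -/

import Mathlib

universe u

/-! ## Parity games -/

/-- The two players, even (diamond) and odd (box). -/
inductive Player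
  | even
  | odd
  deriving DecidableEq

/-- A parity game on the vertex set `V` (finite, via `[Fintype V]`, wherever it matters): each
vertex has one owner, the edge relation is total, and each vertex has a priority. -/
structure ParityGame (V : Type u) where
  owner : V → Player
  E : V → V → Prop
  total : ∀ v, ∃ w, E v w
  prio : V → ℕ

namespace ParityGame

variable {V : Type u}

/-! ### Plays, strategies, winning regions -/

/-- Infinite plays. -/
def IsPlay (G : ParityGame V) (π : ℕ → V) : Prop := ∀ n, G.E (π n) (π (n + 1))

/-- The play `π` is won by player `i`: the least priority occurring infinitely often
is even if and only if `i` is player even. -/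
def WonBy (G : ParityGame V) (i : Player) (π : ℕ → V) : Prop :=
  ∃ p, IsLeast {q : ℕ | ∃ᶠ n in Filter.atTop, G.prio (π n) = q} p ∧ (Even p ↔ i = Player.even)

/-- A partial function `V⁺ → V` is a strategy of player `i` if, whenever it is defined on
`u₁ ⋯ uₙ`, the vertex `uₙ` belongs to `i` and the value is a successor of `uₙ`.  The nonempty
path `u₁ ⋯ uₙ` is given as the pair of the list `u₁ ⋯ uₙ₋₁` and the vertex `uₙ`. -/
def IsStrategy (G : ParityGame V) (i : Player) (σ : List V → V → Option V) : Prop :=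
  ∀ h v w, σ h v = some w → G.owner v = i ∧ G.E v w

/-- The play `π` is consistent with `σ`. -/
def Consistent (σ : List V → V → Option V) (π : ℕ → V) : Prop :=
  ∀ n w, σ ((List.range n).map π) (π n) = some w → π (n + 1) = w

/-- `σ` is winning for player `i` from the vertex `v`. -/
def WinningFrom (G : ParityGame V) (i : Player) (σ : List V → V → Option V) (v : V) : Prop :=
  ∀ π, G.IsPlay π → π 0 = v → Consistent σ π → G.WonBy i π

/-- The set of vertices won by player `i`. -/
def winRegion (G : ParityGame V) (i : Player) : Set V :=
  {v | ∃ σ, G.IsStrategy i σ ∧ G.WinningFrom i σ v}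

/-- The partial function `V⁺ → V` given by a positional one. -/
def positional (σ : V → Option V) : List V → V → Option V := fun _ v => σ v

/-- `σ` is a positional strategy of player `i`, defined on all vertices of `i` in `S`, and it is
winning for `i` from every vertex of `S`. -/
structure IsPositionalWinning (G : ParityGame V) (i : Player) (S : Set V) (σ : V → Option V) :
    Prop where
  isStrategy : G.IsStrategy i (positional σ)
  defined : ∀ v ∈ S, G.owner v = i → (σ v).isSome
  winning : ∀ v ∈ S, G.WinningFrom i (positional σ) v

/-! ### Size parameters -/

/-- The number of edges. -/
noncomputable def numEdges (G : ParityGame V) : ℕ := {e : V × V | G.E e.1 e.2}.ncard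

/-- `d` is one larger than the largest priority occurring in the game. -/
def d [Fintype V] (G : ParityGame V) : ℕ := Finset.univ.sup G.prio + 1

/-- `nᵢ`, the number of vertices of priority `i`. -/
def numPrio [Fintype V] (G : ParityGame V) (i : ℕ) : ℕ :=
  (Finset.univ.filter fun v => G.prio v = i).card

/-- There are no gaps among the priorities: every priority between `1` and the largest one
occurs (priority `0` may or may not occur). -/
def NoGaps [Fintype V] (G : ParityGame V) : Prop :=
  ∀ i, 1 ≤ i → i < G.d → ∃ v, G.prio v = i

end ParityGame

/-! ## Measures -/

/-- `d`-tuples of natural numbers, together with a top element. -/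
inductive Meas (d : ℕ)
  | tup (a : Fin d → ℕ)
  | top

namespace Meas

variable {d : ℕ}

/-- `x <ᵢ y`: the positions `0, …, i` of `x` are lexicographically smaller than those of `y`;
tuples are smaller than the top element. -/
def LtUpTo (i : ℕ) : Meas d → Meas d → Prop
  | tup a, tup b => ∃ j : Fin d, (j : ℕ) ≤ i ∧ (∀ k : Fin d, k < j → a k = b k) ∧ a j < b j
  | tup _, top => True
  | top, _ => False

instance (i : ℕ) : ∀ x y : Meas d, Decidable (LtUpTo i x y)
  | tup a, tup b => inferInstanceAs (Decidable
      (∃ j : Fin d, (j : ℕ) ≤ i ∧ (∀ k : Fin d, k < j → a k = b k) ∧ a j < b j))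
  | tup _, top => inferInstanceAs (Decidable True)
  | top, tup _ => inferInstanceAs (Decidable False)
  | top, top => inferInstanceAs (Decidable False)

/-- `x ≤ᵢ y`. -/
def LeUpTo (i : ℕ) (x y : Meas d) : Prop := ¬ LtUpTo i y x

instance (i : ℕ) (x y : Meas d) : Decidable (LeUpTo i x y) :=
  inferInstanceAs (Decidable (¬ LtUpTo i y x))

/-- The lexicographic order on all `d` positions, strict version. -/
def Lt (x y : Meas d) : Prop := LtUpTo d x y

instance (x y : Meas d) : Decidable (Lt x y) := inferInstanceAs (Decidable (LtUpTo d x y))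

/-- The lexicographic order on all `d` positions. -/
def Le (x y : Meas d) : Prop := LeUpTo d x y

instance (x y : Meas d) : Decidable (Le x y) := inferInstanceAs (Decidable (LeUpTo d x y))

def max (x y : Meas d) : Meas d := if Lt x y then y else x

def min (x y : Meas d) : Meas d := if Lt y x then y else x

def isTop : Meas d → Bool
  | tup _ => false
  | top => true

end Meas

namespace ParityGame

variable {V : Type u} [Fintype V]

/-- The set of measures: the top element, and the tuples with `0` at even positions and
a number that is at most `nᵢ` at each odd position `i`. -/
def M (G : ParityGame V) : Set (Meas G.d) :=
  {x | match x with
    | Meas.tup a => ∀ i : Fin G.d, (Even (i : ℕ) → a i = 0) ∧ (Odd (i : ℕ) → a i ≤ G.numPrio i)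
    | Meas.top => True}

/-- `Prog`, as a function of the priority `p` of the vertex and of the measure of its successor:
the least `m' ∈ M` with `m' ≥ₚ m` if `p` is even, and with `m' >ₚ m` or `m' = m = ⊤` if `p` is odd
(see `progAt_isLeast`).  It is given here by one pass over the tuple: positions after `p` are
cleared; if `p` is odd, then moreover the last odd position up to `p` that is not saturated is
incremented, and the positions after it are cleared. -/
def progAt (G : ParityGame V) (p : ℕ) : Meas G.d → Meas G.d
  | Meas.top => Meas.top
  | Meas.tup a =>
    if Even p then Meas.tup fun i => if (i : ℕ) ≤ p then a i else 0
    else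
      match (Finset.univ.filter fun j : Fin G.d =>
          (j : ℕ) ≤ p ∧ Odd (j : ℕ) ∧ a j < G.numPrio j).max with
      | none => Meas.top
      | some j => Meas.tup fun i => if i < j then a i else if i = j then a j + 1 else 0

/-- The property that `Prog` minimises. -/
def ProgSpec (G : ParityGame V) (p : ℕ) (m x : Meas G.d) : Prop :=
  x ∈ G.M ∧ (Even p → Meas.LeUpTo p m x) ∧
    (Odd p → Meas.LtUpTo p m x ∨ (x = Meas.top ∧ m = Meas.top))

theorem progAt_isLeast (G : ParityGame V) (p : ℕ) (m : Meas G.d) (hm : m ∈ G.M) :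
    G.ProgSpec p m (G.progAt p m) ∧ ∀ x, G.ProgSpec p m x → Meas.Le (G.progAt p m) x := by
  rcases m with a | _
  swap
  · refine ⟨⟨trivial, fun _ h => h, fun _ => Or.inr ⟨rfl, rfl⟩⟩, ?_⟩
    rintro (b | _) ⟨-, he, ho⟩ h
    · rcases Nat.even_or_odd p with hp | hp
      · exact he hp trivial
      · rcases ho hp with h' | h'
        · exact h'
        · exact absurd h'.1 (by simp)
    · exact h
  rcases Nat.even_or_odd p with hp | hp
  · have hp' : ¬ Odd p := Nat.not_odd_iff_even.2 hp
    simp only [progAt, hp, if_true]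
    refine ⟨⟨fun i => ⟨fun hi => ?_, fun hi => ?_⟩, fun _ => ?_, fun h => absurd h hp'⟩, ?_⟩
    · simp [(hm i).1 hi]
    · have := (hm i).2 hi
      dsimp only
      split_ifs <;> omega
    · rintro ⟨j, hj, -, h⟩
      simp [hj] at h
    · rintro (b | _) ⟨-, he, -⟩ h
      · obtain ⟨j, -, hk, hj⟩ := h
        dsimp only at hj
        split_ifs at hj with hjp
        · refine he hp ⟨j, hjp, fun k hkj => ?_, hj⟩
          have hkp : (k : ℕ) ≤ p := le_trans (le_of_lt hkj) hjp
          have := hk k hkj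
          simpa [hkp] using this
        · omega
      · exact h
  · have hp' : ¬ Even p := Nat.not_even_iff_odd.2 hp
    simp only [progAt, hp', if_false]
    rcases hmax : (Finset.univ.filter fun j : Fin G.d =>
          (j : ℕ) ≤ p ∧ Odd (j : ℕ) ∧ a j < G.numPrio j).max with _ | j
    · dsimp only
      refine ⟨⟨trivial, fun h => absurd h hp', fun _ => Or.inl trivial⟩, ?_⟩
      have hemp := Finset.max_eq_bot.1 hmax
      rintro (b | _) ⟨hb, -, ho⟩ h
      · rcases ho hp with h' | h'
        · obtain ⟨j, hjp, -, hj⟩ := h'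
          have hodd : Odd (j : ℕ) := by
            by_contra hne
            have := (hb j).1 (Nat.not_odd_iff_even.1 hne)
            omega
          have : j ∈ (Finset.univ.filter fun j : Fin G.d =>
              (j : ℕ) ≤ p ∧ Odd (j : ℕ) ∧ a j < G.numPrio j) := by
            simp only [Finset.mem_filter, Finset.mem_univ, true_and]
            exact ⟨hjp, hodd, lt_of_lt_of_le hj ((hb j).2 hodd)⟩
          rw [hemp] at this
          simp at this
        · exact absurd h'.1 (by simp)
      · exact h
    · dsimp only
      have hj := Finset.mem_of_max hmax
      simp only [Finset.mem_filter, Finset.mem_univ, true_and] at hj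
      obtain ⟨hjp, hjo, hjn⟩ := hj
      refine ⟨⟨fun i => ⟨fun hi => ?_, fun hi => ?_⟩, fun h => absurd h hp', fun _ => Or.inl
        ⟨j, hjp, fun k hk => ?_, ?_⟩⟩, ?_⟩
      · dsimp only
        split_ifs with h1 h2
        · exact (hm i).1 hi
        · subst h2
          exact absurd hi (Nat.not_even_iff_odd.2 hjo)
        · rfl
      · dsimp only
        split_ifs with h1 h2
        · exact (hm i).2 hi
        · subst h2
          exact hjn
        · exact Nat.zero_le _
      · simp [hk]
      · simp
      · rintro (b | _) ⟨hb, -, ho⟩ h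
        · obtain ⟨l, -, hlk, hl⟩ := h
          rcases ho hp with h' | h'
          · obtain ⟨i, hip, hik, hi⟩ := h'
            have hodd : Odd (i : ℕ) := by
              by_contra hne
              have := (hb i).1 (Nat.not_odd_iff_even.1 hne)
              omega
            have hij : i ≤ j := Finset.le_max_of_eq (by
              simp only [Finset.mem_filter, Finset.mem_univ, true_and]
              exact ⟨hip, hodd, lt_of_lt_of_le hi ((hb i).2 hodd)⟩) hmax
            rcases lt_trichotomy l i with hli | hli | hli
            · have := hik l hli
              simp only [lt_of_lt_of_le hli hij, if_true] at hl
              omega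
            · subst hli
              dsimp only at hl
              split_ifs at hl with h1 h2
              · omega
              · subst h2
                omega
              · exact (lt_or_eq_of_le hij).elim h1 h2
            · have h3 := hlk i hli
              dsimp only at h3 hl
              rcases lt_or_eq_of_le hij with h4 | h4
              · simp only [h4, if_true] at h3
                omega
              · subst h4
                simp only [not_lt_of_gt hli, ne_of_gt hli, if_false] at hl
                omega
          · exact absurd h'.1 (by simp)
        · exact h

/-- `Prog(ρ, v, w)`. -/
def prog (G : ParityGame V) (ρ : V → Meas G.d) (v w : V) : Meas G.d := G.progAt (G.prio v) (ρ w)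

/-! ## The algorithm

The program is executed on a random access machine whose memory holds the arrays and sets that are
listed in the structures `AttrState` and `State` below.  The field `time` counts steps: an
operation on a vertex, a counter, a priority, a set membership bit or a worklist costs one step; an
operation on a `d`-tuple (comparing, copying or clearing a tuple, computing `progAt`) costs `d`
steps. -/

/-- The representation of a game as an input: a list of the vertices, and for every vertex the
lists of its successors and of its predecessors, each in an arbitrary order. -/
structure Input (G : ParityGame V) where
  verts : List V
  verts_nodup : verts.Nodup
  mem_verts : ∀ v, v ∈ verts
  succ : V → List V
  succ_nodup : ∀ v, (succ v).Nodup
  mem_succ : ∀ v w, w ∈ succ v ↔ G.E v w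
  pred : V → List V
  pred_nodup : ∀ v, (pred v).Nodup
  mem_pred : ∀ v u, u ∈ pred v ↔ G.E u v

/-- A lifting policy selects, at each moment `t`, the next vertex to be lifted among
the vertices that can be lifted.  As `t` strictly increases between two selections, every
way of resolving the choices along a run is given by some policy. -/
structure LiftingPolicy (V : Type u) where
  choose : ℕ → (Q : Finset V) → Q.Nonempty → V
  choose_mem : ∀ t Q h, choose t Q h ∈ Q

/-- The first element of a list that is not beaten by another one, found in one pass. -/
def argBest {α : Type u} (better : α → α → Bool) (l : List α) : Option α :=
  l.foldl (fun acc x => match acc with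
    | none => some x
    | some b => if better x b then some x else some b) none

/-! ### Attractors -/

/-- The memory of an attractor computation: the set built so far, the attracting strategy,
for every vertex the number of its successors in the context that are not yet known to be in the
attractor, and the list of those vertices of the attractor whose predecessors are still to be
inspected. -/
structure AttrState (V : Type u) where
  A : Finset V
  strat : V → Option V
  deg : V → ℕ
  stack : List V
  time : ℕ

variable [DecidableEq V]

/-- Inspect the edge from `u` to the vertex `a` of the attractor. -/
def attrEdge (G : ParityGame V) (i : Player) (X : Finset V) (a : V) (s : AttrState V) (u : V) :
    AttrState V :=
  if u ∈ X ∧ u ∉ s.A then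
    if G.owner u = i then
      { s with
        A := insert u s.A
        strat := Function.update s.strat u (some a)
        stack := u :: s.stack
        time := s.time + 4 }
    else if s.deg u = 1 then
      { s with A := insert u s.A, stack := u :: s.stack, time := s.time + 4 }
    else
      { s with deg := Function.update s.deg u (s.deg u - 1), time := s.time + 4 }
  else { s with time := s.time + 2 }

/-- Repeat at most `r` times: remove a vertex from the stack and inspect its predecessors.
Every vertex enters the stack at most once, so `r = |V|` rounds empty the stack. -/
def attrLoop (G : ParityGame V) (R : G.Input) (i : Player) (X : Finset V) :
    ℕ → AttrState V → AttrState V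
  | 0, s => s
  | r + 1, s =>
    match s.stack with
    | [] => s
    | a :: rest =>
      attrLoop G R i X r
        ((R.pred a).foldl (attrEdge G i X a) { s with stack := rest, time := s.time + 1 })

/-- The attractor of player `i` into `U` in the context `W`, guarded by `X`, where `U ⊆ X ⊆ W`:
the least `A` with `U ⊆ A ⊆ X` that contains each `u ∈ X` of player `i` with a successor in `A`, and
each `u ∈ X` of the opponent all of whose successors in `W` are in `A`. -/
def attr (G : ParityGame V) (R : G.Input) (i : Player) (W X U : Finset V) : AttrState V :=
  attrLoop G R i X R.verts.length
    { A := U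
      strat := fun _ => none
      deg := fun u => (R.succ u).countP (· ∈ W)
      stack := R.verts.filter (· ∈ U)
      time := 1 + (R.verts.map fun u => 3 + 2 * (R.succ u).length).sum }

/-! ### Lifting -/

/-- The memory of the algorithm: the current measure `ρ`, the partial strategy `σ` of player odd
(both are global variables), and, for the current context `W`: for every `v ∈ W` the number of
successors `w` of `v` with `Prog(ρ, v, w) ≤ ρ(v)`, and the set of the vertices `v ∈ W` with
`ρ ⊏ Lift(ρ, v)`. -/
structure State (G : ParityGame V) where
  rho : V → Meas G.d
  sigma : V → Option V
  cnt : V → ℕ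
  queue : Finset V
  time : ℕ

variable {G : ParityGame V}

def State.tick (s : State G) (c : ℕ) : State G := { s with time := s.time + c }

/-- The new value of `ρ(v)` in `Lift(ρ, v)`: the maximum of `ρ(v)` and of the minimum (if `v` is
owned by even) or the maximum (if `v` is owned by odd) of `Prog(ρ, v, w)` over the successors `w`
of `v`. -/
def liftVal (R : G.Input) (ρ : V → Meas G.d) (v : V) : Meas G.d :=
  match G.owner v with
  | Player.even => Meas.max (ρ v) (((R.succ v).map (G.prog ρ v)).foldl Meas.min Meas.top)
  | Player.odd => ((R.succ v).map (G.prog ρ v)).foldl Meas.max (ρ v)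

/-- Whether `v` can be lifted, given the number `c` of its successors `w` with
`Prog(ρ, v, w) ≤ ρ(v)`. -/
def liftable (R : G.Input) (v : V) (c : ℕ) : Bool :=
  match G.owner v with
  | Player.even => c = 0
  | Player.odd => c < (R.succ v).length

/-- Compute the counter of `v` from scratch, and insert `v` into the queue if it can be lifted. -/
def inspect (R : G.Input) (s : State G) (v : V) : State G :=
  let c := (R.succ v).countP fun w => Meas.Le (G.prog s.rho v w) (s.rho v)
  { s with
    cnt := Function.update s.cnt v c
    queue := if liftable R v c then insert v s.queue else s.queue
    time := s.time + 3 + (2 * G.d + 2) * (R.succ v).length }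

/-- Update the counter of the vertex `u` after the measure of one of its successors has changed from
`old` to `new`, and insert `u` into the queue if it can now be lifted. -/
def touch (R : G.Input) (old new : Meas G.d) (s : State G) (u : V) : State G :=
  let before : Bool := Meas.Le (G.progAt (G.prio u) old) (s.rho u)
  let after : Bool := Meas.Le (G.progAt (G.prio u) new) (s.rho u)
  let c := if before ∧ ¬ after then s.cnt u - 1 else s.cnt u
  { s with
    cnt := Function.update s.cnt u c
    queue := if liftable R u c then insert u s.queue else s.queue
    time := s.time + 4 * G.d + 5 }

/-- Find all vertices of `W` that can be lifted. -/
def initQueue (R : G.Input) (W : Finset V) (s : State G) : State G :=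
  (R.verts.filter (· ∈ W)).foldl (inspect R)
    { s with queue := ∅, time := s.time + 1 + 2 * R.verts.length }

/-- Replace `ρ` by `Lift(ρ, v)`, and update the counters and the queue. -/
def lift (R : G.Input) (W : Finset V) (s : State G) (v : V) : State G :=
  let old := s.rho v
  let new := liftVal R s.rho v
  let s₁ : State G :=
    { s with
      rho := Function.update s.rho v new
      queue := s.queue.erase v
      time := s.time + 3 + 3 * G.d + (2 * G.d + 1) * (R.succ v).length }
  let s₂ := (R.pred v).foldl
    (fun s u => if u ∈ W ∧ u ≠ v then touch R old new (s.tick 3) u else s.tick 3) s₁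
  inspect R s₂ v

/-- The inner loop: lift vertices of `W` until no vertex of `W` can be lifted (the second component
is then `none`) or some vertex `v` of `W` has been lifted to the top (the second component is then
`some v`).  The number is a bound on the number of iterations; the result is `none` if it is
exceeded. -/
def liftLoop (R : G.Input) (pol : LiftingPolicy V) (W : Finset V) :
    ℕ → State G → Option (State G × Option V)
  | 0, _ => none
  | f + 1, s =>
    if h : s.queue.Nonempty then
      let v := pol.choose s.time s.queue h
      let s := lift R W (s.tick 3) v
      if (s.rho v).isTop then some (s, some v) else liftLoop R pol W f s
    else some (s.tick 1, none)

/-! ### Strategy derivation and the main procedure -/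

/-- For all `w ∈ A \ seed`: set `ρ(w)` to the top, and, if `w` is owned by odd, let `σ(w)` be the
strategy attracting to `seed`. -/
def resolve (R : G.Input) (A seed : Finset V) (strat : V → Option V) (s : State G) : State G :=
  { s with
    rho := fun w => if w ∈ A ∧ w ∉ seed then Meas.top else s.rho w
    sigma := fun w => if w ∈ A ∧ w ∉ seed ∧ G.owner w = Player.odd then strat w else s.sigma w
    time := s.time + 1 + (G.d + 5) * R.verts.length }

/-- If `v` is owned by odd, let `σ(v)` be a successor of `v` in `W` whose measure is maximal with
respect to `≤ₖ`, where `k` is the priority of `v`. -/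
def setSigma (R : G.Input) (W : Finset V) (v : V) (s : State G) : State G :=
  match G.owner v with
  | Player.even => s.tick 1
  | Player.odd =>
    { s with
      sigma := Function.update s.sigma v
        (argBest (fun u b => Meas.LtUpTo (G.prio v) (s.rho b) (s.rho u))
          ((R.succ v).filter (· ∈ W)))
      time := s.time + 2 + (G.d + 3) * (R.succ v).length }

/-- The procedure `SPM-Within`.  One unfolding is one iteration of its outer while loop on the
context `W`; the last call continues that loop with the smaller context.  The first number bounds
the depth of the calls and the number of iterations of each inner loop; the result is `none` if this
bound is exceeded. -/
def spmWithin (R : G.Input) (pol : LiftingPolicy V) : ℕ → Finset V → State G → Option (State G)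
  | 0, _, _ => none
  | f + 1, W, s =>
    if W = ∅ then some (s.tick 1) else
    match liftLoop R pol W f (initQueue R W (s.tick 1)) with
    | none => none
    | some (s, none) => some s
    | some (s, some v) =>
      let k := G.prio v
      let s := setSigma R W v s
      let res := attr G R Player.odd W (W.filter (k ≤ G.prio ·)) {v}
      let s := resolve R res.A {v} res.strat (s.tick res.time)
      let irr := attr G R Player.even W W (W.filter (G.prio · < k))
      let rem := W \ (res.A ∪ irr.A)
      match spmWithin R pol f rem (s.tick (irr.time + 3 * R.verts.length + 1)) with
      | none => none
      | some s =>
        let dom := res.A ∪ rem.filter fun w => (s.rho w).isTop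
        let att := attr G R Player.odd W W dom
        let s := resolve R att.A dom att.strat (s.tick (3 * R.verts.length + att.time))
        spmWithin R pol f (W \ att.A) (s.tick (2 * R.verts.length + 1))

variable (V) in
/-- The output of the algorithm, and the number of steps. -/
structure Result where
  winEven : Finset V
  stratEven : V → Option V
  winOdd : Finset V
  stratOdd : V → Option V
  time : ℕ

/-- The state in which the algorithm starts: `σ` is empty and `ρ` is constantly zero.  The initial
cost accounts for reading the input, computing the numbers `nᵢ`, and setting up the arrays. -/
def initState (R : G.Input) : State G where
  rho := fun _ => Meas.tup fun _ => 0
  sigma := fun _ => none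
  cnt := fun _ => 0
  queue := ∅
  time := 1 + G.d + (G.d + 5) * R.verts.length +
    (R.verts.map fun v => (R.succ v).length + (R.pred v).length).sum

/-- The algorithm `Solve`, with a bound on the depth of the calls and on the number of iterations of
each inner loop.  The result is `none` if this bound is exceeded; otherwise it does not depend on
the bound. -/
def solve (G : ParityGame V) (R : G.Input) (pol : LiftingPolicy V) (bound : ℕ) :
    Option (Result V) :=
  match spmWithin R pol bound Finset.univ (initState R) with
  | none => none
  | some s => some
    { winEven := Finset.univ.filter fun v => (s.rho v).isTop = false
      stratEven := fun v =>
        if G.owner v = Player.even ∧ (s.rho v).isTop = false then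
          argBest (fun u b => Meas.Lt (s.rho u) (s.rho b)) (R.succ v)
        else none
      winOdd := Finset.univ.filter fun v => (s.rho v).isTop = true
      stratOdd := s.sigma
      time := s.time + 1 + (R.verts.map fun v => 4 + (G.d + 2) * (R.succ v).length).sum }

end ParityGame

/-! Even's half is the classical argument on progress measures. When nothing can be lifted any more,
Even moves to successors of least measure and never reaches `⊤`. Suppose an odd `p` were the least
priority seen infinitely often. From some moment on, the measures truncated at `p` never rise, and
they drop whenever `p` is seen, against well-foundedness (`wonBy_even_of_progress`,
`isPositionalWinning_even`).

Odd's half analyses the moment when a vertex `v` of priority `k` in a context `W` is lifted to `⊤`.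
Measures obtained by lifting lie below all prefixed points of `Lift` that are `⊤` wherever they are
(`Reached.least`), and suitable prefixed points can be made by counting vertices. If Even can keep
descending inside a set `S ⊆ W`, then on `S` the entry at each odd position `j ≥ k` is bounded by
the number of unresolved vertices of priority `j` outside `W` plus those counted in `S`
(`Context.le_boundTuple`). Whenever such a count misses `v`, position `k` is not saturated and
`Prog` at `v` stays below `⊤`. Hence `k` is odd, `v ∉ IRR` and `RES` is disjoint from `IRR`. After
the recursive call, the vertices of `IRR` and the undominated ones of `REM` still do not force `v`
to `⊤` (`TopLift.progAt_ne_top`). So the successors that did force it lie in `DOM`. A play of Odd's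
strategy in `DOM` either remains from some point on in the part won by the recursive call, or passes
through `v` infinitely often while all priorities are at least the odd number `k`
(`TopLift.oddTrap`). Attractors and unions of such traps make up Odd's region. Since the two regions
cover all vertices and no vertex is won by both players, they are the winning regions
(`winRegion_eq`).

For the running time, a lift of `u` is paid by the drop in the number of tuples above `ρ u`,
weighted with the cost of a lift (`potential`). Every round resolves a vertex of odd priority, so
there are at most `n` rounds, each costing `O(dm)` apart from its liftings. With `k = ⌊d/2⌋`, the
number of tuples is `∏ (n_{2j+1} + 1)`. Without gaps, the vertices of positive even priority pay for
all but one of the summands `1`, so the arithmetic-geometric mean inequality gives `((n+1)/k)^k ≤ 3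
(n/k)^k`. The `n` rounds are absorbed by `n ≤ 2 (n/k)^k`. -/

set_option linter.unusedSectionVars false

/-! ### The linear order on measures, and truncation. -/

namespace Meas

variable {d : ℕ}

/-- Measures as elements of the lexicographic order with a top element. -/
def toLexTop : Meas d → WithTop (Lex (Fin d → ℕ))
  | tup a => ((toLex a : Lex (Fin d → ℕ)) : WithTop (Lex (Fin d → ℕ)))
  | top => ⊤

theorem toLexTop_injective : Function.Injective (toLexTop (d := d)) := by
  rintro (a | _) (b | _) h
  · simp only [toLexTop, WithTop.coe_inj] at h
    exact congrArg tup (toLex.injective h)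
  · simp [toLexTop] at h
  · simp [toLexTop] at h
  · rfl

noncomputable instance : LinearOrder (Meas d) := LinearOrder.lift' toLexTop toLexTop_injective

theorem tup_lt_tup {a b : Fin d → ℕ} :
    tup a < tup b ↔ ∃ j : Fin d, (∀ k < j, a k = b k) ∧ a j < b j := by
  change ((toLex a : Lex (Fin d → ℕ)) : WithTop (Lex (Fin d → ℕ))) < (toLex b : Lex (Fin d → ℕ)) ↔ _
  rw [WithTop.coe_lt_coe]
  rfl

theorem tup_lt_top (a : Fin d → ℕ) : tup a < top :=
  WithTop.coe_lt_top (toLex a : Lex (Fin d → ℕ))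

theorem le_top' (x : Meas d) : x ≤ top := (le_top : toLexTop x ≤ ⊤)

theorem lt_top_iff {x : Meas d} : x < top ↔ x ≠ top :=
  ⟨fun h => h.ne, fun h => lt_of_le_of_ne (le_top' x) h⟩

theorem eq_top_of_le {x y : Meas d} (h : x ≤ y) (hx : x = top) : y = top :=
  le_antisymm (le_top' y) (hx ▸ h)

theorem isTop_iff {x : Meas d} : x.isTop = true ↔ x = top := by
  cases x <;> simp [isTop]

theorem isTop_eq_false_iff {x : Meas d} : x.isTop = false ↔ x ≠ top := by
  cases x <;> simp [isTop]

instance : WellFoundedLT (Meas d) :=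
  ⟨InvImage.wf (toLexTop (d := d)) (wellFounded_lt : WellFounded
    (α := WithTop (Lex (Fin d → ℕ))) (· < ·))⟩

/-- Clear the positions after `p`. -/
def trunc (p : ℕ) : Meas d → Meas d
  | tup a => tup fun i => if (i : ℕ) ≤ p then a i else 0
  | top => top

/-- Replaces the family of preorders `≤ᵢ` by one linear order applied to truncations, so that
totality and transitivity need no separate proofs. -/
theorem ltUpTo_iff {p : ℕ} {x y : Meas d} : LtUpTo p x y ↔ trunc p x < trunc p y := by
  rcases x with a | _ <;> rcases y with b | _
  · simp only [LtUpTo, trunc, tup_lt_tup]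
    constructor
    · rintro ⟨j, hj, hk, h⟩
      refine ⟨j, fun k hkj => ?_, by simpa [hj] using h⟩
      have : (k : ℕ) ≤ p := le_trans (le_of_lt hkj) hj
      simp [this, hk k hkj]
    · rintro ⟨j, hk, h⟩
      have hj : (j : ℕ) ≤ p := by
        by_contra hj
        simp [hj] at h
      refine ⟨j, hj, fun k hkj => ?_, by simpa [hj] using h⟩
      have : (k : ℕ) ≤ p := le_trans (le_of_lt hkj) hj
      simpa [this] using hk k hkj
  · simp [LtUpTo, trunc, tup_lt_top]
  · simp only [LtUpTo, trunc, false_iff, not_lt]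
    exact le_top' _
  · simp [LtUpTo, trunc]

theorem leUpTo_iff {p : ℕ} {x y : Meas d} : LeUpTo p x y ↔ trunc p x ≤ trunc p y := by
  rw [LeUpTo, ltUpTo_iff, not_lt]

theorem trunc_of_le {p : ℕ} (hp : d ≤ p + 1) (x : Meas d) : trunc p x = x := by
  rcases x with a | _
  · simp only [trunc]
    congr 1
    funext i
    have : (i : ℕ) ≤ p := by omega
    simp [this]
  · rfl

theorem lt_iff {x y : Meas d} : Lt x y ↔ x < y := by
  rw [Lt, ltUpTo_iff, trunc_of_le (by omega), trunc_of_le (by omega)]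

theorem le_iff {x y : Meas d} : Le x y ↔ x ≤ y := by
  rw [Le, leUpTo_iff, trunc_of_le (by omega), trunc_of_le (by omega)]

theorem max_eq (x y : Meas d) : Meas.max x y = x ⊔ y := by
  rw [Meas.max]
  split_ifs with h
  · exact (sup_eq_right.2 (lt_iff.1 h).le).symm
  · exact (sup_eq_left.2 (not_lt.1 fun h' => h (lt_iff.2 h'))).symm

theorem min_eq (x y : Meas d) : Meas.min x y = x ⊓ y := by
  rw [Meas.min]
  split_ifs with h
  · exact (inf_eq_right.2 (lt_iff.1 h).le).symm
  · exact (inf_eq_left.2 (not_lt.1 fun h' => h (lt_iff.2 h'))).symm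

theorem trunc_eq_top {p : ℕ} {x : Meas d} : trunc p x = top ↔ x = top := by
  cases x <;> simp [trunc]

theorem trunc_trunc {p q : ℕ} (h : p ≤ q) (x : Meas d) : trunc p (trunc q x) = trunc p x := by
  rcases x with a | _
  · simp only [trunc]
    congr 1
    funext i
    split_ifs <;> first | rfl | omega
  · rfl

/-- A strict difference at a position up to `p` already decides the full lexicographic comparison.
-/
theorem trunc_mono (p : ℕ) : Monotone (trunc p : Meas d → Meas d) := by
  intro x y h
  by_contra hlt
  rw [not_le, ← ltUpTo_iff] at hlt
  refine absurd h (not_le.2 ?_)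
  rcases y with b | _ <;> rcases x with a | _
  · obtain ⟨j, -, hk, hj⟩ := hlt
    exact tup_lt_tup.2 ⟨j, hk, hj⟩
  · exact tup_lt_top _
  · exact hlt.elim
  · exact hlt.elim

theorem trunc_le_trunc {p q : ℕ} (h : p ≤ q) {x y : Meas d} (hxy : trunc q x ≤ trunc q y) :
    trunc p x ≤ trunc p y := by
  rw [← trunc_trunc h x, ← trunc_trunc h y]
  exact trunc_mono p hxy

theorem tup_le_tup {a b : Fin d → ℕ} (h : ∀ i, a i ≤ b i) : tup a ≤ tup b := by
  rw [← not_lt, tup_lt_tup]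
  rintro ⟨j, -, hj⟩
  exact absurd (h j) (not_le.2 hj)

theorem trunc_tup_le {p : ℕ} {a b : Fin d → ℕ} (h : ∀ i : Fin d, (i : ℕ) ≤ p → a i ≤ b i) :
    trunc p (tup a) ≤ trunc p (tup b) := by
  refine tup_le_tup fun i => ?_
  split_ifs with hi
  · exact h i hi
  · exact le_rfl

theorem trunc_tup_lt {p : ℕ} {a b : Fin d → ℕ} (h : ∀ i : Fin d, (i : ℕ) ≤ p → a i ≤ b i)
    (j : Fin d) (hj : (j : ℕ) = p) (hlt : a j < b j) :
    trunc p (tup a) < trunc p (tup b) := by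
  refine lt_of_le_of_ne (trunc_tup_le h) fun heq => ?_
  simp only [trunc, tup.injEq] at heq
  have := congrFun heq j
  simp only [hj, le_refl, if_true] at this
  omega

theorem tup_zero_le (x : Meas d) : tup (fun _ => 0) ≤ x := by
  rcases x with a | _
  · exact tup_le_tup fun i => Nat.zero_le _
  · exact le_top' _

end Meas

/-! ### Order properties of `Prog`. -/

namespace ParityGame

variable {V : Type u} [Fintype V] {G : ParityGame V}

theorem top_mem_M : (Meas.top : Meas G.d) ∈ G.M := trivial

theorem zero_mem_M : (Meas.tup fun _ => 0 : Meas G.d) ∈ G.M :=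
  fun _ => ⟨fun _ => rfl, fun _ => Nat.zero_le _⟩

theorem progAt_mem_M (p : ℕ) {m : Meas G.d} (hm : m ∈ G.M) : G.progAt p m ∈ G.M :=
  (progAt_isLeast G p m hm).1.1

theorem progAt_le_of_spec {p : ℕ} {m x : Meas G.d} (hm : m ∈ G.M) (h : G.ProgSpec p m x) :
    G.progAt p m ≤ x :=
  Meas.le_iff.1 ((progAt_isLeast G p m hm).2 x h)

/-- The constraint sees `m` only through its truncation. The escape clause `x = m = ⊤` for odd `p`
does no harm: if `x = ⊤` and `m` is a tuple, the strict inequality holds anyway. -/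
theorem ProgSpec.mono {p : ℕ} {m m' x : Meas G.d} (h : G.ProgSpec p m' x)
    (hmm : Meas.trunc p m ≤ Meas.trunc p m') : G.ProgSpec p m x := by
  refine ⟨h.1, fun hp => ?_, fun hp => ?_⟩
  · exact Meas.leUpTo_iff.2 (hmm.trans (Meas.leUpTo_iff.1 (h.2.1 hp)))
  · by_cases hm : m = Meas.top ∧ x = Meas.top
    · exact Or.inr ⟨hm.2, hm.1⟩
    left
    rw [Meas.ltUpTo_iff]
    rcases h.2.2 hp with h' | ⟨hx, -⟩
    · exact hmm.trans_lt (Meas.ltUpTo_iff.1 h')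
    · subst hx
      have : m ≠ Meas.top := fun h => hm ⟨h, rfl⟩
      exact Meas.lt_top_iff.2 fun h => this (Meas.trunc_eq_top.1 h)

/-- The hypothesis concerns positions up to `p` only. This is what makes a `≤ₖ`-maximal successor
good enough for Odd. -/
theorem progAt_mono_trunc {p : ℕ} {m m' : Meas G.d} (hm : m ∈ G.M) (hm' : m' ∈ G.M)
    (h : Meas.trunc p m ≤ Meas.trunc p m') : G.progAt p m ≤ G.progAt p m' :=
  progAt_le_of_spec hm ((progAt_isLeast G p m' hm').1.mono h)

theorem progAt_mono (p : ℕ) {m m' : Meas G.d} (hm : m ∈ G.M) (hm' : m' ∈ G.M)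
    (h : m ≤ m') : G.progAt p m ≤ G.progAt p m' :=
  progAt_mono_trunc hm hm' (Meas.trunc_mono p h)

theorem trunc_le_of_progAt_le {p : ℕ} {m x : Meas G.d} (hm : m ∈ G.M) (h : G.progAt p m ≤ x) :
    Meas.trunc p m ≤ Meas.trunc p x := by
  refine le_trans ?_ (Meas.trunc_mono p h)
  obtain ⟨-, he, ho⟩ := (progAt_isLeast G p m hm).1
  rcases Nat.even_or_odd p with hp | hp
  · exact Meas.leUpTo_iff.1 (he hp)
  · rcases ho hp with h' | ⟨h1, h2⟩
    · exact (Meas.ltUpTo_iff.1 h').le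
    · rw [h1]
      exact Meas.le_top' _

theorem trunc_lt_of_progAt_le {p : ℕ} (hp : Odd p) {m x : Meas G.d} (hm : m ∈ G.M)
    (h : G.progAt p m ≤ x) (hx : x ≠ Meas.top) : Meas.trunc p m < Meas.trunc p x := by
  refine lt_of_lt_of_le ?_ (Meas.trunc_mono p h)
  rcases (progAt_isLeast G p m hm).1.2.2 hp with h' | ⟨h1, h2⟩
  · exact Meas.ltUpTo_iff.1 h'
  · exact absurd (Meas.eq_top_of_le h h1) hx

theorem progAt_top (p : ℕ) : G.progAt p Meas.top = Meas.top := by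
  rw [progAt]

theorem progAt_ne_top_of_even {p : ℕ} (hp : Even p) {m : Meas G.d} (hm : m ≠ Meas.top) :
    G.progAt p m ≠ Meas.top := by
  rcases m with a | _
  · simp [progAt, hp]
  · exact absurd rfl hm

/-- A single unsaturated odd position up to `p` leaves room for an increment; here it is `p` itself.
-/
theorem progAt_ne_top_of_lt {p : ℕ} (hp : Odd p) {a : Fin G.d → ℕ} (j : Fin G.d)
    (hj : (j : ℕ) = p) (h : a j < G.numPrio p) : G.progAt p (Meas.tup a) ≠ Meas.top := by
  have hp' : ¬ Even p := Nat.not_even_iff_odd.2 hp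
  simp only [progAt, hp', if_false]
  rcases hmax : (Finset.univ.filter fun j : Fin G.d =>
      (j : ℕ) ≤ p ∧ Odd (j : ℕ) ∧ a j < G.numPrio j).max with _ | i
  · have hemp := Finset.max_eq_bot.1 hmax
    have : j ∈ (Finset.univ.filter fun j : Fin G.d =>
        (j : ℕ) ≤ p ∧ Odd (j : ℕ) ∧ a j < G.numPrio j) := by
      simp only [Finset.mem_filter, Finset.mem_univ, true_and]
      subst hj
      exact ⟨le_rfl, hp, h⟩
    rw [hemp] at this
    simp at this
  · simp

/-- All positions after `p` are zero. -/
def ZeroAfter (p : ℕ) (x : Meas G.d) : Prop :=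
  ∀ a, x = Meas.tup a → ∀ i : Fin G.d, p < i → a i = 0

theorem zeroAfter_progAt (p : ℕ) (m : Meas G.d) : ZeroAfter p (G.progAt p m) := by
  intro b hb i hi
  rcases m with a | _
  · simp only [progAt] at hb
    split_ifs at hb with hp
    · cases hb
      simp [hi]
    · rcases hmax : (Finset.univ.filter fun j : Fin G.d =>
          (j : ℕ) ≤ p ∧ Odd (j : ℕ) ∧ a j < G.numPrio j).max with _ | j
      · rw [hmax] at hb
        simp at hb
      · rw [hmax] at hb
        cases hb
        have hj := Finset.mem_of_max hmax
        simp only [Finset.mem_filter, Finset.mem_univ, true_and] at hj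
        have : j < i := Fin.lt_def.2 (lt_of_le_of_lt hj.1 hi)
        simp [not_lt_of_gt this, ne_of_gt this]
  · rw [progAt_top] at hb
    cases hb

end ParityGame

namespace ParityGame

variable {V : Type u} [Fintype V] {G : ParityGame V}

/-! ### Sizes -/

theorem Input.toFinset_verts [DecidableEq V] (R : G.Input) : R.verts.toFinset = Finset.univ := by
  ext v
  simp [R.mem_verts]

theorem Input.length_verts (R : G.Input) : R.verts.length = Fintype.card V := by
  classical
  rw [← List.toFinset_card_of_nodup R.verts_nodup, R.toFinset_verts, Finset.card_univ]

theorem Input.sum_verts (R : G.Input) (f : V → ℕ) : (R.verts.map f).sum = ∑ v, f v := by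
  classical
  rw [← R.toFinset_verts, List.sum_toFinset f R.verts_nodup]

theorem Input.sum_succ (R : G.Input) : ∑ v, (R.succ v).length = G.numEdges := by
  classical
  have h : {e : V × V | G.E e.1 e.2} =
      ((Finset.univ.sigma fun v => (R.succ v).toFinset).map
        (Equiv.sigmaEquivProd V V).toEmbedding : Finset (V × V)) := by
    ext ⟨v, w⟩
    simp [R.mem_succ]
  rw [numEdges, h, Set.ncard_coe_finset, Finset.card_map, Finset.card_sigma]
  exact Finset.sum_congr rfl fun v _ => (List.toFinset_card_of_nodup (R.succ_nodup v)).symm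

theorem Input.sum_pred (R : G.Input) : ∑ v, (R.pred v).length = G.numEdges := by
  classical
  have h : {e : V × V | G.E e.1 e.2} =
      ((Finset.univ.sigma fun v => (R.pred v).toFinset).map
        ((Equiv.sigmaEquivProd V V).trans (Equiv.prodComm V V)).toEmbedding : Finset (V × V)) := by
    ext ⟨v, w⟩
    simp [R.mem_pred]
  rw [numEdges, h, Set.ncard_coe_finset, Finset.card_map, Finset.card_sigma]
  exact Finset.sum_congr rfl fun v _ => (List.toFinset_card_of_nodup (R.pred_nodup v)).symm

theorem Input.succ_length_pos (R : G.Input) (v : V) : 1 ≤ (R.succ v).length := by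
  obtain ⟨w, hw⟩ := G.total v
  exact List.length_pos_of_mem ((R.mem_succ v w).2 hw)

theorem Input.succ_length_le (R : G.Input) (v : V) : (R.succ v).length ≤ G.numEdges := by
  rw [← R.sum_succ]
  exact Finset.single_le_sum (f := fun v => (R.succ v).length) (fun _ _ => Nat.zero_le _)
    (Finset.mem_univ v)

theorem Input.card_le (R : G.Input) : Fintype.card V ≤ G.numEdges := by
  rw [← R.sum_succ, ← Finset.card_univ, Finset.card_eq_sum_ones]
  exact Finset.sum_le_sum fun v _ => R.succ_length_pos v

/-! ### Attractors -/

/-- `A` is the attractor of player `i` into `U` in the context `W` guarded by `X`; `strat` attracts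
to `U`, which is witnessed by the rank `r`. -/
structure IsAttr (G : ParityGame V) (i : Player) (W X U A : Finset V) (strat : V → Option V)
    (r : V → ℕ) : Prop where
  seed : U ⊆ A
  sub : A ⊆ X
  own_mem : ∀ u ∈ X, G.owner u = i → ∀ a ∈ A, G.E u a → u ∈ A
  opp_mem : ∀ u ∈ X, G.owner u ≠ i → (∀ w ∈ W, G.E u w → w ∈ A) → u ∈ A
  own : ∀ u ∈ A, u ∉ U → G.owner u = i → ∃ a ∈ A, strat u = some a ∧ G.E u a ∧ r a < r u
  opp : ∀ u ∈ A, u ∉ U → G.owner u ≠ i → ∀ w ∈ W, G.E u w → w ∈ A ∧ r w < r u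
  strat_edge : ∀ u a, strat u = some a → G.owner u = i ∧ G.E u a

variable [DecidableEq V]

/-- The invariant of the attractor computation: `P` is the set of the vertices all of whose
predecessors have been inspected, and `C u` is the set of the successors of `u` from which `u` has
been inspected. -/
structure AttrInv (R : G.Input) (i : Player) (W X U P : Finset V) (C : V → Finset V)
    (s : AttrState V) (r : V → ℕ) : Prop where
  seed : U ⊆ s.A
  sub : s.A ⊆ X
  mem_A : ∀ x, x ∈ s.A ↔ x ∈ P ∨ x ∈ s.stack
  disj : ∀ x ∈ P, x ∉ s.stack
  nodup : s.stack.Nodup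
  counted : ∀ u, C u ⊆ P
  own : ∀ u ∈ s.A, u ∉ U → G.owner u = i → ∃ a ∈ s.A, s.strat u = some a ∧ G.E u a ∧ r a < r u
  opp : ∀ u ∈ s.A, u ∉ U → G.owner u ≠ i → ∀ w ∈ W, G.E u w → w ∈ s.A ∧ r w < r u
  strat_edge : ∀ u a, s.strat u = some a → G.owner u = i ∧ G.E u a
  deg_own : ∀ u ∈ X, u ∉ s.A → G.owner u = i → ∀ a ∈ C u, ¬ G.E u a
  deg_opp : ∀ u ∈ X, u ∉ s.A → G.owner u ≠ i → 1 ≤ s.deg u ∧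
    s.deg u = ((R.succ u).toFinset.filter fun w => w ∈ W ∧ w ∉ C u).card

theorem attrEdge_time (i : Player) (X : Finset V) (a : V) (s : AttrState V) (u : V) :
    (attrEdge G i X a s u).time ≤ s.time + 4 := by
  unfold attrEdge
  split_ifs <;> dsimp only <;> omega

/-- One inspected edge moves `a` into `C u`. The rank of a vertex is fixed when it enters the
attractor, so the conditions on older members are untouched. -/
theorem AttrInv.attrEdge {R : G.Input} {i : Player} {W X U P : Finset V} {C : V → Finset V}
    {s : AttrState V} {r : V → ℕ} (h : AttrInv R i W X U P C s r) {a u : V} (haP : a ∈ P)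
    (haW : a ∈ W) (haC : a ∉ C u) (hua : G.E u a) :
    ∃ r', AttrInv R i W X U P (Function.update C u (insert a (C u)))
      (ParityGame.attrEdge G i X a s u) r' := by
  have hcount : ∀ x, Function.update C u (insert a (C u)) x ⊆ P := by
    intro x
    by_cases hx : x = u
    · subst hx
      rw [Function.update_self]
      exact Finset.insert_subset haP (h.counted x)
    · rw [Function.update_of_ne hx]
      exact h.counted x
  have haA : a ∈ s.A := (h.mem_A a).2 (Or.inl haP)
  -- The edge to `a` is counted for the first time, so the number of uncounted successors drops by
  -- exactly one, as the counter does.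
  have hcard : ((R.succ u).toFinset.filter fun w => w ∈ W ∧ w ∉ C u).card =
      ((R.succ u).toFinset.filter fun w => w ∈ W ∧ w ∉ insert a (C u)).card + 1 := by
    rw [← Finset.card_insert_of_notMem (a := a) (by simp)]
    congr 1
    ext w
    by_cases hw : w = a
    · subst hw
      simp [haW, haC, R.mem_succ, hua]
    · simp [hw]
  unfold ParityGame.attrEdge
  split_ifs with h1 h2 h3
  · obtain ⟨huX, huA⟩ := h1
    have hu : ∀ x ∈ s.A, x ≠ u := fun x hx hxu => huA (hxu ▸ hx)
    -- The new vertex is ranked above all current members, so every edge from it into the old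
    -- attractor descends.
    refine ⟨Function.update r u (s.A.sup r + 1), ?_⟩
    constructor <;> try dsimp only
    · exact h.seed.trans (Finset.subset_insert _ _)
    · exact Finset.insert_subset huX h.sub
    · intro x
      rw [Finset.mem_insert, h.mem_A x, List.mem_cons]
      tauto
    · intro x hx hxs
      rcases List.mem_cons.1 hxs with hxu | hxs
      · exact hu x ((h.mem_A x).2 (Or.inl hx)) hxu
      · exact h.disj x hx hxs
    · exact List.nodup_cons.2 ⟨fun hus => huA ((h.mem_A u).2 (Or.inr hus)), h.nodup⟩
    · exact hcount
    · intro x hx hxU hxi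
      by_cases hxu : x = u
      · subst hxu
        refine ⟨a, Finset.mem_insert_of_mem haA, by simp, hua, ?_⟩
        rw [Function.update_self, Function.update_of_ne (hu a haA)]
        exact Nat.lt_succ_of_le (Finset.le_sup (f := r) haA)
      · obtain ⟨b, hb, h4, h5, h6⟩ := h.own x (Finset.mem_of_mem_insert_of_ne hx hxu) hxU hxi
        refine ⟨b, Finset.mem_insert_of_mem hb, by rwa [Function.update_of_ne hxu], h5, ?_⟩
        rwa [Function.update_of_ne hxu, Function.update_of_ne (hu b hb)]
    · intro x hx hxU hxi w hwW hxw
      have hxu : x ≠ u := fun hxu => hxi (hxu ▸ h2)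
      obtain ⟨h4, h5⟩ := h.opp x (Finset.mem_of_mem_insert_of_ne hx hxu) hxU hxi w hwW hxw
      refine ⟨Finset.mem_insert_of_mem h4, ?_⟩
      rwa [Function.update_of_ne hxu, Function.update_of_ne (hu w h4)]
    · intro x b hxb
      by_cases hxu : x = u
      · subst hxu
        rw [Function.update_self, Option.some.injEq] at hxb
        exact ⟨h2, hxb ▸ hua⟩
      · rw [Function.update_of_ne hxu] at hxb
        exact h.strat_edge x b hxb
    · intro x hxX hxA hxi
      rw [Finset.mem_insert, not_or] at hxA
      rw [Function.update_of_ne hxA.1]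
      exact h.deg_own x hxX hxA.2 hxi
    · intro x hxX hxA hxi
      rw [Finset.mem_insert, not_or] at hxA
      rw [Function.update_of_ne hxA.1]
      exact h.deg_opp x hxX hxA.2 hxi
  · obtain ⟨huX, huA⟩ := h1
    have hu : ∀ x ∈ s.A, x ≠ u := fun x hx hxu => huA (hxu ▸ hx)
    refine ⟨Function.update r u (s.A.sup r + 1), ?_⟩
    constructor <;> try dsimp only
    · exact h.seed.trans (Finset.subset_insert _ _)
    · exact Finset.insert_subset huX h.sub
    · intro x
      rw [Finset.mem_insert, h.mem_A x, List.mem_cons]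
      tauto
    · intro x hx hxs
      rcases List.mem_cons.1 hxs with hxu | hxs
      · exact hu x ((h.mem_A x).2 (Or.inl hx)) hxu
      · exact h.disj x hx hxs
    · exact List.nodup_cons.2 ⟨fun hus => huA ((h.mem_A u).2 (Or.inr hus)), h.nodup⟩
    · exact hcount
    · intro x hx hxU hxi
      have hxu : x ≠ u := fun hxu => h2 (hxu ▸ hxi)
      obtain ⟨b, hb, h4, h5, h6⟩ := h.own x (Finset.mem_of_mem_insert_of_ne hx hxu) hxU hxi
      refine ⟨b, Finset.mem_insert_of_mem hb, h4, h5, ?_⟩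
      rwa [Function.update_of_ne hxu, Function.update_of_ne (hu b hb)]
    · intro x hx hxU hxi w hwW hxw
      by_cases hxu : x = u
      · subst hxu
        -- The counter stood at `1` and the edge to `a` uses it up, so every other successor in `W`
        -- has been counted and lies in `P`.
        have hwA : w ∈ s.A := by
          by_contra hwA
          have hemp := (h.deg_opp x huX huA h2).2
          rw [h3, hcard] at hemp
          have hemp : ((R.succ x).toFinset.filter fun w => w ∈ W ∧ w ∉ insert a (C x)).card = 0 := by
            omega
          rw [Finset.card_eq_zero] at hemp
          have hmem : w ∈ (R.succ x).toFinset.filter fun w => w ∈ W ∧ w ∉ insert a (C x) := by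
            simp only [Finset.mem_filter, List.mem_toFinset, R.mem_succ, Finset.mem_insert, not_or]
            exact ⟨hxw, hwW, fun hwa => hwA (hwa ▸ haA),
              fun hwC => hwA ((h.mem_A w).2 (Or.inl (h.counted x hwC)))⟩
          rw [hemp] at hmem
          simp at hmem
        refine ⟨Finset.mem_insert_of_mem hwA, ?_⟩
        rw [Function.update_self, Function.update_of_ne (hu w hwA)]
        exact Nat.lt_succ_of_le (Finset.le_sup (f := r) hwA)
      · obtain ⟨h4, h5⟩ := h.opp x (Finset.mem_of_mem_insert_of_ne hx hxu) hxU hxi w hwW hxw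
        refine ⟨Finset.mem_insert_of_mem h4, ?_⟩
        rwa [Function.update_of_ne hxu, Function.update_of_ne (hu w h4)]
    · exact h.strat_edge
    · intro x hxX hxA hxi
      rw [Finset.mem_insert, not_or] at hxA
      rw [Function.update_of_ne hxA.1]
      exact h.deg_own x hxX hxA.2 hxi
    · intro x hxX hxA hxi
      rw [Finset.mem_insert, not_or] at hxA
      rw [Function.update_of_ne hxA.1]
      exact h.deg_opp x hxX hxA.2 hxi
  · obtain ⟨huX, huA⟩ := h1
    refine ⟨r, ?_⟩
    constructor <;> try dsimp only
    · exact h.seed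
    · exact h.sub
    · exact h.mem_A
    · exact h.disj
    · exact h.nodup
    · exact hcount
    · exact h.own
    · exact h.opp
    · exact h.strat_edge
    · intro x hxX hxA hxi
      have hxu : x ≠ u := fun hxu => h2 (hxu ▸ hxi)
      rw [Function.update_of_ne hxu]
      exact h.deg_own x hxX hxA hxi
    · intro x hxX hxA hxi
      have := h.deg_opp x hxX hxA hxi
      by_cases hxu : x = u
      · subst hxu
        rw [Function.update_self, Function.update_self]
        omega
      · rwa [Function.update_of_ne hxu, Function.update_of_ne hxu]
  · refine ⟨r, ?_⟩
    have hne : ∀ x ∈ X, x ∉ s.A → x ≠ u := fun x hxX hxA hxu => h1 (hxu ▸ ⟨hxX, hxA⟩)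
    constructor <;> try dsimp only
    · exact h.seed
    · exact h.sub
    · exact h.mem_A
    · exact h.disj
    · exact h.nodup
    · exact hcount
    · exact h.own
    · exact h.opp
    · exact h.strat_edge
    · intro x hxX hxA hxi
      rw [Function.update_of_ne (hne x hxX hxA)]
      exact h.deg_own x hxX hxA hxi
    · intro x hxX hxA hxi
      rw [Function.update_of_ne (hne x hxX hxA)]
      exact h.deg_opp x hxX hxA hxi

/-- The sets `C u` matter only along edges, so `C` can be made uniform again after all predecessors
of a vertex have been inspected. -/
theorem AttrInv.congr {R : G.Input} {i : Player} {W X U P : Finset V} {C C' : V → Finset V}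
    {s : AttrState V} {r : V → ℕ} (h : AttrInv R i W X U P C s r) (hP : ∀ u, C' u ⊆ P)
    (hC : ∀ u w, G.E u w → (w ∈ C u ↔ w ∈ C' u)) : AttrInv R i W X U P C' s r where
  seed := h.seed
  sub := h.sub
  mem_A := h.mem_A
  disj := h.disj
  nodup := h.nodup
  counted := hP
  own := h.own
  opp := h.opp
  strat_edge := h.strat_edge
  deg_own u hu huA hui a ha hua := h.deg_own u hu huA hui a ((hC u a hua).2 ha) hua
  deg_opp u hu huA hui := by
    refine ⟨(h.deg_opp u hu huA hui).1, (h.deg_opp u hu huA hui).2.trans ?_⟩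
    congr 1
    refine Finset.filter_congr fun w hw => ?_
    rw [hC u w ((R.mem_succ u w).1 (List.mem_toFinset.1 hw))]

theorem AttrInv.foldl {R : G.Input} {i : Player} {W X U P : Finset V} {a : V} (haP : a ∈ P)
    (haW : a ∈ W) (l : List V) : ∀ {C : V → Finset V} {s : AttrState V} {r : V → ℕ}, l.Nodup →
    (∀ u ∈ l, G.E u a ∧ a ∉ C u) → AttrInv R i W X U P C s r →
    ∃ r', AttrInv R i W X U P (fun u => if u ∈ l then insert a (C u) else C u)
      (l.foldl (ParityGame.attrEdge G i X a) s) r' := by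
  induction l with
  | nil =>
    intro C s r _ _ h
    exact ⟨r, by simpa using h⟩
  | cons u l ih =>
    intro C s r hl hE h
    rw [List.nodup_cons] at hl
    obtain ⟨h1, h2⟩ := hE u List.mem_cons_self
    obtain ⟨r₁, hr₁⟩ := h.attrEdge haP haW h2 h1
    have hne : ∀ x ∈ l, x ≠ u := fun x hx hxu => hl.1 (hxu ▸ hx)
    obtain ⟨r₂, hr₂⟩ := ih hl.2 (fun x hx => by
      rw [Function.update_of_ne (hne x hx)]
      exact hE x (List.mem_cons_of_mem _ hx)) hr₁
    refine ⟨r₂, ?_⟩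
    rw [List.foldl_cons]
    convert hr₂ using 1
    funext x
    by_cases hxu : x = u
    · subst hxu
      simp [hl.1]
    · simp [hxu]

theorem attrEdge_foldl_time (i : Player) (X : Finset V) (a : V) (l : List V) :
    ∀ s : AttrState V, (l.foldl (attrEdge G i X a) s).time ≤ s.time + 4 * l.length := by
  induction l with
  | nil => simp
  | cons u l ih =>
    intro s
    have h1 := ih (attrEdge G i X a s u)
    have h2 := attrEdge_time (G := G) i X a s u
    rw [List.foldl_cons, List.length_cons]
    omega

/-- Each round moves one vertex from the stack to `P`. So the complement of `P` bounds the rounds,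
and every predecessor list is traversed at most once. -/
theorem AttrInv.attrLoop {R : G.Input} {i : Player} {W X U : Finset V} (hXW : X ⊆ W) (f : ℕ) :
    ∀ {P : Finset V} {s : AttrState V} {r : V → ℕ}, Pᶜ.card ≤ f →
    AttrInv R i W X U P (fun _ => P) s r →
    ∃ r', IsAttr G i W X U (ParityGame.attrLoop G R i X f s).A
        (ParityGame.attrLoop G R i X f s).strat r' ∧
      (ParityGame.attrLoop G R i X f s).time ≤
        s.time + ∑ v ∈ Pᶜ, (1 + 4 * (R.pred v).length) := by
  -- With an empty stack `A = P`: every edge into `A` has been counted, and the invariants on the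
  -- counters become the closure conditions of an attractor.
  have done : ∀ {P : Finset V} {s : AttrState V} {r : V → ℕ}, s.stack = [] →
      AttrInv R i W X U P (fun _ => P) s r → IsAttr G i W X U s.A s.strat r := by
    intro P s r hs h
    have hA : s.A = P := by
      ext x
      simp [h.mem_A, hs]
    refine ⟨h.seed, h.sub, ?_, ?_, h.own, h.opp, h.strat_edge⟩
    · intro u hu hui a ha hua
      by_contra huA
      exact h.deg_own u hu huA hui a (hA ▸ ha) hua
    · intro u hu hui hall
      by_contra huA
      obtain ⟨h1, h2⟩ := h.deg_opp u hu huA hui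
      rw [h2, Nat.one_le_iff_ne_zero, ← Nat.pos_iff_ne_zero, Finset.card_pos] at h1
      obtain ⟨w, hw⟩ := h1
      simp only [Finset.mem_filter, List.mem_toFinset, R.mem_succ] at hw
      exact hw.2.2 (hA ▸ hall w hw.2.1 hw.1)
  induction f with
  | zero =>
    intro P s r hf h
    have hP : P = Finset.univ := by simpa using hf
    have hs : s.stack = [] := List.eq_nil_iff_forall_not_mem.2 fun x =>
      h.disj x (hP ▸ Finset.mem_univ x)
    exact ⟨r, done hs h, Nat.le_add_right _ _⟩
  | succ f ih =>
    intro P s r hf h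
    rw [ParityGame.attrLoop]
    rcases hs : s.stack with _ | ⟨a, rest⟩
    · exact ⟨r, done hs h, Nat.le_add_right _ _⟩
    · dsimp only
      have haP : a ∉ P := fun ha => h.disj a ha (by simp [hs])
      have haA : a ∈ s.A := (h.mem_A a).2 (Or.inr (by simp [hs]))
      have hnd := h.nodup
      rw [hs, List.nodup_cons] at hnd
      have h' : AttrInv R i W X U (insert a P) (fun _ => P)
          { s with stack := rest, time := s.time + 1 } r := by
        refine ⟨h.seed, h.sub, ?_, ?_, hnd.2, fun _ => Finset.subset_insert _ _, h.own, h.opp,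
          h.strat_edge, h.deg_own, h.deg_opp⟩
        · intro x
          dsimp only
          rw [h.mem_A, hs, Finset.mem_insert, List.mem_cons]
          tauto
        · intro x hx hxr
          rcases Finset.mem_insert.1 hx with hxa | hx
          · exact hnd.1 (hxa ▸ hxr)
          · exact h.disj x hx (by simp [hs, hxr])
      obtain ⟨r₁, hr₁⟩ := h'.foldl (Finset.mem_insert_self a P) (hXW (h.sub haA)) (R.pred a)
        (R.pred_nodup a) fun u hu => ⟨(R.mem_pred a u).1 hu, haP⟩
      -- Vertices that are not predecessors of `a` have no edge to it, so `a` may be put into their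
      -- sets as well.
      have hr₂ := hr₁.congr (C' := fun _ => insert a P) (fun _ => subset_rfl) (by
        intro u w huw
        by_cases hu : u ∈ R.pred a
        · simp [hu]
        · have hwa : w ≠ a := fun hwa => hu ((R.mem_pred a u).2 (hwa ▸ huw))
          simp [hu, hwa])
      have haPc : a ∈ Pᶜ := Finset.mem_compl.2 haP
      have hcomp : (insert a P)ᶜ = Pᶜ.erase a := Finset.compl_insert
      obtain ⟨r₃, hr₃, ht⟩ := ih (by
        rw [hcomp, Finset.card_erase_of_mem haPc]
        omega) hr₂
      refine ⟨r₃, hr₃, ht.trans ?_⟩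
      have h4 := attrEdge_foldl_time (G := G) i X a (R.pred a)
        { s with stack := rest, time := s.time + 1 }
      have h5 := Finset.add_sum_erase Pᶜ (fun v => 1 + 4 * (R.pred v).length) haPc
      rw [hcomp]
      dsimp only at h4 h5
      omega

/-- Totality of `W` makes the initial counters positive; an opponent vertex without successors in
`W` would belong to the attractor vacuously but never be inspected. The cost is `3n + 2m` for the
set-up and `n + 4m` for the loop, with `n ≤ m`. -/
theorem attr_spec (R : G.Input) (i : Player) {W X U : Finset V} (hUX : U ⊆ X) (hXW : X ⊆ W)
    (htot : ∀ u ∈ W, ∃ w ∈ W, G.E u w) :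
    (∃ r, IsAttr G i W X U (attr G R i W X U).A (attr G R i W X U).strat r) ∧
      (attr G R i W X U).time ≤ 1 + 10 * G.numEdges := by
  have h0 : AttrInv R i W X U ∅ (fun _ => ∅)
      { A := U
        strat := fun _ => none
        deg := fun u => (R.succ u).countP (· ∈ W)
        stack := R.verts.filter (· ∈ U)
        time := 1 + (R.verts.map fun u => 3 + 2 * (R.succ u).length).sum } fun _ => 0 := by
    constructor <;> try dsimp only
    · exact subset_rfl
    · exact hUX
    · simp [R.mem_verts]
    · simp
    · exact R.verts_nodup.filter _
    · simp
    · intro u hu hu'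
      exact absurd hu hu'
    · intro u hu hu'
      exact absurd hu hu'
    · simp
    · simp
    · intro u huX _ _
      have hc : (R.succ u).countP (· ∈ W) =
          ((R.succ u).toFinset.filter fun w => w ∈ W ∧ w ∉ (∅ : Finset V)).card := by
        rw [List.countP_eq_length_filter,
          ← List.toFinset_card_of_nodup ((R.succ_nodup u).filter _)]
        congr 1
        ext w
        simp
      refine ⟨?_, hc⟩
      obtain ⟨w, hw, huw⟩ := htot u (hXW huX)
      exact List.countP_pos_iff.2 ⟨w, (R.mem_succ u w).2 huw, by simpa using hw⟩
  obtain ⟨r, hr, ht⟩ := AttrInv.attrLoop hXW R.verts.length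
    (by rw [R.length_verts]; exact Finset.card_le_univ _) h0
  refine ⟨⟨r, hr⟩, ht.trans ?_⟩
  dsimp only
  rw [R.sum_verts, Finset.compl_empty, Finset.sum_add_distrib, Finset.sum_add_distrib,
    ← Finset.mul_sum, ← Finset.mul_sum, R.sum_succ, R.sum_pred]
  simp only [Finset.sum_const, Finset.card_univ, smul_eq_mul]
  have := R.card_le
  omega

end ParityGame

/-! ### Lifting a vertex, and the measures that liftings produce. -/

namespace Meas

variable {d : ℕ}

theorem foldl_max_le_iff (l : List (Meas d)) (a x : Meas d) :
    l.foldl Meas.max a ≤ x ↔ a ≤ x ∧ ∀ y ∈ l, y ≤ x := by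
  induction l generalizing a with
  | nil => simp
  | cons b l ih =>
    rw [List.foldl_cons, ih, max_eq, sup_le_iff]
    simp [and_assoc]

theorem foldl_min_le_iff (l : List (Meas d)) (a x : Meas d) :
    l.foldl Meas.min a ≤ x ↔ a ≤ x ∨ ∃ y ∈ l, y ≤ x := by
  induction l generalizing a with
  | nil => simp
  | cons b l ih =>
    rw [List.foldl_cons, ih, min_eq, inf_le_iff]
    simp [or_assoc]

theorem foldl_max_mem (l : List (Meas d)) (a : Meas d) :
    l.foldl Meas.max a = a ∨ l.foldl Meas.max a ∈ l := by
  induction l generalizing a with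
  | nil => simp
  | cons b l ih =>
    rw [List.foldl_cons, Meas.max]
    split_ifs
    · rcases ih b with h | h
      · right
        rw [h]
        exact List.mem_cons_self
      · exact Or.inr (List.mem_cons_of_mem _ h)
    · exact (ih a).imp id (List.mem_cons_of_mem _)

theorem foldl_min_mem (l : List (Meas d)) (a : Meas d) :
    l.foldl Meas.min a = a ∨ l.foldl Meas.min a ∈ l := by
  induction l generalizing a with
  | nil => simp
  | cons b l ih =>
    rw [List.foldl_cons, Meas.min]
    split_ifs
    · rcases ih b with h | h
      · right
        rw [h]
        exact List.mem_cons_self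
      · exact Or.inr (List.mem_cons_of_mem _ h)
    · exact (ih a).imp id (List.mem_cons_of_mem _)

end Meas

namespace ParityGame

variable {V : Type u} [Fintype V] {G : ParityGame V}

theorem one_le_d (G : ParityGame V) : 1 ≤ G.d := Nat.le_add_left _ _

theorem prio_lt_d (G : ParityGame V) (v : V) : G.prio v < G.d :=
  Nat.lt_succ_of_le (Finset.le_sup (f := G.prio) (Finset.mem_univ v))

theorem owner_eq_odd_iff {v : V} : G.owner v = Player.odd ↔ G.owner v ≠ Player.even := by
  cases G.owner v <;> simp

/-- The minimum or maximum of `Prog(ρ, u, w)` over the successors `w` of `u` is at most `x`. -/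
def PreLe (ρ : V → Meas G.d) (u : V) (x : Meas G.d) : Prop :=
  (G.owner u = Player.even → ∃ w, G.E u w ∧ G.prog ρ u w ≤ x) ∧
    (G.owner u = Player.odd → ∀ w, G.E u w → G.prog ρ u w ≤ x)

theorem PreLe.mono {ρ ρ' : V → Meas G.d} (hρ : ∀ u, ρ u ∈ G.M) (hρ' : ∀ u, ρ' u ∈ G.M)
    (h : ∀ u, ρ u ≤ ρ' u) {u : V} {x : Meas G.d} (hu : PreLe ρ' u x) : PreLe ρ u x := by
  refine ⟨fun ho => ?_, fun ho w hw => ?_⟩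
  · obtain ⟨w, hw, hx⟩ := hu.1 ho
    exact ⟨w, hw, (progAt_mono _ (hρ w) (hρ' w) (h w)).trans hx⟩
  · exact (progAt_mono _ (hρ w) (hρ' w) (h w)).trans (hu.2 ho w hw)

theorem liftVal_le_iff (R : G.Input) (ρ : V → Meas G.d) (v : V) (x : Meas G.d) :
    liftVal R ρ v ≤ x ↔ ρ v ≤ x ∧ PreLe ρ v x := by
  unfold liftVal PreLe
  cases hv : G.owner v
  · simp only [Meas.max_eq, sup_le_iff, Meas.foldl_min_le_iff, List.mem_map, R.mem_succ,
      exists_exists_and_eq_and, forall_const, reduceCtorEq, false_imp_iff, and_true]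
    refine and_congr_right fun _ => ⟨?_, Or.inr⟩
    rintro (h | h)
    · obtain ⟨w, hw⟩ := G.total v
      exact ⟨w, hw, (Meas.le_top' _).trans h⟩
    · exact h
  · simp only [Meas.foldl_max_le_iff, List.mem_map, R.mem_succ, forall_const, reduceCtorEq,
      false_imp_iff, true_and, forall_exists_index, and_imp, forall_apply_eq_imp_iff₂]

theorem le_liftVal (R : G.Input) (ρ : V → Meas G.d) (v : V) : ρ v ≤ liftVal R ρ v :=
  ((liftVal_le_iff R ρ v _).1 le_rfl).1

/-- Every value assigned by a lift is the old one, `⊤` or a value of `Prog`. Membership in `M` and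
vanishing after the priority of the vertex are inherited from these. -/
theorem liftVal_cases (R : G.Input) (ρ : V → Meas G.d) (v : V) :
    liftVal R ρ v = ρ v ∨ liftVal R ρ v = Meas.top ∨ ∃ w, liftVal R ρ v = G.prog ρ v w := by
  unfold liftVal
  cases G.owner v
  · dsimp only
    rw [Meas.max]
    split_ifs
    · rcases Meas.foldl_min_mem ((R.succ v).map (G.prog ρ v)) Meas.top with h | h
      · exact Or.inr (Or.inl h)
      · obtain ⟨w, -, hw⟩ := List.mem_map.1 h
        exact Or.inr (Or.inr ⟨w, hw.symm⟩)
    · exact Or.inl rfl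
  · rcases Meas.foldl_max_mem ((R.succ v).map (G.prog ρ v)) (ρ v) with h | h
    · exact Or.inl h
    · obtain ⟨w, -, hw⟩ := List.mem_map.1 h
      exact Or.inr (Or.inr ⟨w, hw.symm⟩)

theorem liftVal_mem_M (R : G.Input) {ρ : V → Meas G.d} (hρ : ∀ u, ρ u ∈ G.M) (v : V) :
    liftVal R ρ v ∈ G.M := by
  rcases liftVal_cases R ρ v with h | h | ⟨w, h⟩ <;> rw [h]
  · exact hρ v
  · exact top_mem_M
  · exact progAt_mem_M _ (hρ w)

/-- The measures that occur in a run: they lie in the measure set, have no entries after the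
priority of the vertex, and are below all prefixed points of `Lift` that are the top element
wherever `ρ` is. -/
structure Reached (ρ : V → Meas G.d) : Prop where
  mem : ∀ u, ρ u ∈ G.M
  zero : ∀ u, ZeroAfter (G.prio u) (ρ u)
  least : ∀ φ : V → Meas G.d, (∀ u, φ u ∈ G.M) → (∀ u, ρ u = Meas.top → φ u = Meas.top) →
    (∀ u, ρ u ≤ φ u ∨ PreLe φ u (φ u)) → ∀ u, ρ u ≤ φ u

theorem reached_zero : Reached (G := G) fun _ => Meas.tup fun _ => 0 where
  mem _ := zero_mem_M
  zero _ a ha i _ := by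
    cases ha
    rfl
  least φ _ _ _ u := Meas.tup_zero_le _

/-- Leastness survives setting measures to `⊤` by fiat because the competitors `φ` are required to
be `⊤` there too. -/
theorem Reached.setTop {ρ ρ' : V → Meas G.d} (h : Reached ρ)
    (hρ : ∀ u, ρ' u = ρ u ∨ ρ' u = Meas.top) : Reached ρ' where
  mem u := by
    rcases hρ u with h' | h' <;> rw [h']
    · exact h.mem u
    · exact top_mem_M
  zero u := by
    rcases hρ u with h' | h' <;> rw [h']
    · exact h.zero u
    · intro a ha
      cases ha
  least φ hφ htop hpre u := by
    have hle : ∀ u, ρ u ≤ ρ' u := fun u => by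
      rcases hρ u with h' | h' <;> rw [h']
      exact Meas.le_top' _
    have := h.least φ hφ (fun u hu => htop u (Meas.eq_top_of_le (hle u) hu))
      (fun u => (hpre u).imp (hle u).trans id)
    rcases hρ u with h' | h'
    · rw [h']
      exact this u
    · rw [htop u h']
      exact Meas.le_top' _

variable [DecidableEq V]

theorem Reached.lift (R : G.Input) {ρ : V → Meas G.d} (h : Reached ρ) (v : V) :
    Reached (Function.update ρ v (liftVal R ρ v)) := by
  have hle : ∀ u, ρ u ≤ Function.update ρ v (liftVal R ρ v) u := fun u => by
    by_cases hu : u = v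
    · subst hu
      rw [Function.update_self]
      exact le_liftVal R ρ u
    · rw [Function.update_of_ne hu]
  refine ⟨fun u => ?_, fun u => ?_, fun φ hφ htop hpre u => ?_⟩
  · by_cases hu : u = v
    · subst hu
      rw [Function.update_self]
      exact liftVal_mem_M R h.mem u
    · rw [Function.update_of_ne hu]
      exact h.mem u
  · by_cases hu : u = v
    · subst hu
      rw [Function.update_self]
      rcases liftVal_cases R ρ u with h' | h' | ⟨w, h'⟩ <;> rw [h']
      · exact h.zero u
      · intro a ha
        cases ha
      · exact zeroAfter_progAt _ _
    · rw [Function.update_of_ne hu]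
      exact h.zero u
  · have hρφ := h.least φ hφ (fun u hu => htop u (Meas.eq_top_of_le (hle u) hu))
      (fun u => (hpre u).imp (hle u).trans id)
    by_cases hu : u = v
    · subst hu
      -- Either the lifted value is below `φ u` outright, or `φ` is prefixed at `u`; then `ρ ≤ φ`
      -- and monotonicity of `Prog` bound the lifted value by `φ u`.
      rcases hpre u with h' | h'
      · exact h'
      · rw [Function.update_self]
        exact (liftVal_le_iff R ρ u _).2 ⟨hρφ u, h'.mono h.mem hφ hρφ⟩
    · rw [Function.update_of_ne hu]
      exact hρφ u

/-! ### The potential -/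

/-- The tuples in the set of measures. -/
def tuples (G : ParityGame V) : Finset (Fin G.d → ℕ) :=
  Fintype.piFinset fun i => Finset.range (if Odd (i : ℕ) then G.numPrio i + 1 else 1)

theorem mem_tuples {a : Fin G.d → ℕ} : a ∈ G.tuples ↔ Meas.tup a ∈ G.M := by
  rw [tuples, Fintype.mem_piFinset]
  refine forall_congr' fun i => ?_
  rcases Nat.even_or_odd (i : ℕ) with h | h
  · have h' : ¬ Odd (i : ℕ) := Nat.not_odd_iff_even.2 h
    simp [h, h']
  · have h' : ¬ Even (i : ℕ) := Nat.not_even_iff_odd.2 h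
    simp [h, h']

open scoped Classical in
/-- The number of tuples that are at least `x`. -/
noncomputable def height (x : Meas G.d) : ℕ := (G.tuples.filter fun a => x ≤ Meas.tup a).card

theorem height_anti {x y : Meas G.d} (h : x ≤ y) : height y ≤ height x := by
  classical
  exact Finset.card_le_card fun a ha => by
    rw [Finset.mem_filter] at ha ⊢
    exact ⟨ha.1, h.trans ha.2⟩

/-- The tuple `x` itself is counted for `x` but not for `y`; this is where `x ∈ M` is needed. -/
theorem height_strictAnti {x y : Meas G.d} (hx : x ∈ G.M) (h : x < y) :
    height y + 1 ≤ height x := by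
  classical
  refine Finset.card_lt_card ⟨fun a ha => ?_, fun hsub => ?_⟩
  · rw [Finset.mem_filter] at ha ⊢
    exact ⟨ha.1, h.le.trans ha.2⟩
  · rcases x with a | _
    · have : a ∈ G.tuples.filter fun a => y ≤ Meas.tup a :=
        hsub (Finset.mem_filter.2 ⟨mem_tuples.2 hx, le_rfl⟩)
      exact absurd h (not_lt.2 (Finset.mem_filter.1 this).2)
    · exact absurd h (not_lt.2 (Meas.le_top' _))

theorem height_le (x : Meas G.d) : height x ≤ G.tuples.card := by
  classical
  exact Finset.card_filter_le _ _

/-- An upper bound on the cost of lifting `v` once. -/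
def liftCost (R : G.Input) (v : V) : ℕ :=
  12 * G.d * (1 + (R.succ v).length + (R.pred v).length)

/-- An upper bound on the cost of all liftings that are still possible. -/
noncomputable def potential (R : G.Input) (ρ : V → Meas G.d) : ℕ :=
  ∑ v, liftCost R v * height (ρ v)

theorem potential_anti (R : G.Input) {ρ ρ' : V → Meas G.d} (h : ∀ u, ρ u ≤ ρ' u) :
    potential R ρ' ≤ potential R ρ :=
  Finset.sum_le_sum fun u _ => Nat.mul_le_mul_left _ (height_anti (h u))

theorem potential_update (R : G.Input) {ρ : V → Meas G.d} {v : V} {x : Meas G.d}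
    (hv : ρ v ∈ G.M) (h : ρ v < x) :
    potential R (Function.update ρ v x) + liftCost R v ≤ potential R ρ := by
  unfold potential
  rw [← Finset.add_sum_erase _ _ (Finset.mem_univ v),
    ← Finset.add_sum_erase (a := v) _ (fun u => liftCost R u * height (ρ u)) (Finset.mem_univ v)]
  have h1 : ∑ u ∈ Finset.univ.erase v, liftCost R u * height (Function.update ρ v x u) =
      ∑ u ∈ Finset.univ.erase v, liftCost R u * height (ρ u) :=
    Finset.sum_congr rfl fun u hu => by rw [Function.update_of_ne (Finset.ne_of_mem_erase hu)]
  rw [h1, Function.update_self]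
  have h2 := Nat.mul_le_mul_left (liftCost R v) (height_strictAnti hv h)
  rw [Nat.mul_add, Nat.mul_one] at h2
  omega

/-! ### Counters and queue -/

/-- The number of successors `w` of `u` with `Prog(ρ, u, w) ≤ ρ(u)`. -/
def progCount (R : G.Input) (ρ : V → Meas G.d) (u : V) : ℕ :=
  (R.succ u).countP fun w => Meas.Le (G.prog ρ u w) (ρ u)

theorem liftable_progCount (R : G.Input) (ρ : V → Meas G.d) (u : V) :
    liftable R u (progCount R ρ u) = true ↔ ¬ PreLe ρ u (ρ u) := by
  unfold liftable progCount PreLe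
  cases hv : G.owner u
  · simp [List.countP_eq_zero, R.mem_succ, Meas.le_iff]
  · simp only [decide_eq_true_eq, reduceCtorEq, false_imp_iff, true_and, forall_const]
    rw [lt_iff_le_and_ne]
    simp [List.countP_le_length, List.countP_eq_length, R.mem_succ, Meas.le_iff]

/-- The counters and the queue are correct for the context `W`. -/
structure QueueInv (R : G.Input) (W : Finset V) (s : State G) : Prop where
  cnt : ∀ u ∈ W, s.cnt u = progCount R s.rho u
  queue : ∀ u, u ∈ s.queue ↔ u ∈ W ∧ ¬ PreLe s.rho u (s.rho u)

theorem inspect_foldl (R : G.Input) (l : List V) : ∀ s : State G,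
    (l.foldl (inspect R) s).rho = s.rho ∧ (l.foldl (inspect R) s).sigma = s.sigma ∧
    (∀ u, (l.foldl (inspect R) s).cnt u = if u ∈ l then progCount R s.rho u else s.cnt u) ∧
    (∀ u, u ∈ (l.foldl (inspect R) s).queue ↔
      u ∈ s.queue ∨ u ∈ l ∧ ¬ PreLe s.rho u (s.rho u)) ∧
    (l.foldl (inspect R) s).time =
      s.time + (l.map fun v => 3 + (2 * G.d + 2) * (R.succ v).length).sum := by
  induction l with
  | nil => simp
  | cons v l ih =>
    intro s
    obtain ⟨h1, h2, h3, h4, h5⟩ := ih (inspect R s v)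
    have hrho : (inspect R s v).rho = s.rho := rfl
    have hq : ∀ u, u ∈ (inspect R s v).queue ↔
        u ∈ s.queue ∨ u = v ∧ ¬ PreLe s.rho u (s.rho u) := by
      intro u
      have := liftable_progCount R s.rho v
      unfold progCount at this
      simp only [inspect]
      split_ifs with h
      · rw [Finset.mem_insert]
        constructor
        · rintro (rfl | h')
          · exact Or.inr ⟨rfl, this.1 h⟩
          · exact Or.inl h'
        · rintro (h' | h')
          · exact Or.inr h'
          · exact Or.inl h'.1
      · constructor
        · exact Or.inl
        · rintro (h' | ⟨rfl, h'⟩)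
          · exact h'
          · exact absurd (this.2 h') h
    rw [List.foldl_cons]
    refine ⟨h1, h2, fun u => ?_, fun u => ?_, ?_⟩
    · rw [h3, hrho]
      by_cases hl : u ∈ l
      · simp [hl]
      · by_cases hu : u = v
        · subst hu
          simp [hl, inspect, progCount]
        · simp [hl, hu, inspect]
    · rw [h4, hrho, hq, List.mem_cons]
      tauto
    · rw [h5]
      simp only [inspect, List.map_cons, List.sum_cons]
      omega

theorem initQueue_spec (R : G.Input) (W : Finset V) (s : State G) :
    (initQueue R W s).rho = s.rho ∧ (initQueue R W s).sigma = s.sigma ∧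
    QueueInv R W (initQueue R W s) ∧
    (initQueue R W s).time ≤ s.time + 1 + 5 * Fintype.card V + (2 * G.d + 2) * G.numEdges := by
  obtain ⟨h1, h2, h3, h4, h5⟩ := inspect_foldl R (R.verts.filter (· ∈ W))
    { s with queue := ∅, time := s.time + 1 + 2 * R.verts.length }
  refine ⟨h1, h2, ⟨fun u hu => ?_, fun u => ?_⟩, ?_⟩
  · rw [initQueue, h3, h1]
    simp [R.mem_verts, hu]
  · rw [initQueue, h4, h1]
    simp [R.mem_verts]
  · rw [initQueue, h5]
    have hsub : ((R.verts.filter (· ∈ W)).map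
        fun v => 3 + (2 * G.d + 2) * (R.succ v).length).sum ≤
        (R.verts.map fun v => 3 + (2 * G.d + 2) * (R.succ v).length).sum :=
      (List.filter_sublist.map _).sum_le_sum (fun _ _ => Nat.zero_le _)
    rw [R.sum_verts, Finset.sum_add_distrib, ← Finset.mul_sum, R.sum_succ] at hsub
    simp only [Finset.sum_const, Finset.card_univ, smul_eq_mul] at hsub
    dsimp only
    rw [R.length_verts]
    omega

/-- The counter of `u` after `touch`. -/
def touchCount (old new x : Meas G.d) (u : V) (c : ℕ) : ℕ :=
  if Meas.Le (G.progAt (G.prio u) old) x ∧ ¬ Meas.Le (G.progAt (G.prio u) new) x then c - 1 else c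

/-- As the list has no repetitions, each counter is changed at most once. Hence the queue can be
described by the final counters. -/
theorem touch_foldl (R : G.Input) (W : Finset V) (v : V) (old new : Meas G.d) (l : List V) :
    ∀ s : State G, l.Nodup →
    ∃ s', s' = l.foldl (fun s u => if u ∈ W ∧ u ≠ v then touch R old new (s.tick 3) u
      else s.tick 3) s ∧
    s'.rho = s.rho ∧ s'.sigma = s.sigma ∧
    (∀ u, s'.cnt u = if u ∈ l ∧ u ∈ W ∧ u ≠ v then touchCount old new (s.rho u) u (s.cnt u)
      else s.cnt u) ∧
    (∀ u, u ∈ s'.queue ↔ u ∈ s.queue ∨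
      (u ∈ l ∧ u ∈ W ∧ u ≠ v) ∧ liftable R u (s'.cnt u) = true) ∧
    s'.time ≤ s.time + (4 * G.d + 8) * l.length := by
  induction l with
  | nil =>
    intro s _
    exact ⟨s, rfl, by simp⟩
  | cons x l ih =>
    intro s hl
    rw [List.nodup_cons] at hl
    by_cases hx : x ∈ W ∧ x ≠ v
    · obtain ⟨s', h0, h1, h2, h3, h4, h5⟩ := ih (touch R old new (s.tick 3) x) hl.2
      have hcnt : ∀ u, (touch R old new (s.tick 3) x).cnt u =
          if u = x then touchCount old new (s.rho x) x (s.cnt x) else s.cnt u := by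
        intro u
        by_cases hu : u = x
        · subst hu
          simp only [touch, touchCount, Function.update_self, if_true, decide_eq_true_eq]
          rfl
        · simp [touch, State.tick, hu]
      have hq : ∀ u, u ∈ (touch R old new (s.tick 3) x).queue ↔ u ∈ s.queue ∨
          u = x ∧ liftable R x (touchCount old new (s.rho x) x (s.cnt x)) = true := by
        intro u
        have := hcnt x
        simp only [touch, Function.update_self, if_true] at this
        simp only [touch, this]
        split_ifs with h
        · rw [Finset.mem_insert]
          simp [State.tick, h, or_comm]
        · simp [State.tick, h]
      refine ⟨s', ?_, h1, h2, fun u => ?_, fun u => ?_, ?_⟩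
      · rw [List.foldl_cons, if_pos hx]
        exact h0
      · rw [h3, hcnt]
        by_cases hu : u = x
        · subst hu
          simp [hl.1, hx]
        · simp only [List.mem_cons, hu, false_or, if_false]
          rfl
      · rw [h4, hq]
        by_cases hu : u = x
        · subst hu
          have h6 : s'.cnt u = touchCount old new (s.rho u) u (s.cnt u) := by
            rw [h3, hcnt]
            simp [hl.1]
          simp [hl.1, hx, h6]
        · simp [hu]
      · refine h5.trans ?_
        simp only [touch, State.tick, List.length_cons]
        ring_nf
        omega
    · obtain ⟨s', h0, h1, h2, h3, h4, h5⟩ := ih (s.tick 3) hl.2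
      refine ⟨s', ?_, h1, h2, fun u => ?_, fun u => ?_, ?_⟩
      · rw [List.foldl_cons, if_neg hx]
        exact h0
      · rw [h3]
        by_cases hu : u = x
        · subst hu
          have h6 : ¬ (u ∈ l ∧ u ∈ W ∧ u ≠ v) := fun h => hx h.2
          have h7 : ¬ (u ∈ u :: l ∧ u ∈ W ∧ u ≠ v) := fun h => hx h.2
          rw [if_neg h6, if_neg h7]
          rfl
        · simp only [List.mem_cons, hu, false_or]
          rfl
      · rw [h4]
        by_cases hu : u = x
        · subst hu
          have h6 : ¬ (u ∈ l ∧ u ∈ W ∧ u ≠ v) := fun h => hx h.2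
          have h7 : ¬ (u ∈ u :: l ∧ u ∈ W ∧ u ≠ v) := fun h => hx h.2
          simp only [h6, h7, false_and, or_false]
          rfl
        · simp only [List.mem_cons, hu, false_or]
          rfl
      · refine h5.trans ?_
        simp only [State.tick, List.length_cons]
        ring_nf
        omega

theorem prog_update_of_not_edge {ρ : V → Meas G.d} {u v w : V} {x : Meas G.d} (huv : ¬ G.E u v)
    (huw : G.E u w) : G.prog (Function.update ρ v x) u w = G.prog ρ u w := by
  rw [prog, prog, Function.update_of_ne (by rintro rfl; exact huv huw)]

theorem progCount_update_of_not_edge (R : G.Input) {ρ : V → Meas G.d} {u v : V} {x : Meas G.d}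
    (huv : ¬ G.E u v) (hne : u ≠ v) :
    progCount R (Function.update ρ v x) u = progCount R ρ u := by
  unfold progCount
  refine List.countP_congr fun w hw => ?_
  rw [prog_update_of_not_edge huv ((R.mem_succ u w).1 hw), Function.update_of_ne hne]

theorem preLe_update_of_not_edge {ρ : V → Meas G.d} {u v : V} {x y : Meas G.d}
    (huv : ¬ G.E u v) : PreLe (Function.update ρ v x) u y ↔ PreLe ρ u y := by
  unfold PreLe
  refine and_congr (imp_congr_right fun _ => exists_congr fun w => and_congr_right fun hw => ?_)
    (imp_congr_right fun _ => forall_congr' fun w => imp_congr_right fun hw => ?_) <;>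
  rw [prog_update_of_not_edge huv hw]

/-- `v` occurs exactly once among the successors of `u`. Its `Prog` value can only rise, so the
count either loses this one or stays the same. -/
theorem progCount_update_of_edge (R : G.Input) {ρ : V → Meas G.d} {u v : V} {x : Meas G.d}
    (huv : G.E u v) (hne : u ≠ v) (hv : ρ v ∈ G.M) (hx : x ∈ G.M) (hle : ρ v ≤ x) :
    progCount R (Function.update ρ v x) u = touchCount (ρ v) x (ρ u) u (progCount R ρ u) := by
  obtain ⟨l₁, l₂, hl⟩ := List.append_of_mem ((R.mem_succ u v).2 huv)
  have hnd := R.succ_nodup u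
  rw [hl, List.nodup_append] at hnd
  obtain ⟨-, h2, h3⟩ := hnd
  rw [List.nodup_cons] at h2
  have hc : ∀ l : List V, v ∉ l →
      l.countP (fun w => Meas.Le (G.prog (Function.update ρ v x) u w)
        (Function.update ρ v x u)) = l.countP fun w => Meas.Le (G.prog ρ u w) (ρ u) := by
    intro l hvl
    refine List.countP_congr fun w hw => ?_
    rw [prog, prog, Function.update_of_ne hne, Function.update_of_ne (by rintro rfl; exact hvl hw)]
  have hmono := progAt_mono (G.prio u) hv hx hle
  unfold progCount
  rw [hl, List.countP_append, List.countP_append, List.countP_cons, List.countP_cons,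
    hc l₁ fun hv => h3 v hv v List.mem_cons_self rfl, hc l₂ h2.1]
  unfold touchCount
  simp only [prog, Function.update_self, Function.update_of_ne hne, Meas.le_iff,
    decide_eq_true_eq]
  by_cases h4 : G.progAt (G.prio u) (ρ v) ≤ ρ u
  · by_cases h5 : G.progAt (G.prio u) x ≤ ρ u
    · simp [h4, h5]
    · simp only [h4, h5, not_false_eq_true, and_self, if_true, if_false]
      omega
  · have h5 : ¬ G.progAt (G.prio u) x ≤ ρ u := fun h => h4 (hmono.trans h)
    simp [h4, h5]

/-- Only `v` and its predecessors can change status: predecessors are handled by `touch`, and `v` is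
recomputed because its own measure has changed. The `3` on the left pays for selecting `v`. -/
theorem lift_spec (R : G.Input) {W : Finset V} {s : State G} (hs : QueueInv R W s)
    (hM : ∀ u, s.rho u ∈ G.M) {v : V} (hv : v ∈ W) :
    (lift R W s v).rho = Function.update s.rho v (liftVal R s.rho v) ∧
    (lift R W s v).sigma = s.sigma ∧ QueueInv R W (lift R W s v) ∧
    (lift R W s v).time + 3 ≤ s.time + liftCost R v := by
  set new := liftVal R s.rho v with hnew
  obtain ⟨s', h0, h1, h2, h3, h4, h5⟩ := touch_foldl R W v (s.rho v) new (R.pred v)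
    { s with
      rho := Function.update s.rho v new
      queue := s.queue.erase v
      time := s.time + 3 + 3 * G.d + (2 * G.d + 1) * (R.succ v).length } (R.pred_nodup v)
  dsimp only at h1 h2 h3 h4 h5
  have hlift : lift R W s v = inspect R s' v := by
    rw [h0]
    rfl
  have hle : s.rho v ≤ new := le_liftVal R s.rho v
  have hnewM : new ∈ G.M := liftVal_mem_M R hM v
  have hmono : ∀ u, s.rho u ≤ Function.update s.rho v new u := fun u => by
    by_cases hu : u = v
    · subst hu
      rwa [Function.update_self]
    · rw [Function.update_of_ne hu]
  have hM' : ∀ u, Function.update s.rho v new u ∈ G.M := fun u => by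
    by_cases hu : u = v
    · subst hu
      rwa [Function.update_self]
    · rw [Function.update_of_ne hu]
      exact hM u
  have hcnt : ∀ u ∈ W, u ≠ v → s'.cnt u = progCount R (Function.update s.rho v new) u := by
    intro u hu huv
    rw [h3]
    by_cases hE : G.E u v
    · rw [if_pos ⟨(R.mem_pred v u).2 hE, hu, huv⟩, Function.update_of_ne huv, hs.cnt u hu,
        progCount_update_of_edge R hE huv (hM v) hnewM hle]
    · rw [if_neg fun h => hE ((R.mem_pred v u).1 h.1), hs.cnt u hu,
        progCount_update_of_not_edge R hE huv]
  obtain ⟨i1, i2, i3, i4, i5⟩ := inspect_foldl R [v] s'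
  rw [List.foldl_cons, List.foldl_nil] at i1 i2 i3 i4 i5
  rw [hlift]
  refine ⟨i1.trans h1, i2.trans h2, ⟨fun u hu => ?_, fun u => ?_⟩, ?_⟩
  · rw [i3, i1, h1]
    by_cases huv : u = v
    · simp [huv]
    · simp only [List.mem_singleton, huv, if_false]
      exact hcnt u hu huv
  · rw [i4, i1, h1, h4]
    by_cases huv : u = v
    · subst huv
      simp [hv]
    · rw [List.mem_singleton, Finset.mem_erase, hs.queue, Function.update_of_ne huv, R.mem_pred]
      simp only [huv, ne_eq, not_false_eq_true, true_and, and_true, false_and, or_false]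
      by_cases huW : u ∈ W
      · have hl := liftable_progCount R (Function.update s.rho v new) u
        rw [← hcnt u huW huv, Function.update_of_ne huv] at hl
        rw [hl]
        simp only [huW, true_and, and_true]
        by_cases hE : G.E u v
        · simp only [hE, true_and, or_iff_right_iff_imp]
          exact fun h h' => h (h'.mono hM hM' hmono)
        · simp [hE, preLe_update_of_not_edge hE]
      · simp [huW]
  · rw [i5]
    simp only [List.map_cons, List.map_nil, List.sum_cons, List.sum_nil, liftCost]
    -- The total is at most `3d + 9` plus `4d + 3` for each successor and `4d + 8` for each
    -- predecessor; the factor `12` covers all three since `d ≥ 1`.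
    have hd := one_le_d G
    nlinarith [Nat.mul_le_mul_right (R.succ v).length hd,
      Nat.mul_le_mul_right (R.pred v).length hd]

/-! ### The inner loop of liftings. -/

/-- Possible outcomes of the inner loop that started from the measures `ρ`. -/
def LoopOutcome (R : G.Input) (W : Finset V) (ρ ρ' : V → Meas G.d) : Option V → Prop
  | none => ∀ u ∈ W, ρ' u ≠ Meas.top ∧ PreLe ρ' u (ρ' u)
  | some v => v ∈ W ∧ ∃ ρ₀, Reached ρ₀ ∧ (∀ u ∈ W, ρ₀ u ≠ Meas.top) ∧ (∀ u, u ∉ W → ρ₀ u = ρ u) ∧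
      liftVal R ρ₀ v = Meas.top ∧ ρ' = Function.update ρ₀ v Meas.top

/-- Induction on a bound for the potential, which every proper lift decreases by at least its cost.
If a vertex reaches `⊤`, the outcome keeps the measures `ρ₀` just before that lift, to which the
later analysis applies. -/
theorem liftLoop_spec (R : G.Input) (pol : LiftingPolicy V) (W : Finset V) (n : ℕ) :
    ∀ s : State G, potential R s.rho ≤ n → QueueInv R W s → Reached s.rho →
    (∀ u ∈ W, s.rho u ≠ Meas.top) →
    ∃ s' o, (∃ f₀, ∀ f ≥ f₀, liftLoop R pol W f s = some (s', o)) ∧ s'.sigma = s.sigma ∧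
      (∀ u, u ∉ W → s'.rho u = s.rho u) ∧ (∀ u, s.rho u ≤ s'.rho u) ∧ Reached s'.rho ∧
      s'.time + potential R s'.rho ≤ s.time + potential R s.rho + 1 ∧
      LoopOutcome R W s.rho s'.rho o := by
  induction n with
  | zero =>
    intro s hn hq hr hnt
    -- A liftable vertex in `W` is not `⊤`, so it would contribute at least its lift cost to the
    -- potential.
    have hemp : s.queue = ∅ := by
      refine Finset.eq_empty_of_forall_notMem fun v hv => ?_
      obtain ⟨hvW, hlift⟩ := (hq.queue v).1 hv
      have hlt : s.rho v < Meas.top := Meas.lt_top_iff.2 (hnt v hvW)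
      have := potential_update R (hr.mem v) hlt
      have hc : 1 ≤ liftCost R v := by
        have := one_le_d G
        unfold liftCost
        exact Nat.mul_pos (by omega) (by omega)
      omega
    refine ⟨s.tick 1, none, ⟨1, fun f hf => ?_⟩, rfl, fun _ _ => rfl, fun _ => le_rfl, hr, ?_,
      fun u hu => ⟨hnt u hu, ?_⟩⟩
    · obtain ⟨f, rfl⟩ := Nat.exists_eq_add_of_le' hf
      simp [liftLoop, hemp]
    · simp only [State.tick]
      omega
    · by_contra h
      have := (hq.queue u).2 ⟨hu, h⟩
      simp [hemp] at this
  | succ n ih =>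
    intro s hn hq hr hnt
    by_cases hne : s.queue.Nonempty
    · set v := pol.choose s.time s.queue hne with hvdef
      obtain ⟨hvW, hlift⟩ := (hq.queue v).1 (pol.choose_mem s.time s.queue hne)
      have hq' : QueueInv R W (s.tick 3) := ⟨hq.cnt, hq.queue⟩
      obtain ⟨l1, l2, l3, l4⟩ := lift_spec R hq' hr.mem hvW
      set t := lift R W (s.tick 3) v with ht
      have hrho : (s.tick 3).rho = s.rho := rfl
      have hsig : (s.tick 3).sigma = s.sigma := rfl
      have htime : (s.tick 3).time = s.time + 3 := rfl
      rw [hrho] at l1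
      rw [hsig] at l2
      rw [htime] at l4
      have hlt : s.rho v < liftVal R s.rho v := by
        refine lt_of_le_of_ne (le_liftVal R s.rho v) fun heq => hlift ?_
        exact ((liftVal_le_iff R s.rho v _).1 heq.symm.le).2
      have hpot := potential_update R (hr.mem v) hlt
      have hr' : Reached t.rho := l1 ▸ hr.lift R v
      have hoff : ∀ u, u ∉ W → t.rho u = s.rho u := fun u hu => by
        rw [l1, Function.update_of_ne (ne_of_mem_of_not_mem hvW hu).symm]
      have hmono : ∀ u, s.rho u ≤ t.rho u := fun u => by
        rw [l1]
        by_cases hu : u = v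
        · rw [hu, Function.update_self]
          exact hlt.le
        · rw [Function.update_of_ne hu]
      rw [← l1] at hpot
      have hc : 1 ≤ liftCost R v := by
        have := one_le_d G
        unfold liftCost
        exact Nat.mul_pos (by omega) (by omega)
      have htv : t.rho v = liftVal R s.rho v := by rw [l1, Function.update_self]
      by_cases htop : t.rho v = Meas.top
      · refine ⟨t, some v, ⟨1, fun f hf => ?_⟩, l2, hoff, hmono, hr', by omega, hvW, s.rho, hr,
          hnt, fun _ _ => rfl, htv ▸ htop, ?_⟩
        · obtain ⟨f, rfl⟩ := Nat.exists_eq_add_of_le' hf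
          simp only [liftLoop, hne, dif_pos, ← hvdef, ← ht, Meas.isTop_iff.2 htop, if_true]
        · rw [l1, ← htv, htop]
      · obtain ⟨s', o, ⟨f₀, hf₀⟩, i1, i2, i3, i4, i5, i6⟩ := ih t (by omega) l3 hr' (by
          intro u hu
          by_cases huv : u = v
          · rwa [huv]
          · rw [l1, Function.update_of_ne huv]
            exact hnt u hu)
        refine ⟨s', o, ⟨f₀ + 1, fun f hf => ?_⟩, i1.trans l2, fun u hu => (i2 u hu).trans
          (hoff u hu), fun u => (hmono u).trans (i3 u), i4, by omega, ?_⟩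
        · obtain ⟨f, rfl⟩ := Nat.exists_eq_add_of_le' (le_trans (Nat.le_add_left 1 f₀) hf)
          simp only [liftLoop, hne, dif_pos, ← hvdef, ← ht, Meas.isTop_eq_false_iff.2 htop]
          exact hf₀ f (by omega)
        · rcases o with _ | w
          · exact i6
          · obtain ⟨h1, ρ₀, h2, h3, h4, h5⟩ := i6
            exact ⟨h1, ρ₀, h2, h3, fun u hu => (h4 u hu).trans (hoff u hu), h5⟩
    · rw [Finset.not_nonempty_iff_eq_empty] at hne
      refine ⟨s.tick 1, none, ⟨1, fun f hf => ?_⟩, rfl, fun _ _ => rfl, fun _ => le_rfl, hr, ?_,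
        fun u hu => ⟨hnt u hu, ?_⟩⟩
      · obtain ⟨f, rfl⟩ := Nat.exists_eq_add_of_le' hf
        simp [liftLoop, hne]
      · simp only [State.tick]
        omega
      · by_contra h
        have := (hq.queue u).2 ⟨hu, h⟩
        simp [hne] at this

end ParityGame

namespace ParityGame

variable {V : Type u} [Fintype V] {G : ParityGame V}

/-! ### Bounds on measures -/

/-- The number of vertices of priority `j` in `S`. -/
def prioCount (G : ParityGame V) (S : Finset V) (j : ℕ) : ℕ :=
  (S.filter fun x => G.prio x = j).card

theorem prioCount_le (S : Finset V) (j : ℕ) : G.prioCount S j ≤ G.numPrio j :=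
  Finset.card_le_card (Finset.filter_subset_filter _ (Finset.subset_univ S))

theorem prioCount_lt {S : Finset V} {v : V} (hv : v ∉ S) :
    G.prioCount S (G.prio v) < G.numPrio (G.prio v) := by
  refine Finset.card_lt_card ⟨Finset.filter_subset_filter _ (Finset.subset_univ S), fun h => hv ?_⟩
  exact (Finset.mem_filter.1 (h (Finset.mem_filter.2 ⟨Finset.mem_univ v, rfl⟩))).1

theorem prioCount_add_le {S T X : Finset V} (hS : S ⊆ X) (hT : T ⊆ X) (h : Disjoint S T) (j : ℕ) :
    G.prioCount S j + G.prioCount T j ≤ G.prioCount X j := by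
  classical
  unfold prioCount
  rw [← Finset.card_union_of_disjoint (Finset.disjoint_filter_filter h), ← Finset.filter_union]
  exact Finset.card_le_card (Finset.filter_subset_filter _ (Finset.union_subset hS hT))

/-- The tuple that is maximal at the odd positions before `k` and given by `c` at the later ones. -/
def boundTuple (G : ParityGame V) (k : ℕ) (c : ℕ → ℕ) : Fin G.d → ℕ := fun j =>
  if Even (j : ℕ) then 0 else if (j : ℕ) < k then G.numPrio j else c j

theorem boundTuple_mem_M {k : ℕ} {c : ℕ → ℕ} (hc : ∀ j, c j ≤ G.numPrio j) :
    Meas.tup (G.boundTuple k c) ∈ G.M := by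
  intro i
  unfold boundTuple
  refine ⟨fun h => by simp [h], fun h => ?_⟩
  simp only [Nat.not_even_iff_odd.2 h, if_false]
  split_ifs
  · exact le_rfl
  · exact hc i

theorem boundTuple_le {k k' : ℕ} {c c' : ℕ → ℕ} (hk : k ≤ k') (hc : ∀ j, c j ≤ G.numPrio j)
    (hcc : ∀ j, k' ≤ j → c j ≤ c' j) (i : Fin G.d) :
    G.boundTuple k c i ≤ G.boundTuple k' c' i := by
  unfold boundTuple
  have := hc i
  have := hcc i
  split_ifs <;> omega

theorem progSpec_of_le {p : ℕ} {a b : Fin G.d → ℕ} (hp : p < G.d) (hb : Meas.tup b ∈ G.M)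
    (h : ∀ i : Fin G.d, (i : ℕ) ≤ p → a i ≤ b i)
    (hlt : Odd p → a ⟨p, hp⟩ < b ⟨p, hp⟩) : G.ProgSpec p (Meas.tup a) (Meas.tup b) := by
  refine ⟨hb, fun _ => Meas.leUpTo_iff.2 (Meas.trunc_tup_le h), fun ho => Or.inl ?_⟩
  exact Meas.ltUpTo_iff.2 (Meas.trunc_tup_lt h ⟨p, hp⟩ rfl (hlt ho))

/-- The form in which counting is used: one vertex of priority `k` missing from the count leaves
position `k` unsaturated. -/
theorem progAt_ne_top_of_le_boundTuple {k : ℕ} (hk : Odd k) (hkd : k < G.d) {c : ℕ → ℕ}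
    (hc : ∀ j, c j ≤ G.numPrio j) (hck : c k < G.numPrio k) {x : Meas G.d} (hx : x ∈ G.M)
    (hle : x ≤ Meas.tup (G.boundTuple k c)) : G.progAt k x ≠ Meas.top := by
  intro htop
  refine progAt_ne_top_of_lt hk (a := G.boundTuple k c) ⟨k, hkd⟩ rfl ?_
    (Meas.eq_top_of_le (progAt_mono k hx (boundTuple_mem_M hc) hle) htop)
  simpa [boundTuple, Nat.not_even_iff_odd.2 hk] using hck

variable [DecidableEq V]

/-! ### Contexts, and bounds on measures by counting vertices. -/

/-- The vertices outside of `W` that have not been resolved. -/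
def frozen (ρ : V → Meas G.d) (W : Finset V) : Finset V :=
  Finset.univ.filter fun x => x ∉ W ∧ (ρ x).isTop = false

theorem mem_frozen {ρ : V → Meas G.d} {W : Finset V} {x : V} :
    x ∈ frozen ρ W ↔ x ∉ W ∧ ρ x ≠ Meas.top := by
  rw [frozen, Finset.mem_filter, Meas.isTop_eq_false_iff]
  simp

/-- The properties of a context `W` in which the algorithm is called. -/
structure Context (G : ParityGame V) (ρ : V → Meas G.d) (W : Finset V) (k₀ : ℕ) : Prop where
  prio_le : ∀ u ∈ W, k₀ ≤ G.prio u
  ne_top : ∀ u ∈ W, ρ u ≠ Meas.top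
  exists_succ : ∀ u ∈ W, ∃ w ∈ W, G.E u w
  -- Exits from `W` give neither player an advantage: Even can leave only to vertices already lost,
  -- and Odd only to unresolved ones, whose measures `bound` controls.
  even_out : ∀ u ∈ W, G.owner u = Player.even → ∀ x, x ∉ W → G.E u x → ρ x = Meas.top
  odd_out : ∀ u ∈ W, G.owner u = Player.odd → ∀ x, x ∉ W → G.E u x → ρ x ≠ Meas.top
  bound : ∀ x, x ∉ W → ρ x ≠ Meas.top →
    ρ x ≤ Meas.tup (G.boundTuple k₀ (G.prioCount (frozen ρ W)))

theorem Context.congr {ρ ρ' : V → Meas G.d} {W : Finset V} {k₀ : ℕ} (h : Context G ρ W k₀)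
    (hoff : ∀ u, u ∉ W → ρ' u = ρ u) (hW : ∀ u ∈ W, ρ' u ≠ Meas.top) : Context G ρ' W k₀ := by
  have hf : frozen ρ' W = frozen ρ W := by
    ext x
    rw [mem_frozen, mem_frozen]
    exact and_congr_right fun hx => by rw [hoff x hx]
  refine ⟨h.prio_le, hW, h.exists_succ, fun u hu ho x hx hux => ?_, fun u hu ho x hx hux => ?_,
    fun x hx hxt => ?_⟩
  · rw [hoff x hx]
    exact h.even_out u hu ho x hx hux
  · rw [hoff x hx]
    exact h.odd_out u hu ho x hx hux
  · rw [hoff x hx] at hxt ⊢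
    rw [hf]
    exact h.bound x hx hxt

open scoped Classical in
/-- The number of vertices of priority `j` in `S` that are counted for `u` according to `Q`. -/
noncomputable def relCount (G : ParityGame V) (S : Finset V) (Q : ℕ → V → V → Prop) (u : V)
    (j : ℕ) : ℕ :=
  G.prioCount (S.filter fun x => Q j x u) j

/-- Moving from `u` to `w` does not increase the numbers `relCount`, and decreases the one at the
priority of `u` if that is odd. -/
def Descends (G : ParityGame V) (S : Finset V) (Q : ℕ → V → V → Prop) (u w : V) : Prop :=
  w ∈ S ∧ (∀ j ≤ G.prio u, ∀ x ∈ S, Q j x w → Q j x u) ∧ (Odd (G.prio u) → ¬ Q (G.prio u) u w)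

theorem relCount_le_prioCount (S : Finset V) (Q : ℕ → V → V → Prop) (u : V) (j : ℕ) :
    G.relCount S Q u j ≤ G.prioCount S j := by
  classical
  exact Finset.card_le_card (Finset.filter_subset_filter _ (Finset.filter_subset _ _))

theorem Descends.relCount_le {S : Finset V} {Q : ℕ → V → V → Prop} {u w : V}
    (h : G.Descends S Q u w) {j : ℕ} (hj : j ≤ G.prio u) :
    G.relCount S Q w j ≤ G.relCount S Q u j := by
  classical
  refine Finset.card_le_card fun x hx => ?_
  simp only [Finset.mem_filter] at hx ⊢
  exact ⟨⟨hx.1.1, h.2.1 j hj x hx.1.1 hx.1.2⟩, hx.2⟩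

theorem relCount_pos {S : Finset V} {Q : ℕ → V → V → Prop} {u : V} (hu : u ∈ S)
    (hQ : Q (G.prio u) u u) : 0 < G.relCount S Q u (G.prio u) := by
  classical
  refine Finset.card_pos.2 ⟨u, ?_⟩
  simp only [Finset.mem_filter]
  exact ⟨⟨hu, hQ⟩, trivial⟩

/-- The vertex `u` is counted for itself but no longer for `w`. -/
theorem Descends.relCount_lt {S : Finset V} {Q : ℕ → V → V → Prop} {u w : V}
    (h : G.Descends S Q u w) (hu : u ∈ S) (hQ : Q (G.prio u) u u) (ho : Odd (G.prio u)) :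
    G.relCount S Q w (G.prio u) < G.relCount S Q u (G.prio u) := by
  classical
  refine Finset.card_lt_card ⟨fun x hx => ?_, fun hsub => ?_⟩
  · simp only [Finset.mem_filter] at hx ⊢
    exact ⟨⟨hx.1.1, h.2.1 _ le_rfl x hx.1.1 hx.1.2⟩, hx.2⟩
  · have hmem : u ∈ (S.filter fun x => Q (G.prio u) x u).filter fun x => G.prio x = G.prio u := by
      simp only [Finset.mem_filter]
      exact ⟨⟨hu, hQ⟩, trivial⟩
    have := hsub hmem
    simp only [Finset.mem_filter] at this
    exact h.2.2 ho this.1.2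

/-- If Even can descend with respect to `Q` inside `S` from all vertices of priority at least `k`,
then the measures on `S` are bounded by the numbers of vertices that are counted by `Q`. -/
theorem Context.le_boundTuple {ρ : V → Meas G.d} {W : Finset V} {k₀ k : ℕ}
    (hctx : Context G ρ W k₀) (hρ : Reached ρ) (hk : k₀ ≤ k) {S : Finset V} (hS : S ⊆ W)
    {Q : ℕ → V → V → Prop} (hQ : ∀ u ∈ S, k ≤ G.prio u → Q (G.prio u) u u)
    (heven : ∀ u ∈ S, k ≤ G.prio u → G.owner u = Player.even →
      ∃ w, G.E u w ∧ G.Descends S Q u w)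
    (hodd : ∀ u ∈ S, k ≤ G.prio u → G.owner u = Player.odd →
      ∀ w ∈ W, G.E u w → G.Descends S Q u w) :
    ∀ u ∈ S, ρ u ≤ Meas.tup (G.boundTuple k fun j =>
        G.prioCount (frozen ρ W) j + G.relCount S Q u j) ∧
      (k ≤ G.prio u → PreLe ρ u (Meas.tup (G.boundTuple k fun j =>
        G.prioCount (frozen ρ W) j + G.relCount S Q u j))) := by
  have hdisj : Disjoint (frozen ρ W) S :=
    Finset.disjoint_left.2 fun x hx hxS => (mem_frozen.1 hx).1 (hS hxS)
  -- The unresolved vertices outside `W` and those of `S` are disjoint, so the combined counts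
  -- respect the caps `nⱼ`.
  have hcle : ∀ u j, G.prioCount (frozen ρ W) j + G.relCount S Q u j ≤ G.numPrio j := fun u j =>
    (Nat.add_le_add_left (relCount_le_prioCount S Q u j) _).trans
      (prioCount_add_le (Finset.subset_univ _) (Finset.subset_univ _) hdisj j)
  set b : V → Meas G.d := fun u => Meas.tup (G.boundTuple k fun j =>
        G.prioCount (frozen ρ W) j + G.relCount S Q u j) with hb
  have hbM : ∀ u, b u ∈ G.M := fun u => boundTuple_mem_M (hcle u)
  have hdesc : ∀ u w, u ∈ S → k ≤ G.prio u → G.Descends S Q u w →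
      G.progAt (G.prio u) (b w) ≤ b u := by
    intro u w hu hku hd
    refine progAt_le_of_spec (hbM w) (progSpec_of_le (prio_lt_d G u) (hbM u) (fun i hi => ?_)
      fun ho => ?_)
    · unfold boundTuple
      have := hd.relCount_le hi
      dsimp only
      split_ifs <;> omega
    · have := hd.relCount_lt hu (hQ u hu hku) ho
      simp only [boundTuple, Nat.not_even_iff_odd.2 ho, if_false, not_lt.2 hku]
      omega
  have hout : ∀ u w, u ∈ S → k ≤ G.prio u → w ∉ W → ρ w ≠ Meas.top →
      G.progAt (G.prio u) (ρ w) ≤ b u := by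
    -- A vertex outside `W` is bounded by the frozen count alone. Since `Q` counts `u` for itself,
    -- the bound at `u` is strictly larger at the priority of `u` when that is odd.
    intro u w hu hku hw hwt
    have hspec : G.ProgSpec (G.prio u)
        (Meas.tup (G.boundTuple k₀ (G.prioCount (frozen ρ W)))) (b u) := by
      refine progSpec_of_le (prio_lt_d G u) (hbM u) (fun i _ => ?_) fun ho => ?_
      · exact boundTuple_le hk (prioCount_le _) (fun j _ => Nat.le_add_right _ _) i
      · have := relCount_pos hu (hQ u hu hku)
        simp only [boundTuple, Nat.not_even_iff_odd.2 ho, if_false, not_lt.2 hku,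
          not_lt.2 (hk.trans hku)]
        omega
    exact progAt_le_of_spec (hρ.mem w) (hspec.mono (Meas.trunc_mono _ (hctx.bound w hw hwt)))
  -- The competitor for leastness: the counting bound on `S`, and `ρ` itself elsewhere, where
  -- nothing has to be proved.
  set φ : V → Meas G.d := fun u => if u ∈ S then b u else ρ u with hφ
  have hφS : ∀ u ∈ S, φ u = b u := fun u hu => if_pos hu
  have hφN : ∀ u, u ∉ S → φ u = ρ u := fun u hu => if_neg hu
  have hφM : ∀ u, φ u ∈ G.M := fun u => by
    by_cases hu : u ∈ S
    · rw [hφS u hu]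
      exact hbM u
    · rw [hφN u hu]
      exact hρ.mem u
  have hpre : ∀ u ∈ S, k ≤ G.prio u → PreLe φ u (b u) := by
    intro u hu hku
    refine ⟨fun ho => ?_, fun ho w hw => ?_⟩
    · obtain ⟨w, hw, hd⟩ := heven u hu hku ho
      refine ⟨w, hw, ?_⟩
      rw [prog, hφS w hd.1]
      exact hdesc u w hu hku hd
    · by_cases hwW : w ∈ W
      · have hd := hodd u hu hku ho w hwW hw
        rw [prog, hφS w hd.1]
        exact hdesc u w hu hku hd
      · rw [prog, hφN w fun h => hwW (hS h)]
        exact hout u w hu hku hwW (hctx.odd_out u (hS hu) ho w hwW hw)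
  have hle : ∀ u, ρ u ≤ φ u := by
    refine hρ.least φ hφM (fun u hu => ?_) fun u => ?_
    · rw [hφN u fun h => hctx.ne_top u (hS h) hu, hu]
    · by_cases hu : u ∈ S
      · rw [hφS u hu]
        by_cases hku : k ≤ G.prio u
        · exact Or.inr (hpre u hu hku)
        -- Below priority `k` no descent is needed: the bound is maximal at the odd positions before
        -- `k`, and `ρ u` vanishes after the priority of `u`.
        · left
          rcases hρu : ρ u with a | _
          · have ha := hρ.mem u
            rw [hρu] at ha
            refine Meas.tup_le_tup fun i => ?_
            unfold boundTuple
            split_ifs with h1 h2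
            · exact ((ha i).1 h1).le
            · exact (ha i).2 (Nat.not_even_iff_odd.1 h1)
            · rw [hρ.zero u a hρu i (by omega)]
              exact Nat.zero_le _
          · exact absurd hρu (hctx.ne_top u (hS hu))
      · exact Or.inl (hφN u hu).symm.le
  intro u hu
  refine ⟨?_, fun hku => (hpre u hu hku).mono hρ.mem hφM hle⟩
  have := hle u
  rwa [hφS u hu] at this

/-! ### Resolving a vertex that is lifted to the top -/

/-- In the context `W`, with the measures `ρ`, the vertex `v` is about to be lifted to the top;
`B` and `I` are the sets that the algorithm computes from it. -/
structure TopLift (R : G.Input) (ρ : V → Meas G.d) (W : Finset V) (k₀ : ℕ) (v : V)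
    (B I : Finset V) (τ τ' : V → Option V) (r r' : V → ℕ) : Prop where
  reached : Reached ρ
  ctx : Context G ρ W k₀
  mem : v ∈ W
  top : liftVal R ρ v = Meas.top
  res : IsAttr G Player.odd W (W.filter (G.prio v ≤ G.prio ·)) {v} B τ r
  irr : IsAttr G Player.even W W (W.filter (G.prio · < G.prio v)) I τ' r'

namespace TopLift

variable {R : G.Input} {ρ : V → Meas G.d} {W : Finset V} {k₀ : ℕ} {v : V} {B I : Finset V}
  {τ τ' : V → Option V} {r r' : V → ℕ}

theorem not_preLe (h : TopLift R ρ W k₀ v B I τ τ' r r') {x : Meas G.d} (hx : x ≠ Meas.top)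
    (hle : ρ v ≤ x) : ¬ PreLe ρ v x := fun hp =>
  hx (Meas.eq_top_of_le ((liftVal_le_iff R ρ v x).2 ⟨hle, hp⟩) h.top)

/-- If some `Prog` value were a tuple, the larger of it and `ρ v` would be a tuple bounding the
lift. -/
theorem even_prog_top (h : TopLift R ρ W k₀ v B I τ τ' r r') (ho : G.owner v = Player.even)
    {w : V} (hw : G.E v w) : G.prog ρ v w = Meas.top := by
  by_contra hne
  have hne' : ρ v ⊔ G.prog ρ v w ≠ Meas.top := by
    rcases le_total (ρ v) (G.prog ρ v w) with h' | h'
    · rwa [sup_eq_right.2 h']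
    · rw [sup_eq_left.2 h']
      exact h.ctx.ne_top v h.mem
  refine h.not_preLe hne' le_sup_left ⟨fun _ => ⟨w, hw, le_sup_right⟩, fun ho' => ?_⟩
  rw [ho] at ho'
  cases ho'

theorem odd_prog_top (h : TopLift R ρ W k₀ v B I τ τ' r r') (ho : G.owner v = Player.odd) :
    ∃ w, G.E v w ∧ G.prog ρ v w = Meas.top := by
  have hv := h.top
  unfold liftVal at hv
  rw [ho] at hv
  dsimp only at hv
  rcases Meas.foldl_max_mem ((R.succ v).map (G.prog ρ v)) (ρ v) with h' | h'
  · exact absurd (h'.symm.trans hv) (h.ctx.ne_top v h.mem)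
  · obtain ⟨w, hw, hw'⟩ := List.mem_map.1 h'
    exact ⟨w, (R.mem_succ v w).1 hw, hw'.trans hv⟩

theorem odd_succ_ne_top (h : TopLift R ρ W k₀ v B I τ τ' r r') (ho : G.owner v = Player.odd)
    {w : V} (hw : G.E v w) : ρ w ≠ Meas.top := by
  by_cases hwW : w ∈ W
  · exact h.ctx.ne_top w hwW
  · exact h.ctx.odd_out v h.mem ho w hwW hw

/-- At an even priority `Prog` never turns a tuple into `⊤`, and `v` has tuples at all relevant
successors: some one in `W` if Even owns it, all of them if Odd does. -/
theorem odd_prio (h : TopLift R ρ W k₀ v B I τ τ' r r') : Odd (G.prio v) := by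
  by_contra hodd
  have heven := Nat.not_odd_iff_even.1 hodd
  cases ho : G.owner v
  · obtain ⟨w, hwW, hw⟩ := h.ctx.exists_succ v h.mem
    exact progAt_ne_top_of_even heven (h.ctx.ne_top w hwW) (h.even_prog_top ho hw)
  · obtain ⟨w, hw, htop⟩ := h.odd_prog_top ho
    exact progAt_ne_top_of_even heven (h.odd_succ_ne_top ho hw) htop

theorem le_prio (h : TopLift R ρ W k₀ v B I τ τ' r r') : k₀ ≤ G.prio v := h.ctx.prio_le v h.mem

/-- Inside the attractor Even descends in rank, so `u` may be credited with exactly the vertices of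
rank at most its own. -/
theorem irr_bound (h : TopLift R ρ W k₀ v B I τ τ' r r') :
    ∀ u ∈ I, ρ u ≤ Meas.tup (G.boundTuple (G.prio v) fun j =>
        G.prioCount (frozen ρ W) j + G.relCount I (fun _ x u => r' x ≤ r' u) u j) ∧
      (G.prio v ≤ G.prio u → PreLe ρ u (Meas.tup (G.boundTuple (G.prio v) fun j =>
        G.prioCount (frozen ρ W) j + G.relCount I (fun _ x u => r' x ≤ r' u) u j))) := by
  have hseed : ∀ u, G.prio v ≤ G.prio u → u ∉ W.filter (G.prio · < G.prio v) := fun u hu hmem =>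
    absurd (Finset.mem_filter.1 hmem).2 (not_lt.2 hu)
  refine h.ctx.le_boundTuple h.reached h.le_prio h.irr.sub (fun u _ _ => le_rfl)
    (fun u hu hku ho => ?_) fun u hu hku ho w hwW hw => ?_
  · obtain ⟨w, hwI, -, hw, hr⟩ := h.irr.own u hu (hseed u hku) ho
    exact ⟨w, hw, hwI, fun j _ x _ hx => hx.trans hr.le, fun _ => not_le.2 hr⟩
  · obtain ⟨hwI, hr⟩ := h.irr.opp u hu (hseed u hku) (owner_eq_odd_iff.1 ho) w hwW hw
    exact ⟨hwI, fun j _ x _ hx => hx.trans hr.le, fun _ => not_le.2 hr⟩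

/-- Otherwise the counting bound would be a tuple above the lifted value of `v`. -/
theorem not_mem_irr (h : TopLift R ρ W k₀ v B I τ τ' r r') : v ∉ I := fun hv => by
  obtain ⟨h1, h2⟩ := h.irr_bound v hv
  exact h.not_preLe (by simp) h1 (h2 le_rfl)

/-- From a common vertex other than `v`, the player owning it has an attracting move into its own
attractor, and the other attractor, which leaves this player no escape, contains the target as well.
The rank towards `v` drops each time, so `v` would be in `I`. -/
theorem disjoint (h : TopLift R ρ W k₀ v B I τ τ' r r') : ∀ u ∈ B, u ∉ I := by
  have key : ∀ n u, r u = n → u ∈ B → u ∉ I := by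
    intro n
    induction n using Nat.strong_induction_on with
    | _ n ih =>
      intro u hn hu huI
      by_cases huv : u = v
      · exact h.not_mem_irr (huv ▸ huI)
      have huv' : u ∉ ({v} : Finset V) := by simpa using huv
      obtain ⟨huW, hku⟩ := Finset.mem_filter.1 (h.res.sub hu)
      have hseed : u ∉ W.filter (G.prio · < G.prio v) := fun hmem =>
        absurd (Finset.mem_filter.1 hmem).2 (not_lt.2 hku)
      cases ho : G.owner u
      · obtain ⟨w, hwI, -, hw, -⟩ := h.irr.own u huI hseed ho
        obtain ⟨hwB, hr⟩ := h.res.opp u hu huv' (by simp [ho]) w (h.irr.sub hwI) hw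
        exact ih _ (hn ▸ hr) w rfl hwB hwI
      · obtain ⟨w, hwB, -, hw, hr⟩ := h.res.own u hu huv' ho
        obtain ⟨hwI, -⟩ := h.irr.opp u huI hseed (by simp [ho]) w
          (Finset.mem_filter.1 (h.res.sub hwB)).1 hw
        exact ih _ (hn ▸ hr) w rfl hwB hwI
  exact fun u hu => key _ u rfl hu

theorem mem_res (h : TopLift R ρ W k₀ v B I τ τ' r r') : v ∈ B :=
  h.res.seed (Finset.mem_singleton_self v)

theorem res_subset (h : TopLift R ρ W k₀ v B I τ τ' r r') : B ⊆ W :=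
  h.res.sub.trans (Finset.filter_subset _ _)

theorem le_prio_of_notMem_irr (h : TopLift R ρ W k₀ v B I τ τ' r r') {u : V} (hu : u ∈ W)
    (huI : u ∉ I) : G.prio v ≤ G.prio u := by
  by_contra hlt
  exact huI (h.irr.seed (Finset.mem_filter.2 ⟨hu, not_le.1 hlt⟩))

theorem mem_rem {u : V} : u ∈ W \ (B ∪ I) ↔ u ∈ W ∧ u ∉ B ∧ u ∉ I := by
  simp

theorem rem_odd_succ (h : TopLift R ρ W k₀ v B I τ τ' r r') {u w : V} (hu : u ∈ W \ (B ∪ I))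
    (ho : G.owner u = Player.odd) (hw : G.E u w) : w ∉ B := fun hwB => by
  obtain ⟨h1, h2, h3⟩ := mem_rem.1 hu
  exact h2 (h.res.own_mem u (Finset.mem_filter.2 ⟨h1, h.le_prio_of_notMem_irr h1 h3⟩) ho w hwB hw)

theorem rem_even_succ (h : TopLift R ρ W k₀ v B I τ τ' r r') {u w : V} (hu : u ∈ W \ (B ∪ I))
    (ho : G.owner u = Player.even) (hw : G.E u w) : w ∉ I := fun hwI => by
  obtain ⟨h1, h2, h3⟩ := mem_rem.1 hu
  exact h3 (h.irr.own_mem u h1 ho w hwI hw)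

/-- The attractor `I` becomes part of the frozen set, with `irr_bound` supplying its bound; this is
why the threshold rises from `k₀` to the priority of `v`. The exit conditions hold because `REM` has
no edges of Odd into `B` and none of Even into `I`. -/
theorem context_rem (h : TopLift R ρ W k₀ v B I τ τ' r r') {ρ' : V → Meas G.d}
    (hB : ∀ u ∈ B, ρ' u = Meas.top) (hoff : ∀ u, u ∉ B → ρ' u = ρ u) :
    Context G ρ' (W \ (B ∪ I)) (G.prio v) := by
  have hfroz : ∀ j, G.prioCount (frozen ρ W) j + G.prioCount I j ≤
      G.prioCount (frozen ρ' (W \ (B ∪ I))) j := by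
    refine fun j => prioCount_add_le (fun x hx => ?_) (fun x hx => ?_)
      (Finset.disjoint_left.2 fun x hx hxI => (mem_frozen.1 hx).1 (h.irr.sub hxI)) j
    · obtain ⟨hxW, hxt⟩ := mem_frozen.1 hx
      refine mem_frozen.2 ⟨fun hx => hxW (mem_rem.1 hx).1, ?_⟩
      rwa [hoff x fun hxB => hxW (h.res_subset hxB)]
    · refine mem_frozen.2 ⟨fun hx' => (mem_rem.1 hx').2.2 hx, ?_⟩
      rw [hoff x fun hxB => h.disjoint x hxB hx]
      exact h.ctx.ne_top x (h.irr.sub hx)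
  constructor
  · intro u hu
    exact h.le_prio_of_notMem_irr (mem_rem.1 hu).1 (mem_rem.1 hu).2.2
  · intro u hu
    obtain ⟨h1, h2, h3⟩ := mem_rem.1 hu
    rw [hoff u h2]
    exact h.ctx.ne_top u h1
  · intro u hu
    obtain ⟨h1, h2, h3⟩ := mem_rem.1 hu
    cases ho : G.owner u
    · by_contra! hall
      refine h2 (h.res.opp_mem u (Finset.mem_filter.2 ⟨h1, h.le_prio_of_notMem_irr h1 h3⟩)
        (by simp [ho]) fun w hwW hw => ?_)
      by_contra hwB
      exact hall w (mem_rem.2 ⟨hwW, hwB, h.rem_even_succ hu ho hw⟩) hw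
    · by_contra! hall
      refine h3 (h.irr.opp_mem u h1 (by simp [ho]) fun w hwW hw => ?_)
      by_contra hwI
      exact hall w (mem_rem.2 ⟨hwW, h.rem_odd_succ hu ho hw, hwI⟩) hw
  · intro u hu ho x hx hux
    by_cases hxB : x ∈ B
    · exact hB x hxB
    · rw [hoff x hxB]
      refine h.ctx.even_out u (mem_rem.1 hu).1 ho x (fun hxW => hx ?_) hux
      exact mem_rem.2 ⟨hxW, hxB, h.rem_even_succ hu ho hux⟩
  · intro u hu ho x hx hux
    rw [hoff x (h.rem_odd_succ hu ho hux)]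
    by_cases hxW : x ∈ W
    · exact h.ctx.ne_top x hxW
    · exact h.ctx.odd_out u (mem_rem.1 hu).1 ho x hxW hux
  · intro x hx hxt
    have hxB : x ∉ B := fun hxB => hxt (hB x hxB)
    rw [hoff x hxB] at hxt ⊢
    by_cases hxW : x ∈ W
    · have hxI : x ∈ I := by
        by_contra hxI
        exact hx (mem_rem.2 ⟨hxW, hxB, hxI⟩)
      refine (h.irr_bound x hxI).1.trans (Meas.tup_le_tup fun i => ?_)
      unfold boundTuple
      split_ifs
      · exact le_rfl
      · exact le_rfl
      · exact (Nat.add_le_add_left (relCount_le_prioCount _ _ _ _) _).trans (hfroz i)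
    · refine (h.ctx.bound x hxW hxt).trans (Meas.tup_le_tup fun i => ?_)
      exact boundTuple_le h.le_prio (prioCount_le _)
        (fun j _ => (Nat.le_add_right _ _).trans (hfroz j)) i

/-- After the recursive call, the vertices of the context that are not dominated do not force `v`
to the top. -/
theorem progAt_ne_top (h : TopLift R ρ W k₀ v B I τ τ' r r') {ρ' : V → Meas G.d}
    (hB : ∀ u ∈ B, ρ' u = Meas.top) (hout : ∀ u, u ∉ W → ρ u = Meas.top → ρ' u = Meas.top)
    (hM : ∀ u, ρ' u ∈ G.M)
    (hstable : ∀ u ∈ W \ (B ∪ I), ρ' u ≠ Meas.top → PreLe ρ' u (ρ' u)) {w : V} (hw : w ∈ W)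
    (hwB : w ∉ B) (hwt : w ∈ W \ (B ∪ I) → ρ' w ≠ Meas.top) :
    G.progAt (G.prio v) (ρ w) ≠ Meas.top := by
  classical
  -- The vertices of `REM` that the recursive call left undominated.
  set N := (W \ (B ∪ I)).filter fun x => ρ' x ≠ Meas.top with hN
  have hmemN : ∀ x, x ∈ N ↔ (x ∈ W ∧ x ∉ B ∧ x ∉ I) ∧ ρ' x ≠ Meas.top := fun x => by
    rw [hN, Finset.mem_filter, mem_rem]
  have hNW : N ⊆ W := fun x hx => ((hmemN x).1 hx).1.1
  -- All of `I` counts below `N`. Inside `I` vertices are compared by rank, and inside `N` by the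
  -- new measures `ρ'` up to position `j`, which certify progress there because `N` is stable.
  set Q : ℕ → V → V → Prop := fun j x u =>
    if u ∈ I then x ∈ I ∧ r' x ≤ r' u else x ∈ I ∨ Meas.trunc j (ρ' x) ≤ Meas.trunc j (ρ' u)
    with hQ
  have hQI : ∀ j x u, u ∈ I → (Q j x u ↔ x ∈ I ∧ r' x ≤ r' u) := fun j x u hu => by
    simp only [hQ, hu, if_true]
  have hQN : ∀ j x u, u ∉ I → (Q j x u ↔ x ∈ I ∨ Meas.trunc j (ρ' x) ≤ Meas.trunc j (ρ' u)) :=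
    fun j x u hu => by simp only [hQ, hu, if_false]
  have hseed : ∀ u, G.prio v ≤ G.prio u → u ∉ W.filter (G.prio · < G.prio v) := fun u hu hmem =>
    absurd (Finset.mem_filter.1 hmem).2 (not_lt.2 hu)
  have hdI : ∀ u w, u ∈ I → w ∈ I → r' w < r' u → G.Descends (I ∪ N) Q u w := by
    intro u w hu hw hr
    refine ⟨Finset.mem_union_left _ hw, fun j _ x _ hx => ?_, fun _ hx => ?_⟩
    · obtain ⟨h1, h2⟩ := (hQI j x w hw).1 hx
      exact (hQI j x u hu).2 ⟨h1, h2.trans hr.le⟩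
    · exact absurd ((hQI _ _ _ hw).1 hx).2 (not_le.2 hr)
  have hdN : ∀ u w, u ∈ N → w ∈ N → G.prog ρ' u w ≤ ρ' u → G.Descends (I ∪ N) Q u w := by
    intro u w hu hw hle
    have huI := ((hmemN u).1 hu).1.2.2
    have hwI := ((hmemN w).1 hw).1.2.2
    have h1 := trunc_le_of_progAt_le (hM w) hle
    refine ⟨Finset.mem_union_right _ hw, fun j hj x _ hx => ?_, fun ho hx => ?_⟩
    · rw [hQN j x w hwI] at hx
      rw [hQN j x u huI]
      exact hx.imp id fun hx => hx.trans (Meas.trunc_le_trunc hj h1)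
    · rw [hQN _ _ _ hwI] at hx
      rcases hx with hx | hx
      · exact huI hx
      · exact absurd hx (not_le.2 (trunc_lt_of_progAt_le ho (hM w) hle ((hmemN u).1 hu).2))
  have hdNI : ∀ u w, u ∈ N → w ∈ I → G.Descends (I ∪ N) Q u w := by
    intro u w hu hw
    have huI := ((hmemN u).1 hu).1.2.2
    refine ⟨Finset.mem_union_left _ hw, fun j _ x _ hx => ?_, fun _ hx => ?_⟩
    · exact (hQN j x u huI).2 (Or.inl ((hQI j x w hw).1 hx).1)
    · exact huI ((hQI _ _ _ hw).1 hx).1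
  have hbound := h.ctx.le_boundTuple (S := I ∪ N) (Q := Q) h.reached h.le_prio
    (Finset.union_subset h.irr.sub hNW)
    (fun u hu _ => by
      by_cases huI : u ∈ I
      · exact (hQI _ _ _ huI).2 ⟨huI, le_rfl⟩
      · exact (hQN _ _ _ huI).2 (Or.inr le_rfl))
    (fun u hu hku ho => by
      rcases Finset.mem_union.1 hu with hu | hu
      · obtain ⟨w, hwI, -, hw, hr⟩ := h.irr.own u hu (hseed u hku) ho
        exact ⟨w, hw, hdI u w hu hwI hr⟩
      · obtain ⟨hurem, hut⟩ := (hmemN u).1 hu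
        have hurem' : u ∈ W \ (B ∪ I) := mem_rem.2 hurem
        obtain ⟨w, hw, hle⟩ := (hstable u hurem' hut).1 ho
        have hwt : ρ' w ≠ Meas.top := fun hwt => hut (Meas.eq_top_of_le hle (by
          rw [prog, hwt, progAt_top]))
        refine ⟨w, hw, hdN u w hu ((hmemN w).2 ⟨⟨?_, fun hwB => hwt (hB w hwB),
          h.rem_even_succ hurem' ho hw⟩, hwt⟩) hle⟩
        by_contra hwW
        exact hwt (hout w hwW (h.ctx.even_out u hurem.1 ho w hwW hw)))
    (fun u hu hku ho w hwW hw => by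
      rcases Finset.mem_union.1 hu with hu | hu
      · obtain ⟨hwI, hr⟩ := h.irr.opp u hu (hseed u hku) (owner_eq_odd_iff.1 ho) w hwW hw
        exact hdI u w hu hwI hr
      · obtain ⟨hurem, hut⟩ := (hmemN u).1 hu
        have hurem' : u ∈ W \ (B ∪ I) := mem_rem.2 hurem
        by_cases hwI : w ∈ I
        · exact hdNI u w hu hwI
        · have hle := (hstable u hurem' hut).2 ho w hw
          have hwt : ρ' w ≠ Meas.top := fun hwt => hut (Meas.eq_top_of_le hle (by
            rw [prog, hwt, progAt_top]))
          exact hdN u w hu ((hmemN w).2 ⟨⟨hwW, h.rem_odd_succ hurem' ho hw, hwI⟩, hwt⟩) hle)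
  have hwS : w ∈ I ∪ N := by
    by_cases hwI : w ∈ I
    · exact Finset.mem_union_left _ hwI
    · exact Finset.mem_union_right _ ((hmemN w).2 ⟨⟨hw, hwB, hwI⟩,
        hwt (mem_rem.2 ⟨hw, hwB, hwI⟩)⟩)
  have hdisj : Disjoint (frozen ρ W) (I ∪ N) := Finset.disjoint_left.2 fun x hx hxS =>
    (mem_frozen.1 hx).1 (Finset.union_subset h.irr.sub hNW hxS)
  -- The decisive missing vertex: `v` lies in `W` and in `B`, hence it is not counted, and the total
  -- at its priority stays below the cap.
  have hvS : v ∉ frozen ρ W ∪ (I ∪ N) := by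
    rw [Finset.mem_union, Finset.mem_union, mem_frozen, hmemN]
    have := h.mem
    have := h.mem_res
    have := h.not_mem_irr
    tauto
  have hle : ∀ j, G.prioCount (frozen ρ W) j + G.relCount (I ∪ N) Q w j ≤
      G.prioCount (frozen ρ W ∪ (I ∪ N)) j := fun j =>
    (Nat.add_le_add_left (relCount_le_prioCount _ _ _ _) _).trans
      (prioCount_add_le Finset.subset_union_left Finset.subset_union_right hdisj j)
  exact progAt_ne_top_of_le_boundTuple h.odd_prio (prio_lt_d G v)
    (fun j => (hle j).trans (prioCount_le _ j)) ((hle _).trans_lt (prioCount_lt hvS))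
    (h.reached.mem w) (hbound w hwS).1

/-- Shows that a successor which forces an Odd vertex `v` to `⊤` lies in `W`, where `σ v` is chosen.
-/
theorem progAt_ne_top_outside (h : TopLift R ρ W k₀ v B I τ τ' r r')
    (ho : G.owner v = Player.odd) {w : V} (hw : w ∉ W) (hvw : G.E v w) :
    G.progAt (G.prio v) (ρ w) ≠ Meas.top := by
  have hvF : v ∉ frozen ρ W := fun hv => (mem_frozen.1 hv).1 h.mem
  refine progAt_ne_top_of_le_boundTuple h.odd_prio (prio_lt_d G v) (prioCount_le _)
    (prioCount_lt hvF) (h.reached.mem w) ?_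
  refine (h.ctx.bound w hw (h.ctx.odd_out v h.mem ho w hw hvw)).trans (Meas.tup_le_tup fun i => ?_)
  exact boundTuple_le h.le_prio (prioCount_le _) (fun _ _ => le_rfl) i

end TopLift

/-- The context after the removal of an attractor of Odd all of whose vertices are resolved. -/
theorem Context.sdiff {ρ ρ' : V → Meas G.d} {W D A : Finset V} {k₀ : ℕ} {τ : V → Option V}
    {r : V → ℕ} (h : Context G ρ W k₀) (hA : IsAttr G Player.odd W W D A τ r)
    (hoff : ∀ u, u ∉ W → ρ' u = ρ u) (htop : ∀ u ∈ A, ρ' u = Meas.top)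
    (hnt : ∀ u ∈ W \ A, ρ' u ≠ Meas.top) : Context G ρ' (W \ A) k₀ := by
  -- Everything that leaves the context is resolved, so the frozen set and with it the bound are
  -- unchanged.
  have hf : frozen ρ' (W \ A) = frozen ρ W := by
    ext x
    rw [mem_frozen, mem_frozen, Finset.mem_sdiff]
    by_cases hxA : x ∈ A
    · simp [htop x hxA, hA.sub hxA]
    · by_cases hxW : x ∈ W
      · simp [hxA, hxW]
      · simp [hxW, hoff x hxW]
  have hmem : ∀ x, x ∉ W \ A → x ∈ A ∨ x ∉ W := fun x hx => by
    rw [Finset.mem_sdiff] at hx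
    tauto
  refine ⟨fun u hu => h.prio_le u (Finset.mem_sdiff.1 hu).1, hnt, fun u hu => ?_,
    fun u hu ho x hx hux => ?_, fun u hu ho x hx hux => ?_, fun x hx hxt => ?_⟩
  · obtain ⟨huW, huA⟩ := Finset.mem_sdiff.1 hu
    cases ho : G.owner u
    · by_contra! hall
      refine huA (hA.opp_mem u huW (by simp [ho]) fun w hwW hw => ?_)
      by_contra hwA
      exact hall w (Finset.mem_sdiff.2 ⟨hwW, hwA⟩) hw
    · obtain ⟨w, hwW, hw⟩ := h.exists_succ u huW
      exact ⟨w, Finset.mem_sdiff.2 ⟨hwW, fun hwA => huA (hA.own_mem u huW ho w hwA hw)⟩, hw⟩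
  · rcases hmem x hx with hxA | hxW
    · exact htop x hxA
    · rw [hoff x hxW]
      exact h.even_out u (Finset.mem_sdiff.1 hu).1 ho x hxW hux
  · rcases hmem x hx with hxA | hxW
    · exact absurd (hA.own_mem u (Finset.mem_sdiff.1 hu).1 ho x hxA hux)
        (Finset.mem_sdiff.1 hu).2
    · rw [hoff x hxW]
      exact h.odd_out u (Finset.mem_sdiff.1 hu).1 ho x hxW hux
  · rcases hmem x hx with hxA | hxW
    · exact absurd (htop x hxA) hxt
    · rw [hf]
      rw [hoff x hxW] at hxt ⊢
      exact h.bound x hxW hxt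

end ParityGame

namespace ParityGame

variable {V : Type u} {G : ParityGame V}

/-! ### Plays and strategies -/

/-- The play `π` follows the positional strategy `σ`. -/
def Follows (σ : V → Option V) (π : ℕ → V) : Prop := ∀ n w, σ (π n) = some w → π (n + 1) = w

theorem IsPlay.shift {π : ℕ → V} (h : G.IsPlay π) (N : ℕ) : G.IsPlay fun n => π (n + N) := by
  intro n
  have := h (n + N)
  rwa [Nat.add_right_comm] at this

theorem Follows.shift {σ : V → Option V} {π : ℕ → V} (h : Follows σ π) (N : ℕ) :
    Follows σ fun n => π (n + N) := by
  intro n w hw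
  have := h (n + N) w hw
  rwa [Nat.add_right_comm] at this

theorem frequently_shift {p : ℕ → Prop} (N : ℕ) :
    (∃ᶠ n in Filter.atTop, p (n + N)) ↔ ∃ᶠ n in Filter.atTop, p n := by
  rw [← Filter.frequently_map (m := fun n => n + N), Filter.map_add_atTop_eq_nat]

theorem wonBy_shift {i : Player} {π : ℕ → V} (N : ℕ) :
    G.WonBy i (fun n => π (n + N)) ↔ G.WonBy i π := by
  unfold WonBy
  have : ∀ q, (∃ᶠ n in Filter.atTop, G.prio (π (n + N)) = q) ↔
      ∃ᶠ n in Filter.atTop, G.prio (π n) = q := fun q =>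
    frequently_shift (p := fun n => G.prio (π n) = q) N
  simp only [this]

theorem wonBy_odd_of_frequently {π : ℕ → V} {k : ℕ} (hk : Odd k) (hle : ∀ n, k ≤ G.prio (π n))
    (hfreq : ∃ᶠ n in Filter.atTop, G.prio (π n) = k) : G.WonBy Player.odd π := by
  refine ⟨k, ⟨hfreq, fun q hq => ?_⟩, ?_⟩
  · obtain ⟨n, hn⟩ := Filter.Frequently.exists hq
    exact hn ▸ hle n
  · simp [Nat.not_even_iff_odd.2 hk]

/-- Within `W`, Even cannot leave `T`, and the strategy `σ` of Odd stays in `T` and wins all plays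
in `T`. -/
structure OddTrap (G : ParityGame V) (W T : Finset V) (σ : V → Option V) : Prop where
  sub : T ⊆ W
  odd : ∀ u ∈ T, G.owner u = Player.odd → ∃ w ∈ T, σ u = some w
  even : ∀ u ∈ T, G.owner u = Player.even → ∀ w ∈ W, G.E u w → w ∈ T
  win : ∀ π, G.IsPlay π → Follows σ π → (∀ n, π n ∈ T) → G.WonBy Player.odd π

namespace OddTrap

variable {W T D A : Finset V} {σ σ' : V → Option V}

theorem congr (h : OddTrap G W T σ) (hσ : ∀ u ∈ T, σ' u = σ u) : OddTrap G W T σ' := by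
  refine ⟨h.sub, fun u hu ho => ?_, h.even, fun π hπ hf hT => h.win π hπ (fun n w hw => ?_) hT⟩
  · rw [hσ u hu]
    exact h.odd u hu ho
  · exact hf n w (by rwa [hσ _ (hT n)])

theorem step (h : OddTrap G W T σ) {π : ℕ → V} (hπ : G.IsPlay π) (hf : Follows σ π) {n : ℕ}
    (hW : π (n + 1) ∈ W) (hn : π n ∈ T) : π (n + 1) ∈ T := by
  cases ho : G.owner (π n)
  · exact h.even _ hn ho _ hW (hπ n)
  · obtain ⟨w, hw, hσ⟩ := h.odd _ hn ho
    rw [hf n w hσ]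
    exact hw

theorem stays (h : OddTrap G W T σ) {π : ℕ → V} (hπ : G.IsPlay π) (hf : Follows σ π)
    (hW : ∀ n, π n ∈ W) {N : ℕ} (hN : π N ∈ T) : ∀ n, π (n + N) ∈ T := by
  intro n
  induction n with
  | zero => rwa [Nat.zero_add]
  | succ n ih =>
    rw [Nat.add_right_comm]
    exact h.step hπ hf (hW _) ih

theorem win_of_visit (h : OddTrap G W T σ) {π : ℕ → V} (hπ : G.IsPlay π) (hf : Follows σ π)
    (hW : ∀ n, π n ∈ W) {N : ℕ} (hN : π N ∈ T) : G.WonBy Player.odd π :=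
  (wonBy_shift N).1 (h.win _ (hπ.shift N) (hf.shift N) (h.stays hπ hf hW hN))

/-- A play that ever visits `A` is trapped and won there; any other play stays in `T`. -/
theorem union [DecidableEq V] (hA : OddTrap G W A σ) (hT : OddTrap G (W \ A) T σ) :
    OddTrap G W (A ∪ T) σ := by
  have hsub : A ∪ T ⊆ W := Finset.union_subset hA.sub (hT.sub.trans Finset.sdiff_subset)
  refine ⟨hsub, fun u hu ho => ?_, fun u hu ho w hw huw => ?_, fun π hπ hf hmem => ?_⟩
  · rcases Finset.mem_union.1 hu with hu | hu
    · obtain ⟨w, hw, hσ⟩ := hA.odd u hu ho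
      exact ⟨w, Finset.mem_union_left _ hw, hσ⟩
    · obtain ⟨w, hw, hσ⟩ := hT.odd u hu ho
      exact ⟨w, Finset.mem_union_right _ hw, hσ⟩
  · rcases Finset.mem_union.1 hu with hu | hu
    · exact Finset.mem_union_left _ (hA.even u hu ho w hw huw)
    · by_cases hwA : w ∈ A
      · exact Finset.mem_union_left _ hwA
      · exact Finset.mem_union_right _
          (hT.even u hu ho w (Finset.mem_sdiff.2 ⟨hw, hwA⟩) huw)
  · by_cases hv : ∃ N, π N ∈ A
    · obtain ⟨N, hN⟩ := hv
      exact hA.win_of_visit hπ hf (fun n => hsub (hmem n)) hN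
    · push Not at hv
      exact hT.win π hπ hf fun n => (Finset.mem_union.1 (hmem n)).resolve_left (hv n)

end OddTrap

/-- A play that stays in an attractor of Odd and follows the attracting strategy reaches the
target. -/
theorem IsAttr.reaches {W X U A : Finset V} {σ τ : V → Option V} {r : V → ℕ}
    (h : IsAttr G Player.odd W X U A τ r)
    (hσ : ∀ u ∈ A, u ∉ U → G.owner u = Player.odd → σ u = τ u) {π : ℕ → V} (hπ : G.IsPlay π)
    (hf : Follows σ π) (hW : ∀ n, π n ∈ W) {N : ℕ} (hN : π N ∈ A) : ∃ n ≥ N, π n ∈ U := by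
  have key : ∀ m N, r (π N) = m → π N ∈ A → ∃ n ≥ N, π n ∈ U := by
    intro m
    induction m using Nat.strong_induction_on with
    | _ m ih =>
      intro N hm hN
      by_cases hU : π N ∈ U
      · exact ⟨N, le_rfl, hU⟩
      have hnext : π (N + 1) ∈ A ∧ r (π (N + 1)) < r (π N) := by
        by_cases ho : G.owner (π N) = Player.odd
        · obtain ⟨a, ha, hτ, -, hr⟩ := h.own _ hN hU ho
          rw [hf N a (by rw [hσ _ hN hU ho, hτ])]
          exact ⟨ha, hr⟩
        · exact h.opp _ hN hU ho _ (hW _) (hπ N)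
      obtain ⟨n, hn, hnU⟩ := ih _ (hm ▸ hnext.2) (N + 1) rfl hnext.1
      exact ⟨n, (Nat.le_succ N).trans hn, hnU⟩
  exact key _ N rfl hN

theorem OddTrap.attr {W D A : Finset V} {σ τ : V → Option V} {r : V → ℕ}
    (hD : OddTrap G W D σ) (hA : IsAttr G Player.odd W W D A τ r)
    (hσ : ∀ u ∈ A, u ∉ D → G.owner u = Player.odd → σ u = τ u) : OddTrap G W A σ := by
  refine ⟨hA.sub, fun u hu ho => ?_, fun u hu ho w hw huw => ?_, fun π hπ hf hmem => ?_⟩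
  · by_cases huD : u ∈ D
    · obtain ⟨w, hw, h⟩ := hD.odd u huD ho
      exact ⟨w, hA.seed hw, h⟩
    · obtain ⟨a, ha, hτ, -, -⟩ := hA.own u hu huD ho
      exact ⟨a, ha, by rw [hσ u hu huD ho, hτ]⟩
  · by_cases huD : u ∈ D
    · exact hA.seed (hD.even u huD ho w hw huw)
    · exact (hA.opp u hu huD (by simp [ho]) w hw huw).1
  · obtain ⟨n, -, hn⟩ := hA.reaches hσ hπ hf (fun n => hA.sub (hmem n)) (hmem 0)
    exact hD.win_of_visit hπ hf (fun n => hA.sub (hmem n)) hn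

variable [Fintype V] [DecidableEq V]

/-- If a play in `B ∪ T` avoids `B` from some point on, it is won in `T`. Otherwise the attractor
leads it to `v` again and again, and the odd priority of `v` is the least one in `B ∪ T`. -/
theorem TopLift.oddTrap {R : G.Input} {ρ : V → Meas G.d} {W : Finset V} {k₀ : ℕ} {v : V}
    {B I T : Finset V} {τ τ' σ : V → Option V} {r r' : V → ℕ}
    (h : TopLift R ρ W k₀ v B I τ τ' r r') (hT : OddTrap G (W \ (B ∪ I)) T σ)
    (hσ : ∀ u ∈ B, u ≠ v → G.owner u = Player.odd → σ u = τ u)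
    (hodd : G.owner v = Player.odd → ∃ w ∈ B ∪ T, σ v = some w)
    (heven : G.owner v = Player.even → ∀ w ∈ W, G.E v w → w ∈ B ∪ T) :
    OddTrap G W (B ∪ T) σ := by
  have hsub : B ∪ T ⊆ W :=
    Finset.union_subset h.res_subset (hT.sub.trans Finset.sdiff_subset)
  refine ⟨hsub, fun u hu ho => ?_, fun u hu ho w hw huw => ?_, fun π hπ hf hmem => ?_⟩
  · by_cases huv : u = v
    · subst huv
      exact hodd ho
    rcases Finset.mem_union.1 hu with hu | hu
    · obtain ⟨a, ha, hτ, -, -⟩ := h.res.own u hu (by simpa using huv) ho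
      exact ⟨a, Finset.mem_union_left _ ha, by rw [hσ u hu huv ho, hτ]⟩
    · obtain ⟨w, hw, h'⟩ := hT.odd u hu ho
      exact ⟨w, Finset.mem_union_right _ hw, h'⟩
  · by_cases huv : u = v
    · subst huv
      exact heven ho w hw huw
    rcases Finset.mem_union.1 hu with hu | hu
    · exact Finset.mem_union_left _
        (h.res.opp u hu (by simpa using huv) (by simp [ho]) w hw huw).1
    · by_cases hwB : w ∈ B
      · exact Finset.mem_union_left _ hwB
      · refine Finset.mem_union_right _ (hT.even u hu ho w ?_ huw)
        exact TopLift.mem_rem.2 ⟨hw, hwB, h.rem_even_succ (hT.sub hu) ho huw⟩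
  · by_cases hev : ∃ N, ∀ n, π (n + N) ∉ B
    · obtain ⟨N, hN⟩ := hev
      exact (wonBy_shift N).1 (hT.win _ (hπ.shift N) (hf.shift N) fun n =>
        (Finset.mem_union.1 (hmem (n + N))).resolve_left (hN n))
    · push Not at hev
      refine wonBy_odd_of_frequently h.odd_prio (fun n => ?_) ?_
      · rcases Finset.mem_union.1 (hmem n) with hn | hn
        · exact (Finset.mem_filter.1 (h.res.sub hn)).2
        · obtain ⟨h1, -, h2⟩ := TopLift.mem_rem.1 (hT.sub hn)
          exact h.le_prio_of_notMem_irr h1 h2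
      · rw [Filter.frequently_atTop]
        intro N
        obtain ⟨n, hn⟩ := hev N
        obtain ⟨m, hm, hmv⟩ := h.res.reaches (σ := σ)
          (fun u hu huv => hσ u hu (by simpa using huv)) hπ hf (fun n => hsub (hmem n)) hn
        rw [Finset.mem_singleton] at hmv
        exact ⟨m, (Nat.le_add_left N n).trans hm, by rw [hmv]⟩

/-! ### The main procedure -/

/-- Stated for minima of a function into a linear order; the choice of a maximal successor uses the
order dual. -/
theorem argBest_spec {α : Type*} {β : Type*} [LinearOrder β] (f : α → β) {better : α → α → Bool}
    (hb : ∀ x b, better x b = true ↔ f x < f b) {l : List α} (hl : l ≠ []) :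
    ∃ b ∈ l, argBest better l = some b ∧ ∀ x ∈ l, f b ≤ f x := by
  have key : ∀ (l : List α) (b : α), ∃ b' ∈ b :: l,
      l.foldl (fun acc x => match acc with
        | none => some x
        | some b => if better x b then some x else some b) (some b) = some b' ∧
      ∀ x ∈ b :: l, f b' ≤ f x := by
    intro l
    induction l with
    | nil =>
      intro b
      exact ⟨b, by simp⟩
    | cons y l ih =>
      intro b
      rw [List.foldl_cons]
      dsimp only
      by_cases hy : better y b = true
      · rw [if_pos hy]
        obtain ⟨b', h1, h2, h3⟩ := ih y
        refine ⟨b', List.mem_cons_of_mem _ h1, h2, fun x hx => ?_⟩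
        rcases List.mem_cons.1 hx with rfl | hx
        · exact (h3 y List.mem_cons_self).trans ((hb y x).1 hy).le
        · exact h3 x hx
      · rw [if_neg hy]
        obtain ⟨b', h1, h2, h3⟩ := ih b
        refine ⟨b', ?_, h2, fun x hx => ?_⟩
        · rcases List.mem_cons.1 h1 with rfl | h1
          · exact List.mem_cons_self
          · exact List.mem_cons_of_mem _ (List.mem_cons_of_mem _ h1)
        · rcases List.mem_cons.1 hx with rfl | hx
          · exact h3 x List.mem_cons_self
          · rcases List.mem_cons.1 hx with rfl | hx
            · exact (h3 b List.mem_cons_self).trans (not_lt.1 fun h => hy ((hb x b).2 h))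
            · exact h3 x (List.mem_cons_of_mem _ hx)
  rcases l with _ | ⟨b, l⟩
  · exact absurd rfl hl
  · obtain ⟨b', h1, h2, h3⟩ := key l b
    exact ⟨b', h1, h2, h3⟩

/-- `σ` is a positional strategy of Odd. -/
def IsOddStrategy (G : ParityGame V) (σ : V → Option V) : Prop :=
  ∀ v w, σ v = some w → G.owner v = Player.odd ∧ G.E v w

theorem setSigma_spec (R : G.Input) {W : Finset V} {v : V} (s : State G)
    (hsucc : ∃ w ∈ W, G.E v w) :
    (setSigma R W v s).rho = s.rho ∧ (∀ u, u ≠ v → (setSigma R W v s).sigma u = s.sigma u) ∧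
    (IsOddStrategy G s.sigma → IsOddStrategy G (setSigma R W v s).sigma) ∧
    (G.owner v = Player.odd → ∃ w ∈ W, G.E v w ∧ (setSigma R W v s).sigma v = some w ∧
      ∀ x ∈ W, G.E v x → Meas.trunc (G.prio v) (s.rho x) ≤ Meas.trunc (G.prio v) (s.rho w)) ∧
    (setSigma R W v s).time ≤ s.time + 2 + (G.d + 3) * G.numEdges := by
  cases ho : G.owner v
  · have h : setSigma R W v s = s.tick 1 := by
      unfold setSigma
      rw [ho]
    rw [h]
    refine ⟨rfl, fun _ _ => rfl, id, fun h => by simp at h, ?_⟩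
    simp only [State.tick]
    omega
  · have h : setSigma R W v s = { s with
        sigma := Function.update s.sigma v
          (argBest (fun u b => Meas.LtUpTo (G.prio v) (s.rho b) (s.rho u))
            ((R.succ v).filter (· ∈ W)))
        time := s.time + 2 + (G.d + 3) * (R.succ v).length } := by
      unfold setSigma
      rw [ho]
    rw [h]
    have hmem : ∀ x, x ∈ (R.succ v).filter (· ∈ W) ↔ G.E v x ∧ x ∈ W := fun x => by
      simp [R.mem_succ]
    obtain ⟨w₀, hw₀, hvw₀⟩ := hsucc
    obtain ⟨w, hw, hbest, hmax⟩ := argBest_spec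
      (f := fun x => OrderDual.toDual (Meas.trunc (G.prio v) (s.rho x)))
      (better := fun u b => Meas.LtUpTo (G.prio v) (s.rho b) (s.rho u))
      (fun x b => by
        rw [decide_eq_true_eq, Meas.ltUpTo_iff]
        exact Iff.rfl)
      (List.ne_nil_of_mem ((hmem w₀).2 ⟨hvw₀, hw₀⟩))
    rw [hmem] at hw
    rw [hbest]
    refine ⟨rfl, fun u hu => Function.update_of_ne hu _ _, fun hσ u x hux => ?_,
      fun _ => ⟨w, hw.2, hw.1, Function.update_self _ _ _, fun x hx hvx =>
        hmax x ((hmem x).2 ⟨hvx, hx⟩)⟩, ?_⟩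
    · by_cases huv : u = v
      · subst huv
        dsimp only at hux
        rw [Function.update_self, Option.some.injEq] at hux
        exact ⟨ho, hux ▸ hw.1⟩
      · dsimp only at hux
        rw [Function.update_of_ne huv] at hux
        exact hσ u x hux
    · have := Nat.mul_le_mul_left (G.d + 3) (R.succ_length_le v)
      dsimp only
      omega

/-- The number of unresolved vertices of odd priority. -/
def openCount (ρ : V → Meas G.d) : ℕ :=
  (Finset.univ.filter fun u => Odd (G.prio u) ∧ (ρ u).isTop = false).card

theorem openCount_anti {ρ ρ' : V → Meas G.d} (h : ∀ u, ρ u ≤ ρ' u) :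
    openCount ρ' ≤ openCount ρ := by
  refine Finset.card_le_card fun u hu => ?_
  simp only [Finset.mem_filter, Meas.isTop_eq_false_iff] at hu ⊢
  exact ⟨hu.1, hu.2.1, fun ht => hu.2.2 (Meas.eq_top_of_le (h u) ht)⟩

theorem openCount_lt {ρ ρ' : V → Meas G.d} (h : ∀ u, ρ u ≤ ρ' u) {v : V} (hv : Odd (G.prio v))
    (hv1 : ρ v ≠ Meas.top) (hv2 : ρ' v = Meas.top) : openCount ρ' + 1 ≤ openCount ρ := by
  refine Finset.card_lt_card ⟨fun u hu => ?_, fun hsub => ?_⟩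
  · simp only [Finset.mem_filter, Meas.isTop_eq_false_iff] at hu ⊢
    exact ⟨hu.1, hu.2.1, fun ht => hu.2.2 (Meas.eq_top_of_le (h u) ht)⟩
  · have hmem : v ∈ Finset.univ.filter fun u => Odd (G.prio u) ∧ (ρ u).isTop = false := by
      simp only [Finset.mem_filter, Meas.isTop_eq_false_iff]
      exact ⟨Finset.mem_univ v, hv, hv1⟩
    have := hsub hmem
    simp only [Finset.mem_filter, Meas.isTop_eq_false_iff] at this
    exact this.2.2 hv2

/-- An upper bound on the cost of an iteration of the main loop without the liftings. -/
noncomputable def roundCost (G : ParityGame V) : ℕ := 100 * (G.d * G.numEdges)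

/-- What a call of the main procedure on the context `W` achieves. -/
structure Outcome (R : G.Input) (W : Finset V) (s s' : State G) : Prop where
  rho_off : ∀ u, u ∉ W → s'.rho u = s.rho u
  sigma_off : ∀ u, u ∉ W → s'.sigma u = s.sigma u
  mono : ∀ u, s.rho u ≤ s'.rho u
  reached : Reached s'.rho
  strategy : IsOddStrategy G s'.sigma
  stable : ∀ u ∈ W, s'.rho u ≠ Meas.top → PreLe s'.rho u (s'.rho u)
  trap : OddTrap G W (W.filter fun u => (s'.rho u).isTop) s'.sigma
  -- A round resolves at least one vertex of odd priority. The three `roundCost` released by it pay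
  -- for the round itself and for the final summand of each of the two calls it makes.
  time : s'.time + potential R s'.rho + 3 * G.roundCost * openCount s'.rho ≤
    s.time + potential R s.rho + 3 * G.roundCost * openCount s.rho + G.roundCost

theorem oddTrap_empty {W : Finset V} {σ : V → Option V} : OddTrap G W ∅ σ where
  sub := Finset.empty_subset W
  odd u hu := by simp at hu
  even u hu := by simp at hu
  win π _ _ h := by simpa using h 0

theorem resolve_rho (R : G.Input) (A seed : Finset V) (τ : V → Option V) (s : State G) (w : V) :
    (resolve R A seed τ s).rho w = if w ∈ A ∧ w ∉ seed then Meas.top else s.rho w := rfl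

theorem resolve_sigma (R : G.Input) (A seed : Finset V) (τ : V → Option V) (s : State G) (w : V) :
    (resolve R A seed τ s).sigma w =
      if w ∈ A ∧ w ∉ seed ∧ G.owner w = Player.odd then τ w else s.sigma w := rfl

theorem IsOddStrategy.resolve (R : G.Input) (A seed : Finset V) {τ : V → Option V} {s : State G}
    (h : IsOddStrategy G s.sigma) (hτ : IsOddStrategy G τ) :
    IsOddStrategy G (ParityGame.resolve R A seed τ s).sigma := by
  intro v w hvw
  rw [resolve_sigma] at hvw
  split_ifs at hvw
  · exact hτ v w hvw
  · exact h v w hvw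

theorem le_resolve_rho (R : G.Input) (A seed : Finset V) (τ : V → Option V) (s : State G) (w : V) :
    s.rho w ≤ (resolve R A seed τ s).rho w := by
  rw [resolve_rho]
  split_ifs
  · exact Meas.le_top' _
  · exact le_rfl

theorem Reached.resolve (R : G.Input) (A seed : Finset V) (τ : V → Option V) {s : State G}
    (h : Reached s.rho) : Reached (ParityGame.resolve R A seed τ s).rho :=
  h.setTop fun u => by
    rw [resolve_rho]
    split_ifs
    · exact Or.inr rfl
    · exact Or.inl rfl

theorem numEdges_pos [Nonempty V] (R : G.Input) : 1 ≤ G.numEdges :=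
  Fintype.card_pos.trans_le R.card_le

/-- Removing the dominion of a vertex that is lifted to the top. -/
theorem Outcome.round [Nonempty V] {R : G.Input} {pol : LiftingPolicy V} {W : Finset V}
    {s s₁ : State G} {k₀ : ℕ} {v : V} (hctx : Context G s.rho W k₀)
    (hstrat : IsOddStrategy G s.sigma) (hsig₁ : s₁.sigma = s.sigma)
    (hmono₁ : ∀ u, s.rho u ≤ s₁.rho u)
    (htime₁ : s₁.time + potential R s₁.rho ≤
      s.time + 3 + 5 * Fintype.card V + (2 * G.d + 2) * G.numEdges + potential R s.rho)
    (hout : LoopOutcome R W s.rho s₁.rho (some v)) {f₀ : ℕ}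
    (hloop : ∀ f ≥ f₀, liftLoop R pol W f (initQueue R W (s.tick 1)) = some (s₁, some v))
    (ih : ∀ (W' : Finset V) (s : State G) (k₀ : ℕ), W'.card < W.card → Context G s.rho W' k₀ →
      Reached s.rho → IsOddStrategy G s.sigma →
      ∃ s', (∃ f₀, ∀ f ≥ f₀, spmWithin R pol f W' s = some s') ∧ Outcome R W' s s') :
    ∃ s', (∃ f₀, ∀ f ≥ f₀, spmWithin R pol f W s = some s') ∧
      Outcome R W s s' := by
  obtain ⟨hvW, ρ, hreach, hnt, hoff, htop, hs₁⟩ := hout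
  have hctxρ : Context G ρ W k₀ := hctx.congr hoff hnt
  obtain ⟨q1, q2, q3, q4, q5⟩ := setSigma_spec R s₁ (hctxρ.exists_succ v hvW)
  set s₂ := setSigma R W v s₁ with hs₂
  obtain ⟨⟨r, hres⟩, htres⟩ := attr_spec R Player.odd (W := W)
    (X := W.filter (G.prio v ≤ G.prio ·)) (U := {v}) (by simp [hvW]) (Finset.filter_subset _ _)
    hctxρ.exists_succ
  obtain ⟨⟨r', hirr⟩, htirr⟩ := attr_spec R Player.even (W := W) (X := W)
    (U := W.filter (G.prio · < G.prio v)) (Finset.filter_subset _ _) subset_rfl hctxρ.exists_succ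
  set res := attr G R Player.odd W (W.filter (G.prio v ≤ G.prio ·)) {v} with hresdef
  set irr := attr G R Player.even W W (W.filter (G.prio · < G.prio v)) with hirrdef
  have h : TopLift R ρ W k₀ v res.A irr.A res.strat irr.strat r r' :=
    ⟨hreach, hctxρ, hvW, htop, hres, hirr⟩
  set s₃ := resolve R res.A {v} res.strat (s₂.tick res.time) with hs₃
  set s₃' := s₃.tick (irr.time + 3 * R.verts.length + 1) with hs₃'
  set rem := W \ (res.A ∪ irr.A) with hrem
  have hρ₁ : ∀ u, u ≠ v → s₁.rho u = ρ u := fun u hu => by rw [hs₁, Function.update_of_ne hu]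
  have hρ₁v : s₁.rho v = Meas.top := by rw [hs₁, Function.update_self]
  have hrho₃ : ∀ u, s₃.rho u = if u ∈ res.A ∧ u ∉ ({v} : Finset V) then Meas.top else s₁.rho u :=
    fun u => by
      rw [hs₃, resolve_rho, ← q1]
      rfl
  have hB₃ : ∀ u ∈ res.A, s₃'.rho u = Meas.top := fun u hu => by
    change s₃.rho u = _
    rw [hrho₃]
    by_cases huv : u = v
    · simp [huv, hρ₁v]
    · simp [hu, huv]
  have hoff₃ : ∀ u, u ∉ res.A → s₃'.rho u = ρ u := fun u hu => by
    change s₃.rho u = _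
    rw [hrho₃, if_neg fun h => hu h.1, hρ₁ u]
    rintro rfl
    exact hu h.mem_res
  have hreach₁ : Reached s₁.rho := hreach.setTop fun u => by
    by_cases huv : u = v
    · exact Or.inr (huv ▸ hρ₁v)
    · exact Or.inl (hρ₁ u huv)
  have hreach₂ : Reached (s₂.tick res.time).rho := by
    change Reached s₂.rho
    rw [q1]
    exact hreach₁
  have hreach₃ : Reached s₃'.rho := hreach₂.resolve R res.A {v} res.strat
  have hstrat₂ : IsOddStrategy G (s₂.tick res.time).sigma := q3 (hsig₁ ▸ hstrat)
  have hstrat₃ : IsOddStrategy G s₃'.sigma := hstrat₂.resolve R res.A {v} hres.strat_edge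
  have hctx₃ : Context G s₃'.rho rem (G.prio v) := h.context_rem hB₃ hoff₃
  have hvrem : v ∉ rem := fun hv => (TopLift.mem_rem.1 hv).2.1 h.mem_res
  have hcard : rem.card < W.card :=
    Finset.card_lt_card ⟨Finset.sdiff_subset, fun hsub => hvrem (hsub hvW)⟩
  obtain ⟨s₄, ⟨f₁, hf₁⟩, o₄⟩ := ih rem s₃' (G.prio v) hcard hctx₃ hreach₃ hstrat₃
  have hremB : ∀ u ∈ res.A, u ∉ rem := fun u hu hur => (TopLift.mem_rem.1 hur).2.1 hu
  have hB₄ : ∀ u ∈ res.A, s₄.rho u = Meas.top := fun u hu => by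
    rw [o₄.rho_off u (hremB u hu), hB₃ u hu]
  set T := rem.filter fun w => (s₄.rho w).isTop with hT
  set dom := res.A ∪ T with hdom
  have hmemT : ∀ u, u ∈ T ↔ u ∈ rem ∧ s₄.rho u = Meas.top := fun u => by
    rw [hT, Finset.mem_filter, Meas.isTop_iff]
  have hdomW : dom ⊆ W :=
    Finset.union_subset h.res_subset ((Finset.filter_subset _ _).trans Finset.sdiff_subset)
  have hρW : ∀ u, u ∉ W → s₄.rho u = ρ u := fun u hu => by
    rw [o₄.rho_off u fun hur => hu (Finset.mem_sdiff.1 hur).1,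
      hoff₃ u fun huB => hu (h.res_subset huB)]
  -- The contrapositive of `TopLift.progAt_ne_top`: whatever in `W` forces `v` to `⊤` is dominated.
  have hdomv : ∀ w ∈ W, G.progAt (G.prio v) (ρ w) = Meas.top → w ∈ dom := by
    intro w hw hprog
    by_contra hwd
    rw [hdom, Finset.mem_union, not_or, hmemT] at hwd
    refine h.progAt_ne_top hB₄ (fun u hu hut => (hρW u hu).trans hut) o₄.reached.mem
      o₄.stable hw hwd.1 (fun hwr hwt => hwd.2 ⟨hwr, hwt⟩) hprog
  have hsig₄ : ∀ u ∈ res.A, s₄.sigma u = if u ∈ res.A ∧ u ∉ ({v} : Finset V) ∧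
      G.owner u = Player.odd then res.strat u else s₂.sigma u := fun u hu =>
    o₄.sigma_off u (hremB u hu)
  have htrapD : OddTrap G W dom s₄.sigma := by
    refine h.oddTrap o₄.trap (fun u hu huv ho => ?_) (fun ho => ?_) fun ho w hw hvw => ?_
    · rw [hsig₄ u hu, if_pos ⟨hu, by simpa using huv, ho⟩]
    · obtain ⟨w, hwW, -, hσ, hmax⟩ := q4 ho
      refine ⟨w, ?_, by rw [hsig₄ v h.mem_res, if_neg (by simp), hσ]⟩
      -- At a self-loop `v` may be chosen itself, since its measure is already `⊤`; it belongs to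
      -- `RES`.
      by_cases hwv : w = v
      · exact Finset.mem_union_left _ (hwv ▸ h.mem_res)
      refine hdomv w hwW ?_
      obtain ⟨x, hvx, hx⟩ := h.odd_prog_top ho
      have hxW : x ∈ W := by
        by_contra hxW
        exact h.progAt_ne_top_outside ho hxW hvx hx
      refine Meas.eq_top_of_le (progAt_mono_trunc (hreach.mem x) (hreach.mem w) ?_) hx
      -- The choice compares measures after the lift. They differ from `ρ` only at `v`, where `⊤` is
      -- above `ρ x` anyway.
      rw [← hρ₁ w hwv]
      refine le_trans (Meas.trunc_mono _ ?_) (hmax x hxW hvx)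
      by_cases hxv : x = v
      · rw [hxv, hρ₁v]
        exact Meas.le_top' _
      · exact (hρ₁ x hxv).symm.le
    · exact hdomv w hw (h.even_prog_top ho hvw)
  obtain ⟨⟨ra, hatt⟩, htatt⟩ := attr_spec R Player.odd (W := W) (X := W) (U := dom) hdomW
    subset_rfl hctxρ.exists_succ
  set att := attr G R Player.odd W W dom with hattdef
  set s₅ := resolve R att.A dom att.strat (s₄.tick (3 * R.verts.length + att.time)) with hs₅
  set s₅' := s₅.tick (2 * R.verts.length + 1) with hs₅'
  have hrho₅ : ∀ u, s₅'.rho u = if u ∈ att.A ∧ u ∉ dom then Meas.top else s₄.rho u := fun u => rfl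
  have hsig₅ : ∀ u, s₅'.sigma u = if u ∈ att.A ∧ u ∉ dom ∧ G.owner u = Player.odd then
      att.strat u else s₄.sigma u := fun u => rfl
  have htop₅ : ∀ u ∈ att.A, s₅'.rho u = Meas.top := fun u hu => by
    rw [hrho₅]
    split_ifs with hd
    · rfl
    · have hud : u ∈ dom := by
        by_contra hud
        exact hd ⟨hu, hud⟩
      rcases Finset.mem_union.1 hud with huB | huT
      · exact hB₄ u huB
      · exact ((hmemT u).1 huT).2
  have hoff₅ : ∀ u, u ∉ att.A → s₅'.rho u = s₄.rho u := fun u hu => by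
    rw [hrho₅, if_neg fun h => hu h.1]
  have hnt₅ : ∀ u ∈ W \ att.A, s₅'.rho u ≠ Meas.top := fun u hu => by
    obtain ⟨huW, huA⟩ := Finset.mem_sdiff.1 hu
    have hud : u ∉ dom := fun hud => huA (hatt.seed hud)
    rw [hdom, Finset.mem_union, not_or, hmemT] at hud
    rw [hoff₅ u huA]
    by_cases hur : u ∈ rem
    · exact fun ht => hud.2 ⟨hur, ht⟩
    · rw [o₄.rho_off u hur, hoff₃ u hud.1]
      exact hnt u huW
  have hctx₅ : Context G s₅'.rho (W \ att.A) k₀ := hctxρ.sdiff hatt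
    (fun u hu => (hoff₅ u fun huA => hu (hatt.sub huA)).trans (hρW u hu)) htop₅ hnt₅
  have hreach₄ : Reached (s₄.tick (3 * R.verts.length + att.time)).rho := o₄.reached
  have hreach₅ : Reached s₅'.rho := hreach₄.resolve R att.A dom att.strat
  have hstrat₄ : IsOddStrategy G (s₄.tick (3 * R.verts.length + att.time)).sigma := o₄.strategy
  have hstrat₅ : IsOddStrategy G s₅'.sigma := hstrat₄.resolve R att.A dom hatt.strat_edge
  have hvA : v ∈ att.A := hatt.seed (Finset.mem_union_left _ h.mem_res)
  have hcard₅ : (W \ att.A).card < W.card :=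
    Finset.card_lt_card ⟨Finset.sdiff_subset, fun hsub => (Finset.mem_sdiff.1 (hsub hvW)).2 hvA⟩
  obtain ⟨s', ⟨f₂, hf₂⟩, o'⟩ := ih (W \ att.A) s₅' k₀ hcard₅ hctx₅ hreach₅ hstrat₅
  have htrapA : OddTrap G W att.A s'.sigma := by
    have h5 : OddTrap G W att.A s₅'.sigma := by
      refine (htrapD.congr fun u hu => ?_).attr hatt fun u hu hud ho => ?_
      · rw [hsig₅, if_neg fun h => h.2.1 hu]
      · rw [hsig₅, if_pos ⟨hu, hud, ho⟩]
    exact h5.congr fun u hu => o'.sigma_off u fun hu' => (Finset.mem_sdiff.1 hu').2 hu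
  have hle₃ : ∀ u, s₁.rho u ≤ s₃'.rho u := fun u => by
    have := le_resolve_rho R res.A {v} res.strat (s₂.tick res.time) u
    have h' : (s₂.tick res.time).rho u = s₁.rho u := by
      change s₂.rho u = _
      rw [q1]
    rwa [h'] at this
  have hle₅ : ∀ u, s₄.rho u ≤ s₅'.rho u := fun u =>
    le_resolve_rho R att.A dom att.strat (s₄.tick (3 * R.verts.length + att.time)) u
  refine ⟨s', ⟨f₀ + f₁ + f₂ + 1, fun f hf => ?_⟩, fun u hu => ?_, fun u hu => ?_, fun u => ?_,
    o'.reached, o'.strategy, fun u hu hut => ?_, ?_, ?_⟩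
  · obtain ⟨f, rfl⟩ := Nat.exists_eq_add_of_le' (le_trans (Nat.le_add_left 1 _) hf)
    have hW : W ≠ ∅ := Finset.ne_empty_of_mem hvW
    rw [spmWithin, if_neg hW, hloop f (by omega)]
    dsimp only
    rw [hf₁ f (by omega)]
    exact hf₂ f (by omega)
  · rw [o'.rho_off u fun hu' => hu (Finset.mem_sdiff.1 hu').1,
      hoff₅ u fun huA => hu (hatt.sub huA), hρW u hu, hoff u hu]
  · have huB : u ∉ res.A := fun huB => hu (h.res_subset huB)
    rw [o'.sigma_off u fun hu' => hu (Finset.mem_sdiff.1 hu').1, hsig₅,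
      if_neg fun h => hu (hatt.sub h.1), o₄.sigma_off u fun hur => hu (Finset.mem_sdiff.1 hur).1]
    change (if u ∈ res.A ∧ u ∉ ({v} : Finset V) ∧
      G.owner u = Player.odd then res.strat u else s₂.sigma u) = _
    rw [if_neg fun h => huB h.1, q2 u (by rintro rfl; exact hu hvW), hsig₁]
  · exact (hmono₁ u).trans ((hle₃ u).trans ((o₄.mono u).trans ((hle₅ u).trans (o'.mono u))))
  · have huA : u ∉ att.A := fun huA => hut (Meas.eq_top_of_le (o'.mono u) (htop₅ u huA))
    exact o'.stable u (Finset.mem_sdiff.2 ⟨hu, huA⟩) hut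
  · convert htrapA.union o'.trap using 1
    ext u
    simp only [Finset.mem_union, Finset.mem_filter, Finset.mem_sdiff, Meas.isTop_iff]
    constructor
    · rintro ⟨h1, h2⟩
      by_cases huA : u ∈ att.A
      · exact Or.inl huA
      · exact Or.inr ⟨⟨h1, huA⟩, h2⟩
    · rintro (h1 | ⟨⟨h1, -⟩, h2⟩)
      · exact ⟨hatt.sub h1, Meas.eq_top_of_le (o'.mono u) (htop₅ u h1)⟩
      · exact ⟨h1, h2⟩
  · have t₃ : s₃'.time = s₂.time + res.time + 1 + (G.d + 5) * R.verts.length +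
        (irr.time + 3 * R.verts.length + 1) := rfl
    have t₅ : s₅'.time = s₄.time + (3 * R.verts.length + att.time) + 1 +
        (G.d + 5) * R.verts.length + (2 * R.verts.length + 1) := rfl
    have p₃ := potential_anti R hle₃
    have p₅ := potential_anti R hle₅
    -- This unit pays for the round: `v` has odd priority and was unresolved when the round began.
    have c₃ : openCount s₃'.rho + 1 ≤ openCount s.rho :=
      openCount_lt (fun u => (hmono₁ u).trans (hle₃ u)) h.odd_prio (hctx.ne_top v hvW)
        (hB₃ v h.mem_res)
    have c₅ := openCount_anti hle₅
    have c₃' := Nat.mul_le_mul_left (3 * G.roundCost) c₃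
    have c₅' := Nat.mul_le_mul_left (3 * G.roundCost) c₅
    have t₄ := o₄.time
    have t' := o'.time
    rw [R.length_verts] at t₃ t₅
    have hm := numEdges_pos R
    have hnm := R.card_le
    have hdm := Nat.mul_le_mul_right G.numEdges (one_le_d G)
    have hdn := Nat.mul_le_mul_left G.d hnm
    have hD : G.roundCost = 100 * (G.d * G.numEdges) := rfl
    rw [Nat.mul_add, Nat.mul_one] at c₃'
    rw [Nat.add_mul] at t₃ t₅ q5
    rw [Nat.add_mul, Nat.mul_assoc] at htime₁
    omega

/-- Induction on the size of the context: both the recursive call and the continuation of the outer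
loop omit `v`. -/
theorem spmWithin_spec [Nonempty V] (R : G.Input) (pol : LiftingPolicy V) (n : ℕ) :
    ∀ (W : Finset V) (s : State G) (k₀ : ℕ), W.card = n → Context G s.rho W k₀ →
    Reached s.rho → IsOddStrategy G s.sigma →
    ∃ s', (∃ f₀, ∀ f ≥ f₀, spmWithin R pol f W s = some s') ∧ Outcome R W s s' := by
  induction n using Nat.strong_induction_on with
  | _ n ih =>
  intro W s k₀ hn hctx hreach hstrat
  have hm := numEdges_pos R
  have hnm := R.card_le
  have hdm := Nat.mul_le_mul_right G.numEdges (one_le_d G)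
  have hD : G.roundCost = 100 * (G.d * G.numEdges) := rfl
  by_cases hW : W = ∅
  · subst hW
    refine ⟨s.tick 1, ⟨1, fun f hf => ?_⟩, fun _ _ => rfl, fun _ _ => rfl, fun _ => le_rfl, hreach,
      hstrat, fun u hu => by simp at hu, oddTrap_empty, ?_⟩
    · obtain ⟨f, rfl⟩ := Nat.exists_eq_add_of_le' hf
      simp [spmWithin]
    · simp only [State.tick]
      omega
  obtain ⟨i1, i2, i3, i4⟩ := initQueue_spec R W (s.tick 1)
  have hrho : (s.tick 1).rho = s.rho := rfl
  have hsig : (s.tick 1).sigma = s.sigma := rfl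
  have htime : (s.tick 1).time = s.time + 1 := rfl
  rw [hrho] at i1
  rw [hsig] at i2
  rw [htime] at i4
  obtain ⟨s₁, o, ⟨f₀, hf₀⟩, j1, j2, j3, j4, j5, j6⟩ :=
    liftLoop_spec R pol W _ (initQueue R W (s.tick 1)) le_rfl i3 (i1 ▸ hreach)
      (i1 ▸ hctx.ne_top)
  rw [i1] at j2 j3 j5 j6
  rw [i2] at j1
  rcases o with _ | v
  · refine ⟨s₁, ⟨f₀ + 1, fun f hf => ?_⟩, j2, fun u _ => by rw [j1], j3, j4, j1 ▸ hstrat,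
      fun u hu _ => (j6 u hu).2, ?_, ?_⟩
    · obtain ⟨f, rfl⟩ := Nat.exists_eq_add_of_le' (le_trans (Nat.le_add_left 1 f₀) hf)
      rw [spmWithin, if_neg hW, hf₀ f (by omega)]
    · convert oddTrap_empty (G := G) (W := W) (σ := s₁.sigma)
      exact Finset.filter_false_of_mem fun u hu ht => (j6 u hu).1 (Meas.isTop_iff.1 ht)
    · have c := Nat.mul_le_mul_left (3 * G.roundCost) (openCount_anti j3)
      rw [Nat.add_mul, Nat.mul_assoc] at i4
      omega
  · exact Outcome.round (pol := pol) hctx hstrat j1 j3 (by omega) j6 hf₀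
      fun W' s k₀ hcard => ih W'.card (hn ▸ hcard) W' s k₀ rfl

end ParityGame

namespace ParityGame

variable {V : Type u} {G : ParityGame V}

/-! ### The winning regions -/

/-- The play from `v` in which both players follow their strategies, with its history. -/
noncomputable def jointPlay (G : ParityGame V) (σ τ : List V → V → Option V) (v : V) :
    ℕ → List V × V
  | 0 => ([], v)
  | n + 1 =>
    let x := jointPlay G σ τ v n
    (x.1 ++ [x.2], ((σ x.1 x.2).orElse fun _ => τ x.1 x.2).getD (Classical.choose (G.total x.2)))

/-- A vertex is not won by both players. -/
theorem not_winningFrom_both {σ τ : List V → V → Option V} (hσ : G.IsStrategy Player.even σ)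
    (hτ : G.IsStrategy Player.odd τ) {v : V} (hσv : G.WinningFrom Player.even σ v)
    (hτv : G.WinningFrom Player.odd τ v) : False := by
  set π : ℕ → V := fun n => (jointPlay G σ τ v n).2 with hπ
  have hhist : ∀ n, (jointPlay G σ τ v n).1 = (List.range n).map π := by
    intro n
    induction n with
    | zero => rfl
    | succ n ih =>
      rw [List.range_succ, List.map_append, ← ih]
      rfl
  have hnext : ∀ n, π (n + 1) = ((σ ((List.range n).map π) (π n)).orElse
      fun _ => τ ((List.range n).map π) (π n)).getD (Classical.choose (G.total (π n))) := by
    intro n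
    rw [← hhist n]
    rfl
  have hσπ : Consistent σ π := by
    intro n w hw
    rw [hnext, hw]
    rfl
  have hτπ : Consistent τ π := by
    intro n w hw
    have hnone : σ ((List.range n).map π) (π n) = none := by
      rcases h : σ ((List.range n).map π) (π n) with _ | x
      · rfl
      · have h1 := (hσ _ _ _ h).1
        have h2 := (hτ _ _ _ hw).1
        rw [h1] at h2
        cases h2
    rw [hnext, hnone, hw]
    rfl
  have hplay : G.IsPlay π := by
    intro n
    rw [hnext]
    rcases h : σ ((List.range n).map π) (π n) with _ | x
    · rcases h' : τ ((List.range n).map π) (π n) with _ | x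
      · exact Classical.choose_spec (G.total (π n))
      · exact (hτ _ _ _ h').2
    · exact (hσ _ _ _ h).2
  obtain ⟨p, hp, hpe⟩ := hσv π hplay rfl hσπ
  obtain ⟨q, hq, hqe⟩ := hτv π hplay rfl hτπ
  rw [hp.unique hq] at hpe
  simp only [reduceCtorEq, iff_false, iff_true] at hpe hqe
  exact hqe hpe

/-- Complementary sets on which the players have positional winning strategies are the winning
regions. -/
theorem winRegion_eq {S T : Set V} {σ τ : V → Option V} (h : IsCompl S T)
    (hS : G.IsPositionalWinning Player.even S σ) (hT : G.IsPositionalWinning Player.odd T τ) :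
    S = G.winRegion Player.even ∧ T = G.winRegion Player.odd := by
  have hST : ∀ v, v ∈ S ∨ v ∈ T := fun v => by
    have := h.codisjoint.top_le (Set.mem_univ v)
    simpa using this
  refine ⟨Set.Subset.antisymm (fun v hv => ⟨_, hS.isStrategy, hS.winning v hv⟩) ?_,
    Set.Subset.antisymm (fun v hv => ⟨_, hT.isStrategy, hT.winning v hv⟩) ?_⟩
  · rintro v ⟨σ', h1, h2⟩
    refine (hST v).resolve_right fun hv => ?_
    exact not_winningFrom_both h1 hT.isStrategy h2 (hT.winning v hv)
  · rintro v ⟨τ', h1, h2⟩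
    refine (hST v).resolve_left fun hv => ?_
    exact not_winningFrom_both hS.isStrategy h1 (hS.winning v hv) h2

variable [Fintype V]

/-- Only finitely many priorities occur, so one of them recurs. -/
theorem exists_isLeast_frequently (G : ParityGame V) (π : ℕ → V) :
    ∃ p, IsLeast {q : ℕ | ∃ᶠ n in Filter.atTop, G.prio (π n) = q} p := by
  classical
  have hne : ∃ q, ∃ᶠ n in Filter.atTop, G.prio (π n) = q := by
    by_contra! hall
    have hev : ∀ᶠ n in Filter.atTop, ∀ q ∈ Finset.range G.d, G.prio (π n) ≠ q :=
      (Filter.eventually_all_finset _).2 fun q _ => hall q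
    obtain ⟨n, hn⟩ := hev.exists
    exact hn _ (Finset.mem_range.2 (prio_lt_d G (π n))) rfl
  exact ⟨Nat.find hne, Nat.find_spec hne, fun q hq => Nat.find_min' hne hq⟩

/-- A play along which the measures witness progress is won by Even. -/
theorem wonBy_even_of_progress {ρ : V → Meas G.d} (hM : ∀ u, ρ u ∈ G.M) {π : ℕ → V}
    (hnt : ∀ n, ρ (π n) ≠ Meas.top) (hprog : ∀ n, G.prog ρ (π n) (π (n + 1)) ≤ ρ (π n)) :
    G.WonBy Player.even π := by
  obtain ⟨p, hp⟩ := exists_isLeast_frequently G π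
  refine ⟨p, hp, ⟨fun _ => rfl, fun _ => ?_⟩⟩
  by_contra hodd
  rw [Nat.not_even_iff_odd] at hodd
  have hev : ∀ᶠ n in Filter.atTop, ∀ q ∈ Finset.range p, G.prio (π n) ≠ q :=
    (Filter.eventually_all_finset _).2 fun q hq => Filter.not_frequently.1 fun h =>
      absurd (hp.2 h) (not_le.2 (Finset.mem_range.1 hq))
  obtain ⟨N, hN⟩ := Filter.eventually_atTop.1 hev
  have hge : ∀ n ≥ N, p ≤ G.prio (π n) := fun n hn => by
    by_contra hlt
    exact hN n hn _ (Finset.mem_range.2 (not_le.1 hlt)) rfl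
  -- After moment `N` all priorities are at least `p`, so the measures truncated at `p` never
  -- increase, and each visit to priority `p` makes them drop strictly.
  set f : ℕ → Meas G.d := fun n => Meas.trunc p (ρ (π (n + N))) with hf
  have hanti : Antitone f := antitone_nat_of_succ_le fun n => by
    have := trunc_le_of_progAt_le (hM _) (hprog (n + N))
    rw [Nat.add_right_comm] at this
    exact Meas.trunc_le_trunc (hge _ (Nat.le_add_left N n)) this
  obtain ⟨x, ⟨m, rfl⟩, hmin⟩ := WellFounded.has_min (wellFounded_lt : WellFounded
    (α := Meas G.d) (· < ·)) (Set.range f) (Set.range_nonempty f)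
  obtain ⟨n, hn, hnp⟩ := Filter.frequently_atTop.1 hp.1 (m + N)
  obtain ⟨j, rfl⟩ := Nat.exists_eq_add_of_le' ((Nat.le_add_left N m).trans hn)
  have hlt := trunc_lt_of_progAt_le (p := G.prio (π (j + N))) (by rwa [hnp]) (hM _)
    (hprog (j + N)) (hnt _)
  rw [hnp, Nat.add_right_comm] at hlt
  exact hmin (f (j + 1)) ⟨_, rfl⟩ (lt_of_lt_of_le hlt (hanti (by omega)))

/-- If no vertex can be lifted, then Even wins from the vertices that are not the top by moving to
successors with minimal measure. -/
theorem isPositionalWinning_even (R : G.Input) {ρ : V → Meas G.d} (hM : ∀ u, ρ u ∈ G.M)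
    (hstable : ∀ u, ρ u ≠ Meas.top → PreLe ρ u (ρ u)) :
    G.IsPositionalWinning Player.even {v | ρ v ≠ Meas.top} fun v =>
      if G.owner v = Player.even ∧ (ρ v).isTop = false then
        argBest (fun u b => Meas.Lt (ρ u) (ρ b)) (R.succ v)
      else none := by
  have hbest : ∀ v, ∃ b, G.E v b ∧
      argBest (fun u b => Meas.Lt (ρ u) (ρ b)) (R.succ v) = some b ∧
      ∀ x, G.E v x → ρ b ≤ ρ x := by
    intro v
    obtain ⟨w, hw⟩ := G.total v
    obtain ⟨b, h1, h2, h3⟩ := argBest_spec (f := ρ)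
      (better := fun u b => Meas.Lt (ρ u) (ρ b)) (fun x b => by
        rw [decide_eq_true_eq, Meas.lt_iff])
      (List.ne_nil_of_mem ((R.mem_succ v w).2 hw))
    exact ⟨b, (R.mem_succ v b).1 h1, h2, fun x hx => h3 x ((R.mem_succ v x).2 hx)⟩
  refine ⟨fun h v w hvw => ?_, fun v hv ho => ?_, fun v hv π hπ h0 hcons => ?_⟩
  · simp only [positional] at hvw
    split_ifs at hvw with hv
    obtain ⟨b, h1, h2, -⟩ := hbest v
    rw [h2, Option.some.injEq] at hvw
    exact ⟨hv.1, hvw ▸ h1⟩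
  · obtain ⟨b, -, h2, -⟩ := hbest v
    rw [if_pos ⟨ho, Meas.isTop_eq_false_iff.2 hv⟩, h2]
    rfl
  · have hstep : ∀ n, ρ (π n) ≠ Meas.top → G.prog ρ (π n) (π (n + 1)) ≤ ρ (π n) := by
      intro n hn
      cases ho : G.owner (π n)
      · obtain ⟨b, -, h2, h3⟩ := hbest (π n)
        have hnext : π (n + 1) = b := hcons n b (by
          rw [positional, if_pos ⟨ho, Meas.isTop_eq_false_iff.2 hn⟩, h2])
        obtain ⟨w, hw, hle⟩ := (hstable _ hn).1 ho
        rw [hnext]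
        -- Stability provides only some good successor `w`; the chosen `b` has a measure no larger,
        -- hence no larger `Prog` either.
        exact (progAt_mono _ (hM b) (hM w) (h3 w hw)).trans hle
      · exact (hstable _ hn).2 ho _ (hπ n)
    have hnt : ∀ n, ρ (π n) ≠ Meas.top := by
      intro n
      induction n with
      | zero => rwa [h0]
      | succ n ih =>
        intro htop
        have := hstep n ih
        rw [prog, htop, progAt_top] at this
        exact ih (Meas.eq_top_of_le this rfl)
    exact wonBy_even_of_progress hM hnt fun n => hstep n (hnt n)

theorem OddTrap.isPositionalWinning {T : Finset V} {σ : V → Option V}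
    (h : OddTrap G Finset.univ T σ) (hσ : IsOddStrategy G σ) :
    G.IsPositionalWinning Player.odd (T : Set V) σ := by
  refine ⟨fun _ v w hvw => hσ v w hvw, fun v hv ho => ?_, fun v hv π hπ h0 hcons => ?_⟩
  · obtain ⟨w, -, hw⟩ := h.odd v hv ho
    rw [hw]
    rfl
  · exact h.win_of_visit hπ hcons (fun n => Finset.mem_univ _) (N := 0) (by
      rw [h0]
      exact hv)

/-! ### The number of measures -/

theorem prod_range_odd (f : ℕ → ℕ) (d : ℕ) :
    ∏ i ∈ Finset.range d, (if Odd i then f i else 1) = ∏ j ∈ Finset.range (d / 2), f (2 * j + 1) := by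
  induction d using Nat.twoStepInduction with
  | zero => rfl
  | one => simp
  | more d ih _ =>
    rw [Finset.prod_range_succ, Finset.prod_range_succ, ih, Nat.add_div_right d (by norm_num),
      Finset.prod_range_succ]
    rcases Nat.even_or_odd' d with ⟨c, rfl | rfl⟩
    · have h1 : ¬ Odd (2 * c) := by simp
      have h2 : Odd (2 * c + 1) := ⟨c, rfl⟩
      simp [h1, h2]
    · have h1 : Odd (2 * c + 1) := ⟨c, rfl⟩
      have h2 : ¬ Odd (2 * c + 1 + 1) := by
        rw [Nat.not_odd_iff_even]
        exact ⟨c + 1, by ring⟩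
      have h3 : (2 * c + 1) / 2 = c := by omega
      simp [h1, h2, h3]

/-- The `1` added at an odd `i ≥ 3` is paid by the even index `i - 1`. The `1` added at `i = 1`
would need index `0`, where `f` may vanish, whence the extra `1` on the right. -/
theorem sum_range_odd_le (f : ℕ → ℕ) (d : ℕ) (hf : ∀ i, 1 ≤ i → i < d → 1 ≤ f i) :
    ∑ j ∈ Finset.range (d / 2), (f (2 * j + 1) + 1) ≤ (∑ i ∈ Finset.range d, f i) + 1 := by
  induction d using Nat.twoStepInduction with
  | zero => simp
  | one => simp
  | more d ih _ =>
    have ih := ih fun i h1 h2 => hf i h1 (by omega)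
    rw [Finset.sum_range_succ (fun i => f i), Finset.sum_range_succ (fun i => f i),
      Nat.add_div_right d (by norm_num), Finset.sum_range_succ]
    have h1 := hf (d + 1) (by omega) (by omega)
    rcases Nat.eq_zero_or_pos d with rfl | hd
    · simp
    have h2 := hf d hd (by omega)
    rcases Nat.even_or_odd' d with ⟨c, rfl | rfl⟩
    · have h3 : 2 * c / 2 = c := by omega
      rw [h3] at ih ⊢
      omega
    · have h3 : (2 * c + 1) / 2 = c := by omega
      rw [h3] at ih ⊢
      omega

theorem card_tuples (G : ParityGame V) :
    G.tuples.card = ∏ j ∈ Finset.range (G.d / 2), (G.numPrio (2 * j + 1) + 1) := by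
  rw [tuples, Fintype.card_piFinset, ← prod_range_odd (fun i => G.numPrio i + 1),
    ← Fin.prod_univ_eq_prod_range (fun i => if Odd i then G.numPrio i + 1 else 1)]
  exact Finset.prod_congr rfl fun i _ => Finset.card_range _

theorem sum_numPrio (G : ParityGame V) : ∑ i ∈ Finset.range G.d, G.numPrio i = Fintype.card V := by
  rw [← Finset.card_univ]
  exact (Finset.card_eq_sum_card_fiberwise fun v _ =>
    Finset.mem_coe.2 (Finset.mem_range.2 (prio_lt_d G v))).symm

theorem NoGaps.one_le_numPrio (h : G.NoGaps) {i : ℕ} (h1 : 1 ≤ i) (h2 : i < G.d) :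
    1 ≤ G.numPrio i := by
  obtain ⟨v, hv⟩ := h i h1 h2
  exact Finset.card_pos.2 ⟨v, Finset.mem_filter.2 ⟨Finset.mem_univ v, hv⟩⟩

theorem NoGaps.sum_le (h : G.NoGaps) :
    ∑ j ∈ Finset.range (G.d / 2), (G.numPrio (2 * j + 1) + 1) ≤ Fintype.card V + 1 := by
  rw [← sum_numPrio]
  exact sum_range_odd_le G.numPrio G.d fun i h1 h2 => h.one_le_numPrio h1 h2

theorem NoGaps.two_mul_le (h : G.NoGaps) : 2 * (G.d / 2) ≤ Fintype.card V + 1 := by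
  refine le_trans ?_ h.sum_le
  rw [mul_comm, ← smul_eq_mul, ← Finset.card_range (G.d / 2), ← Finset.sum_const]
  simp only [Finset.card_range]
  refine Finset.sum_le_sum fun j hj => ?_
  have := Finset.mem_range.1 hj
  have := h.one_le_numPrio (i := 2 * j + 1) (by omega) (by omega)
  omega

theorem prod_le_div_pow {k : ℕ} (hk : 1 ≤ k) (z : ℕ → ℝ) (hz : ∀ i, 0 ≤ z i) {S : ℝ}
    (hS : ∑ i ∈ Finset.range k, z i ≤ S) : ∏ i ∈ Finset.range k, z i ≤ (S / k) ^ k := by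
  have hk' : (0 : ℝ) < k := by exact_mod_cast hk
  have h := Real.geom_mean_le_arith_mean (Finset.range k) (fun _ => 1) z (fun _ _ => zero_le_one)
    (by simpa using hk') fun i _ => hz i
  simp only [Real.rpow_one, Finset.sum_const, Finset.card_range, nsmul_eq_mul, mul_one,
    one_mul] at h
  have hp : 0 ≤ ∏ i ∈ Finset.range k, z i := Finset.prod_nonneg fun i _ => hz i
  calc ∏ i ∈ Finset.range k, z i = ((∏ i ∈ Finset.range k, z i) ^ ((k : ℝ)⁻¹)) ^ k := by
        rw [Real.rpow_inv_natCast_pow hp (by omega)]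
    _ ≤ (S / k) ^ k := by
        refine pow_le_pow_left₀ (Real.rpow_nonneg hp _) (h.trans ?_) k
        gcongr

theorem NoGaps.card_tuples_le (h : G.NoGaps) (hk : 1 ≤ G.d / 2) :
    (G.tuples.card : ℝ) ≤
      3 * ((Fintype.card V : ℝ) / ((G.d / 2 : ℕ) : ℝ)) ^ (G.d / 2) := by
  set k := G.d / 2 with hkdef
  set n := Fintype.card V with hn
  have hkn : k ≤ n := by
    have := h.two_mul_le
    omega
  have hk' : (0 : ℝ) < k := by exact_mod_cast hk
  have hn' : (0 : ℝ) < n := by exact_mod_cast hk.trans hkn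
  have hprod : (G.tuples.card : ℝ) ≤ (((n : ℝ) + 1) / k) ^ k := by
    rw [card_tuples, Nat.cast_prod]
    refine prod_le_div_pow hk (fun j => ((G.numPrio (2 * j + 1) + 1 : ℕ) : ℝ))
      (fun _ => Nat.cast_nonneg _) ?_
    exact_mod_cast h.sum_le
  -- The price of replacing `n + 1` by `n` in the base is at most `e`, because `k ≤ n`.
  have hexp : (1 + 1 / (n : ℝ)) ^ k ≤ 3 := by
    calc (1 + 1 / (n : ℝ)) ^ k ≤ (1 + 1 / (n : ℝ)) ^ n := by
          refine pow_le_pow_right₀ ?_ hkn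
          have : 0 ≤ 1 / (n : ℝ) := by positivity
          linarith
      _ ≤ (Real.exp (1 / (n : ℝ))) ^ n := by
          refine pow_le_pow_left₀ (by positivity) ?_ n
          rw [add_comm]
          exact Real.add_one_le_exp _
      _ = Real.exp 1 := by
          rw [← Real.exp_nat_mul]
          congr 1
          field_simp
      _ ≤ 3 := by linarith [Real.exp_one_lt_d9]
  have heq : ((n : ℝ) + 1) / k = (1 + 1 / (n : ℝ)) * (n / k) := by
    field_simp
  rw [heq, mul_pow] at hprod
  refine hprod.trans ?_
  gcongr

/-- Absorbs the number of rounds, which may be as large as `n`, into the bound on the number of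
measures. -/
theorem NoGaps.card_le (h : G.NoGaps) (hk : 1 ≤ G.d / 2) :
    (Fintype.card V : ℝ) ≤ 2 * ((Fintype.card V : ℝ) / ((G.d / 2 : ℕ) : ℝ)) ^ (G.d / 2) ∧
      1 ≤ ((Fintype.card V : ℝ) / ((G.d / 2 : ℕ) : ℝ)) ^ (G.d / 2) := by
  have h2 := h.two_mul_le
  obtain ⟨k, hk⟩ := Nat.exists_eq_add_of_le' hk
  rw [hk] at h2 ⊢
  set n := Fintype.card V with hn
  have hk' : (0 : ℝ) < ((k + 1 : ℕ) : ℝ) := by positivity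
  set y : ℝ := (n : ℝ) / ((k + 1 : ℕ) : ℝ) with hy
  have hny : (n : ℝ) = y * (k + 1) := by
    rw [hy]
    push_cast
    field_simp
  have hy1 : 1 ≤ y := by
    rw [hy, le_div_iff₀ hk', one_mul]
    exact_mod_cast (by omega : k + 1 ≤ n)
  refine ⟨?_, one_le_pow₀ hy1⟩
  -- Here `k + 1` is `⌊d/2⌋`. For `k ≥ 1` the inequality `2(k+1) ≤ n + 1` gives `y ≥ 3/2`, and
  -- Bernoulli's inequality applies; then `2 y^(k+1) ≥ (k+2) y ≥ n`.
  have hpow : 1 + (k : ℝ) * (1 / 2) ≤ y ^ k := by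
    rcases Nat.eq_zero_or_pos k with rfl | hkpos
    · simp
    · have h32 : (3 / 2 : ℝ) ≤ y := by
        rw [hy, le_div_iff₀ hk']
        have : (2 * (k + 1) : ℝ) ≤ n + 1 := by exact_mod_cast h2
        have : (1 : ℝ) ≤ k := by exact_mod_cast hkpos
        push_cast
        linarith
      calc 1 + (k : ℝ) * (1 / 2) ≤ (1 + 1 / 2) ^ k := one_add_mul_le_pow (by norm_num) k
        _ ≤ y ^ k := pow_le_pow_left₀ (by norm_num) (by linarith) k
  rw [pow_succ, hny]
  nlinarith [mul_le_mul_of_nonneg_left hpow (by linarith : 0 ≤ y)]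

/-! ### Correctness and running time -/

variable [DecidableEq V]

theorem context_univ : Context G (fun _ => Meas.tup fun _ => 0) Finset.univ 0 where
  prio_le _ _ := Nat.zero_le _
  ne_top _ _ := by simp
  exists_succ u _ := by
    obtain ⟨w, hw⟩ := G.total u
    exact ⟨w, Finset.mem_univ w, hw⟩
  even_out _ _ _ x hx := absurd (Finset.mem_univ x) hx
  odd_out _ _ _ x hx := absurd (Finset.mem_univ x) hx
  bound x hx := absurd (Finset.mem_univ x) hx

theorem potential_le (R : G.Input) (ρ : V → Meas G.d) :
    potential R ρ ≤ 36 * (G.tuples.card * (G.d * G.numEdges)) := by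
  have h1 : potential R ρ ≤ ∑ v, liftCost R v * G.tuples.card :=
    Finset.sum_le_sum fun v _ => Nat.mul_le_mul_left _ (height_le _)
  have h2 : ∑ v, liftCost R v = 12 * G.d * (Fintype.card V + G.numEdges + G.numEdges) := by
    unfold liftCost
    rw [← Finset.mul_sum, Finset.sum_add_distrib, Finset.sum_add_distrib, R.sum_succ, R.sum_pred]
    simp
  rw [← Finset.sum_mul, h2] at h1
  refine h1.trans ?_
  have h3 : 12 * G.d * (Fintype.card V + G.numEdges + G.numEdges) ≤
      36 * (G.d * G.numEdges) := by
    have := Nat.mul_le_mul_left G.d R.card_le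
    calc 12 * G.d * (Fintype.card V + G.numEdges + G.numEdges)
        = 12 * (G.d * Fintype.card V + G.d * G.numEdges + G.d * G.numEdges) := by ring
      _ ≤ 36 * (G.d * G.numEdges) := by omega
  calc _ ≤ 36 * (G.d * G.numEdges) * G.tuples.card := Nat.mul_le_mul_right _ h3
    _ = _ := by ring

/-- The three summands are the liftings (`potential_le`), the rounds at `3 · 100` each, and `100`
for the outermost call together with the input and output phases, which need fewer than `20` units
of `dm`. -/
theorem solve_spec [Nonempty V] (R : G.Input) (pol : LiftingPolicy V) :
    ∃ r : Result V, (∃ b₀, ∀ b ≥ b₀, G.solve R pol b = some r) ∧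
      IsCompl (r.winEven : Set V) (r.winOdd : Set V) ∧
      G.IsPositionalWinning Player.even (r.winEven : Set V) r.stratEven ∧
      G.IsPositionalWinning Player.odd (r.winOdd : Set V) r.stratOdd ∧
      r.time ≤ (36 * G.tuples.card + 300 * openCount (G := G) (fun _ => Meas.tup fun _ => 0) + 120) *
        (G.d * G.numEdges) := by
  obtain ⟨s, ⟨b₀, hb₀⟩, o⟩ := spmWithin_spec R pol _ Finset.univ (initState R) 0 rfl context_univ
    reached_zero (by
      intro v w hvw
      simp [initState] at hvw)
  have hEven : ((Finset.univ.filter fun v => (s.rho v).isTop = false : Finset V) : Set V) =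
      {v | s.rho v ≠ Meas.top} := by
    ext v
    simp [Meas.isTop_eq_false_iff]
  refine ⟨_, ⟨b₀, fun b hb => by rw [solve, hb₀ b hb]⟩, ?_, ?_, ?_, ?_⟩
  · dsimp only
    refine ⟨Set.disjoint_left.2 fun v hv hv' => ?_, codisjoint_iff_le_sup.2 fun v _ => ?_⟩
    · rw [Finset.mem_coe, Finset.mem_filter] at hv hv'
      simp [hv.2] at hv'
    · rcases h : (s.rho v).isTop with _ | _
      · exact Or.inl (by simp [h])
      · exact Or.inr (by simp [h])
  · dsimp only
    rw [hEven]
    exact isPositionalWinning_even R o.reached.mem fun u hu => o.stable u (Finset.mem_univ u) hu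
  · exact o.trap.isPositionalWinning o.strategy
  · dsimp only
    have ht := o.time
    have hp := potential_le R (initState R).rho
    have hinit : (initState R).time = 1 + G.d + (G.d + 5) * R.verts.length +
      (R.verts.map fun v => (R.succ v).length + (R.pred v).length).sum := rfl
    rw [R.sum_verts, Finset.sum_add_distrib, R.sum_succ, R.sum_pred, R.length_verts,
      Nat.add_mul] at hinit
    rw [R.sum_verts, Finset.sum_add_distrib, ← Finset.mul_sum, R.sum_succ, Finset.sum_const,
      Finset.card_univ, smul_eq_mul, Nat.add_mul]
    have hm := numEdges_pos R
    have hnm := R.card_le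
    have hdm := Nat.mul_le_mul_right G.numEdges (one_le_d G)
    have hdm' := Nat.mul_le_mul_left G.d hm
    have hdn := Nat.mul_le_mul_left G.d hnm
    have hcount : 3 * G.roundCost * openCount (initState R).rho =
        300 * (openCount (G := G) (fun _ => Meas.tup fun _ => 0) * (G.d * G.numEdges)) := by
      change 3 * (100 * (G.d * G.numEdges)) * openCount (G := G) (fun _ => Meas.tup fun _ => 0) = _
      ring
    have hD : G.roundCost = 100 * (G.d * G.numEdges) := rfl
    rw [Nat.add_mul, Nat.add_mul, Nat.mul_assoc, Nat.mul_assoc]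
    omega

theorem openCount_eq_zero (hd : G.d / 2 = 0) (ρ : V → Meas G.d) : openCount ρ = 0 := by
  rw [openCount, Finset.card_eq_zero]
  refine Finset.filter_false_of_mem fun v _ hv => ?_
  have h1 := prio_lt_d G v
  have h2 := hv.1.pos
  omega

theorem NoGaps.count_le [Nonempty V] (h : G.NoGaps) :
    36 * (G.tuples.card : ℝ) + 300 * (openCount (G := G) (fun _ => Meas.tup fun _ => 0) : ℝ) + 120 ≤
      1000 * ((Fintype.card V : ℝ) / ((G.d / 2 : ℕ) : ℝ)) ^ (G.d / 2) := by
  rcases Nat.eq_zero_or_pos (G.d / 2) with hd | hd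
  -- For `d = 1` the base is a division by zero, but the exponent is `0` and the power is `1`, as
  -- the convention demands.
  · rw [openCount_eq_zero hd, card_tuples, hd]
    norm_num
  · have h1 := h.card_tuples_le hd
    obtain ⟨h2, h3⟩ := h.card_le hd
    have h4 : (openCount (G := G) (fun _ => Meas.tup fun _ => 0) : ℝ) ≤ Fintype.card V := by
      exact_mod_cast Finset.card_filter_le _ _
    -- The coefficients add up to `36·3 + 300·2 + 120 = 828`.
    linarith

end ParityGame

theorem mainTheorem2 :
    ∃ C : ℝ, ∀ (V : Type u) [Fintype V] [DecidableEq V] [Nonempty V]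
      (G : ParityGame V) (R : G.Input) (pol : ParityGame.LiftingPolicy V),
      ∃ r : ParityGame.Result V,
        (∃ b₀ : ℕ, ∀ b ≥ b₀, G.solve R pol b = some r) ∧
        (r.winEven : Set V) = G.winRegion Player.even ∧
        (r.winOdd : Set V) = G.winRegion Player.odd ∧
        IsCompl (r.winEven : Set V) (r.winOdd : Set V) ∧
        G.IsPositionalWinning Player.even (r.winEven : Set V) r.stratEven ∧
        G.IsPositionalWinning Player.odd (r.winOdd : Set V) r.stratOdd ∧
        (G.NoGaps →
          (r.time : ℝ) ≤ C * (G.d * G.numEdges *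
            ((Fintype.card V : ℝ) / ((G.d / 2 : ℕ) : ℝ)) ^ (G.d / 2))) := by
  refine ⟨1000, fun V _ _ _ G R pol => ?_⟩
  obtain ⟨r, h1, h2, h3, h4, h5⟩ := ParityGame.solve_spec R pol
  obtain ⟨h6, h7⟩ := ParityGame.winRegion_eq h2 h3 h4
  refine ⟨r, h1, h6, h7, h2, h3, h4, fun hgaps => ?_⟩
  have h8 : (r.time : ℝ) ≤ (36 * (G.tuples.card : ℝ) +
      300 * (ParityGame.openCount (G := G) (fun _ => Meas.tup fun _ => 0) : ℝ) + 120) *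
      (G.d * G.numEdges) := by
    exact_mod_cast h5
  refine h8.trans ((mul_le_mul_of_nonneg_right hgaps.count_le (by positivity)).trans_eq ?_)
  ring
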